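/- Theorem (Riemann–Roch). Let $K$ be a global field (a number field, or a function field in one variable over a finite field), let $\mathbb{A}_K$ be its adèle ring, in which $K$ is embedded diagonally, and let $\mathbb{I}_K=\mathbb{A}_K^\times$ be its idèle group, with $|x|=\prod_v |x_v|_v$ the product of the normalized absolute values. Let $\psi:\mathbb{A}_K\to S^1$ be a non-trivial continuous unitary character that is trivial on $K$, and let $dx$ be the Haar measure on $\mathbb{A}_K$ that is self-dual for $\psi$. Let $\mathcal{S}(\mathbb{A}_K)=\bigotimes'_v\mathcal{S}(K_v)$ be the space of adèlic Schwartz–Bruhat functions, i.e. the complex linear span of the functions $x\mapsto\prod_v f_v(x_v)$ with $f_v$ a Schwartz function on $K_v$ for $v$ Archimedean, $f_v$ locally constant with compact support on $K_v$ for $v$ non-Archimedean, and $f_v$ the characteristic function of $\mathcal{O}_v$ for almost all $v$. For $f\in\mathcal{S}(\mathbb{A}_K)$ put $$\hat f(y)=\int_{\mathbb{A}_K} f(x)\,\psi(xy)\,dx .$$ Self-duality of $dx$ means that $\hat{\hat f}(x)=f(-x)$ for all $f\in\mathcal{S}(\mathbb{A}_K)$ and $x\in\mathbb{A}_K$. Then,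 for every $f\in\mathcal{S}(\mathbb{A}_K)$ and every idèle $x\in\mathbb{I}_K$, the series $\sum_{\gamma\in K}f(\gamma x)$ and $\sum_{\gamma\in K}\hat f(\gamma x^{-1})$ converge absolutely and $$\sum_{\gamma\in K} f(\gamma x)=\frac{1}{|x|}\sum_{\gamma\in K}\hat f(\gamma x^{-1}).$$ -/

import Mathlib

open IsDedekindDomain
open scoped RestrictedProduct
noncomputable section
namespace GlobalField
variable (K : Type*) [Field K]

/-- The finite (non-Archimedean) places of `K`, each given by its valuation ring: the discrete
valuation rings in `K` with fraction field `K`. (For a global field every nontrivial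
non-Archimedean absolute value is discrete, and its equivalence class is determined by its
valuation ring.) -/
def FinitePlace : Type _ := {A : ValuationSubring K // IsDiscreteValuationRing A}

variable {K}
namespace FinitePlace
instance (v : FinitePlace K) : IsDiscreteValuationRing v.1 := v.2

/-- The maximal ideal of the valuation ring of `v`, as a height one prime. -/
def prime (v : FinitePlace K) : HeightOneSpectrum v.1 := IsDiscreteValuationRing.maximalIdeal v.1

/-- The completion `K_v`. -/
abbrev Completion (v : FinitePlace K) : Type _ := v.prime.adicCompletion K

/-- The ring of integers `O_v` of `K_v`. -/
abbrev integers (v : FinitePlace K) : ValuationSubring v.Completion :=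
  v.prime.adicCompletionIntegers K

theorem valuation_le_one_iff (v : FinitePlace K) (k : K) : v.prime.valuation K k ≤ 1 ↔ k ∈ v.1 := by
  constructor
  · intro h
    obtain ⟨a, rfl⟩ := IsDiscreteValuationRing.exists_lift_of_le_one h
    exact a.2
  · intro h
    exact v.prime.valuation_le_one (K := K) ⟨k, h⟩


/-- Weak approximation: an element that is a unit at one of finitely many places and lies in the
maximal ideal at the others. -/
theorem exists_unit_of_injective {n : ℕ} {v : Fin n → FinitePlace K} (hv : Function.Injective v)
    (i : Fin n) : ∃ e : K, (v i).prime.valuation K e = 1 ∧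
      ∀ j ≠ i, (v j).prime.valuation K e < 1 := by
  have h2 : (1 : NNReal) < 2 := one_lt_two
  have hlt (w : FinitePlace K) (a : K) :
      w.prime.adicAbv h2 a < 1 ↔ w.prime.valuation K a < 1 := by
    rw [← WithZeroMulInt.toNNReal_lt_one_iff h2, ← NNReal.coe_lt_coe]; rfl
  have hle (w : FinitePlace K) (a : K) :
      w.prime.adicAbv h2 a ≤ 1 ↔ w.prime.valuation K a ≤ 1 := by
    rw [← WithZeroMulInt.toNNReal_le_one_iff h2, ← NNReal.coe_le_coe]; rfl
  obtain ⟨a, ha, haj⟩ := AbsoluteValue.exists_one_lt_lt_one_pi_of_not_isEquiv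
    (v := fun j => (v j).prime.adicAbv (K := K) h2) (fun j => by
      obtain ⟨π, hπ⟩ := (v j).prime.valuation_exists_uniformizer K
      refine ⟨π, fun h => by rw [h, map_zero] at hπ; exact WithZero.exp_ne_zero hπ.symm, ?_⟩
      refine ((hlt _ _).2 ?_).ne
      rw [hπ, ← WithZero.exp_zero, WithZero.exp_lt_exp]; norm_num)
    (fun j k hjk h => hjk (hv (Subtype.ext (SetLike.ext fun x => by
      rw [← valuation_le_one_iff, ← valuation_le_one_iff, ← hle, ← hle]
      exact h.le_one_iff)))) i
  have ha' : 1 < (v i).prime.valuation K a := not_le.1 fun h => ha.not_ge ((hle _ _).2 h)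
  refine ⟨a / (1 + a), ?_, fun j hj => ?_⟩
  · have : (v i).prime.valuation K (1 + a) = (v i).prime.valuation K a :=
      Valuation.map_add_eq_of_lt_right ((v i).prime.valuation K) (x := 1) (by rw [map_one]; exact ha')
    rw [map_div₀, this, div_self]
    exact (zero_lt_one.trans ha').ne'
  · have hj' := (hlt _ _).1 (haj j hj)
    have : (v j).prime.valuation K (1 + a) = 1 := Valuation.map_one_add_of_lt _ hj'
    rwa [map_div₀, this, div_one]

/-- Over a domain `R₀` whose fraction field `L` satisfies `[K : L] < ∞`, only finitely many finite
places of `K` are centred at a given element `π`. -/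
theorem finite_of_center {R₀ L : Type*} [CommRing R₀] [IsDomain R₀] [Field L] [Algebra R₀ L]
    [IsFractionRing R₀ L] [Algebra R₀ K] [Algebra L K] [IsScalarTower R₀ L K]
    [FiniteDimensional L K] (π : R₀) (hπ : π ≠ 0) (hπ0 : ∀ c : R₀, (∀ n : ℕ, π ^ n ∣ c) → c = 0)
    (S : Set (FinitePlace K))
    (hle : ∀ v ∈ S, ∀ c : R₀, v.prime.valuation K (algebraMap R₀ K c) ≤ 1)
    (hlt : ∀ v ∈ S, ∀ c : R₀, v.prime.valuation K (algebraMap R₀ K c) < 1 → π ∣ c) :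
    S.Finite := by
  by_contra hS
  obtain ⟨f, -⟩ : ∃ f : ℕ → S, Function.Injective f :=
    ⟨_, (Set.Infinite.natEmbedding S hS).injective⟩
  set n := Module.finrank L K + 1
  let g : Fin n → FinitePlace K := fun i => (Set.Infinite.natEmbedding S hS i).1
  have hg : Function.Injective g := fun i j h =>
    Fin.ext ((Set.Infinite.natEmbedding S hS).injective (Subtype.ext h))
  have hgS (i) : g i ∈ S := (Set.Infinite.natEmbedding S hS i).2
  choose e he hej using exists_unit_of_injective hg
  have key (c : Fin n → R₀) (hc : ∑ i, c i • e i = 0) (i : Fin n) : π ∣ c i := by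
    refine hlt _ (hgS i) _ ?_
    have h1 : c i • e i = -∑ j ∈ Finset.univ.erase i, c j • e j := by
      rw [eq_neg_iff_add_eq_zero, Finset.add_sum_erase _ (fun j => c j • e j) (Finset.mem_univ i), hc]
    have h2 : (g i).prime.valuation K (c i • e i) < 1 := by
      rw [h1, Valuation.map_neg]
      refine Valuation.map_sum_lt _ one_ne_zero fun j hj => ?_
      rw [Algebra.smul_def, map_mul]
      exact mul_lt_one_of_nonneg_of_lt_one_right (hle _ (hgS i) _) zero_le
        (hej j i (Finset.ne_of_mem_erase hj).symm)
    rwa [Algebra.smul_def, map_mul, he, mul_one] at h2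
  have key2 (m : ℕ) : ∀ c : Fin n → R₀, ∑ i, c i • e i = 0 → ∀ i, π ^ m ∣ c i := by
    induction m with
    | zero => simp
    | succ m ih =>
      intro c hc i
      choose d hd using key c hc
      have hd0 : ∑ i, d i • e i = 0 := by
        have h3 : π • ∑ i, d i • e i = 0 := by
          rw [Finset.smul_sum, ← hc]
          exact Finset.sum_congr rfl fun i _ => by rw [smul_smul, ← hd]
        rw [Algebra.smul_def] at h3
        refine (mul_eq_zero.1 h3).resolve_left fun h => hπ ?_
        rw [IsScalarTower.algebraMap_apply R₀ L K] at h
        exact IsFractionRing.injective R₀ L (by simpa using h)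
      rw [pow_succ', hd i]
      exact mul_dvd_mul_left _ (ih d hd0 i)
  have hli : LinearIndependent R₀ e :=
    Fintype.linearIndependent_iff.2 fun c hc i => hπ0 _ fun m => key2 m c hc i
  have := ((LinearIndependent.iff_fractionRing R₀ L).1 hli).fintype_card_le_finrank
  simp [n] at this

end FinitePlace

/-- `K` is a global field: a number field, or a function field in one variable over a finite
field, i.e. a finite extension of `F(X)` for some finite field `F`. -/
class IsGlobalField (K : Type*) [Field K] : Prop where
  numberField_or_functionField : NumberField K ∨
    ∃ (F : Type) (_ : Field F) (_ : Finite F) (_ : Algebra (RatFunc F) K), FunctionField F K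

namespace FinitePlace

theorem finite_not_mem_of_numberField [NumberField K] (k : K) :
    {v : FinitePlace K | k ∉ v.1}.Finite := by
  have hZ (v : FinitePlace K) (c : ℤ) : v.prime.valuation K (c : K) ≤ 1 :=
    (valuation_le_one_iff v _).2 (intCast_mem v.1 c)
  have hfin (p : ℕ) (hp : p.Prime) : {v : FinitePlace K | v.prime.valuation K (p : K) < 1}.Finite := by
    refine finite_of_center (R₀ := ℤ) (L := ℚ) (p : ℤ) (mod_cast hp.ne_zero) ?_ _
      (fun v _ c => by simpa using hZ v c) ?_
    · intro c hc
      by_contra h0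
      exact (Int.finiteMultiplicity_iff.2
        ⟨by simpa using hp.ne_one, h0⟩ : FiniteMultiplicity (p : ℤ) c).not_pow_dvd_of_multiplicity_lt
          (Nat.lt_succ_self _) (hc _)
    · intro v hv c hc
      by_contra h
      obtain ⟨a, b, hab⟩ := ((Nat.prime_iff_prime_int.1 hp).coprime_iff_not_dvd).2 h
      have h1 : (a : K) * (p : K) + (b : K) * (c : K) = 1 := mod_cast congrArg (Int.cast (R := K)) hab
      have h2 : v.prime.valuation K ((a : K) * (p : K) + (b : K) * (c : K)) < 1 := by
        refine Valuation.map_add_lt _ ?_ ?_ <;> rw [map_mul]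
        · exact mul_lt_one_of_nonneg_of_lt_one_right (hZ v a) zero_le hv
        · exact mul_lt_one_of_nonneg_of_lt_one_right (hZ v b) zero_le (by simpa using hc)
      rw [h1, map_one] at h2
      exact h2.false
  have halg : IsAlgebraic ℤ k :=
    (IsFractionRing.isAlgebraic_iff ℤ ℚ K).2 (Algebra.IsAlgebraic.isAlgebraic k)
  obtain ⟨d, hd0, hd⟩ := halg.exists_integral_multiple
  refine ((d.natAbs.primeFactors.finite_toSet).biUnion
    fun p hp => hfin p (Nat.prime_of_mem_primeFactors hp)).subset fun v hv => ?_
  have hmem : v.prime.valuation K (d • k) ≤ 1 := by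
    have : IsIntegral v.1 (d • k) := by
      obtain ⟨q, hqm, hq⟩ := hd
      refine ⟨q.map (Int.castRingHom v.1), hqm.map _, ?_⟩
      rw [Polynomial.eval₂_map, show (algebraMap v.1 K).comp (Int.castRingHom v.1) =
        algebraMap ℤ K from RingHom.ext_int _ _]
      exact hq
    obtain ⟨y, hy⟩ := IsIntegrallyClosed.isIntegral_iff.1 this
    rw [valuation_le_one_iff, ← hy]
    exact y.2
  have hvk : 1 < v.prime.valuation K k := not_le.1 fun h => hv ((valuation_le_one_iff v _).1 h)
  have hd1 : v.prime.valuation K (d : K) < 1 := by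
    refine lt_of_le_of_ne (hZ v d) fun h => ?_
    rw [zsmul_eq_mul, map_mul, h, one_mul] at hmem
    exact hmem.not_gt hvk
  by_contra hall
  simp only [Set.mem_iUnion, not_exists, SetLike.mem_coe, Set.mem_ofPred_eq, not_lt] at hall
  have h1 (m : ℕ) (hm0 : m ≠ 0) (hm : ∀ p ∈ m.primeFactors, 1 ≤ v.prime.valuation K (p : K)) :
      1 ≤ v.prime.valuation K (m : K) := by
    rw [← Nat.prod_factorization_pow_eq_self hm0, Finsupp.prod, Nat.cast_prod, map_prod]
    refine Finset.one_le_prod' fun p hp => ?_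
    rw [Nat.cast_pow, map_pow]
    exact one_le_pow_of_one_le' (hm p (by simpa using hp)) _
  have h2 := h1 d.natAbs (Int.natAbs_ne_zero.2 hd0) hall
  rcases Int.natAbs_eq d with h | h
  · rw [h] at hd1; exact hd1.not_ge (by simpa using h2)
  · rw [h] at hd1; exact hd1.not_ge (by simpa using h2)

theorem finite_not_mem_of_functionField (F : Type) [Field F] [Finite F] [Algebra (RatFunc F) K]
    [FunctionField F K] (k : K) : {v : FinitePlace K | k ∉ v.1}.Finite := by
  let _ : Algebra F K := Algebra.compHom K (algebraMap F (RatFunc F))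
  have : IsScalarTower F (RatFunc F) K := IsScalarTower.of_algebraMap_eq fun _ => rfl
  have hF (v : FinitePlace K) (c : F) (hc : c ≠ 0) : v.prime.valuation K (algebraMap F K c) = 1 := by
    have := Fintype.ofFinite F
    have h : (v.prime.valuation K (algebraMap F K c)) ^ (Fintype.card F - 1) = 1 := by
      rw [← map_pow, ← map_pow, FiniteField.pow_card_sub_one_eq_one c hc, map_one, map_one]
    by_contra h1
    have hn : Fintype.card F - 1 ≠ 0 := Nat.sub_ne_zero_of_lt Fintype.one_lt_card
    rcases lt_or_gt_of_ne h1 with h1 | h1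
    · exact (pow_lt_one₀ zero_le h1 hn).ne h
    · exact (one_lt_pow₀ h1 hn).ne' h
  have hF' (v : FinitePlace K) (c : F) : v.prime.valuation K (algebraMap F K c) ≤ 1 := by
    by_cases hc : c = 0
    · simp [hc]
    · exact (hF v c hc).le
  by_cases hk : IsAlgebraic F k
  · convert Set.finite_empty
    refine Set.eq_empty_of_forall_notMem fun v hv => hv ?_
    have : IsIntegral v.1 k := by
      obtain ⟨p, hpm, hp⟩ := hk.isIntegral
      let φ : F →+* v.1 := (algebraMap F K).codRestrict v.1.toSubring
        (fun c => (valuation_le_one_iff v _).1 (hF' v c))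
      exact ⟨p.map φ, hpm.map φ, by rw [Polynomial.eval₂_map]; exact hp⟩
    obtain ⟨y, hy⟩ := IsIntegrallyClosed.isIntegral_iff.1 this
    rw [← hy]; exact y.2
  have hk : Transcendental F k⁻¹ := fun h => hk (by simpa using h.inv)
  have hfin := FunctionField.finiteDimensional_of_adjoin_transcendental hk
  open scoped IntermediateField.algebraAdjoinAdjoin in
  set y := k⁻¹ with hy
  have hy0 : y ≠ 0 := fun h => hk (h ▸ isAlgebraic_zero)
  let R₀ := Algebra.adjoin F {y}
  let π : R₀ := ⟨y, Algebra.self_mem_adjoin_singleton F y⟩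
  have hsurj (c : R₀) : ∃ p : Polynomial F, Polynomial.aeval y p = (c : K) := by
    exact (AlgHom.mem_range _).1 (Algebra.adjoin_singleton_eq_range_aeval F y ▸ c.2)
  have hinj := transcendental_iff_injective.1 hk
  have hlt (v : FinitePlace K) (hv : k ∉ v.1) : v.prime.valuation K y < 1 := by
    rw [hy, map_inv₀]
    exact inv_lt_one_of_one_lt₀ (not_le.1 fun h => hv ((valuation_le_one_iff _ _).1 h))
  have hpoly (v : FinitePlace K) (hv : k ∉ v.1) (p : Polynomial F) :
      v.prime.valuation K (Polynomial.aeval y p) ≤ 1 := by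
    rw [Polynomial.aeval_eq_sum_range]
    refine Valuation.map_sum_le _ fun i _ => ?_
    rw [Algebra.smul_def, map_mul, map_pow]
    exact mul_le_one' (hF' v _) (pow_le_one' (hlt v hv).le _)
  refine finite_of_center (R₀ := R₀) (L := IntermediateField.adjoin F {y}) π ?_ ?_ _ ?_ ?_
  · exact fun h => hy0 (congrArg Subtype.val h)
  · intro c hc
    obtain ⟨p, hp⟩ := hsurj c
    have : p = 0 := by
      by_contra hp0
      obtain ⟨d, hd⟩ := hc (p.natDegree + 1)
      obtain ⟨q, hq⟩ := hsurj d
      have h1 : p = Polynomial.X ^ (p.natDegree + 1) * q := hinj (by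
        rw [hp, hd]; simp [hq, π])
      have := Polynomial.natDegree_le_of_dvd (Dvd.intro _ h1.symm) hp0
      simp at this
    exact Subtype.ext (by rw [← hp, this]; simp)
  · intro v hv c
    obtain ⟨p, hp⟩ := hsurj c
    change v.prime.valuation K (c : K) ≤ 1
    rw [← hp]; exact hpoly v hv p
  · intro v hv c hc
    obtain ⟨p, hp⟩ := hsurj c
    change v.prime.valuation K (c : K) < 1 at hc
    have h1 : (c : K) = y * Polynomial.aeval y p.divX + algebraMap F K (p.coeff 0) := by
      have := congrArg (Polynomial.aeval y) (Polynomial.X_mul_divX_add p)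
      rw [← hp, ← this, map_add, map_mul, Polynomial.aeval_X, Polynomial.aeval_C]
    have h2 : v.prime.valuation K (algebraMap F K (p.coeff 0)) < 1 := by
      rw [eq_sub_of_add_eq' h1.symm]
      refine Valuation.map_sub_lt _ hc ?_
      rw [map_mul]
      exact mul_lt_one_of_lt_of_le (hlt v hv) (hpoly v hv _)
    have h3 : p.coeff 0 = 0 := by
      by_contra h
      exact h2.ne (hF v _ h)
    refine ⟨⟨Polynomial.aeval y p.divX, ?_⟩, Subtype.ext ?_⟩
    · exact Polynomial.aeval_mem_adjoin_singleton F y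
    · rw [h1, h3]; simp [π]

/-- An element of a global field is integral at all but finitely many finite places. -/
theorem finite_not_mem [IsGlobalField K] (k : K) : {v : FinitePlace K | k ∉ v.1}.Finite := by
  rcases IsGlobalField.numberField_or_functionField (K := K) with h | ⟨F, _, _, _, h⟩
  · exact finite_not_mem_of_numberField k
  · exact finite_not_mem_of_functionField F k

open Classical in
/-- The normalized absolute value on `K_v`: `|π|_v = 1 / q_v` for a uniformizer `π`, with `q_v` the
cardinality of the residue field. (`Valued.v π = exp (-1)` in `ℤᵐ⁰`.) -/
def absValue (v : FinitePlace K) (x : v.Completion) : ℝ :=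
  if x = 0 then 0
  else (Nat.card (IsLocalRing.ResidueField v.1) : ℝ) ^ (WithZero.log (Valued.v x))

/-- The Schwartz-Bruhat functions on `K_v`, `v` finite: locally constant with compact support. -/
def IsSchwartzBruhat (v : FinitePlace K) (f : v.Completion → ℂ) : Prop :=
  IsLocallyConstant f ∧ HasCompactSupport f

end FinitePlace

variable (K)

/-- The restricted product of the `K_v` with respect to the `O_v` over all finite places `v`. -/
def FiniteAdeleRing : Type _ := Πʳ v : FinitePlace K, [v.Completion, v.integers]

namespace FiniteAdeleRing

instance : CommRing (FiniteAdeleRing K) :=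
  inferInstanceAs (CommRing (Πʳ v : FinitePlace K, [v.Completion, v.integers]))

instance : TopologicalSpace (FiniteAdeleRing K) :=
  inferInstanceAs (TopologicalSpace (Πʳ v : FinitePlace K, [v.Completion, v.integers]))

instance : IsTopologicalRing (FiniteAdeleRing K) :=
  have : Fact (∀ v : FinitePlace K, IsOpen (v.integers : Set v.Completion)) :=
    ⟨fun _ => Valued.isOpen_valuationSubring _⟩
  RestrictedProduct.isTopologicalRing (fun v : FinitePlace K => v.Completion)

instance : DFunLike (FiniteAdeleRing K) (FinitePlace K) FinitePlace.Completion where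
  coe a := a.1
  coe_injective _ _ := Subtype.ext

/-- The diagonal embedding of `K`. -/
def diagonal [IsGlobalField K] : K →+* FiniteAdeleRing K where
  toFun k := ⟨fun v => (algebraMap K v.Completion k), by
    refine (FinitePlace.finite_not_mem k).subset fun v hv hk => hv ?_
    exact v.prime.coe_mem_adicCompletionIntegers (K := K) ⟨k, hk⟩⟩
  map_one' := Subtype.ext <| funext fun _ => map_one _
  map_mul' _ _ := Subtype.ext <| funext fun _ => map_mul _ _ _
  map_zero' := Subtype.ext <| funext fun _ => map_zero _
  map_add' _ _ := Subtype.ext <| funext fun _ => map_add _ _ _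

instance [IsGlobalField K] : Algebra K (FiniteAdeleRing K) := (diagonal K).toAlgebra

end FiniteAdeleRing

/-- The adele ring of a global field: the restricted product of all completions of `K`. The
Archimedean places are the infinite places of `K`; there are none for a function field, and then
`InfiniteAdeleRing K` is the empty product. -/
def AdeleRing : Type _ := NumberField.InfiniteAdeleRing K × FiniteAdeleRing K

namespace AdeleRing

instance : CommRing (AdeleRing K) :=
  inferInstanceAs (CommRing (NumberField.InfiniteAdeleRing K × FiniteAdeleRing K))

instance : TopologicalSpace (AdeleRing K) :=
  inferInstanceAs (TopologicalSpace (NumberField.InfiniteAdeleRing K × FiniteAdeleRing K))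

instance : IsTopologicalRing (AdeleRing K) :=
  inferInstanceAs (IsTopologicalRing (NumberField.InfiniteAdeleRing K × FiniteAdeleRing K))

instance : MeasurableSpace (AdeleRing K) := borel _

instance : BorelSpace (AdeleRing K) := ⟨rfl⟩

/-- `K` is embedded diagonally in its adele ring. -/
instance [IsGlobalField K] : Algebra K (AdeleRing K) :=
  inferInstanceAs (Algebra K (NumberField.InfiniteAdeleRing K × FiniteAdeleRing K))

end AdeleRing

/-- The idele group. -/
abbrev IdeleGroup : Type _ := (AdeleRing K)ˣ

variable {K}

/-- The absolute value `∏_v |x_v|_v` of an idele, with the normalized absolute value at each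
place: the usual one at a real place, the square of the usual one at a complex place. All but
finitely many factors are `1`. -/
def ideleNorm (x : IdeleGroup K) : ℝ :=
  (∏ᶠ v : NumberField.InfinitePlace K, ‖(x : AdeleRing K).1 v‖ ^ v.mult) *
    ∏ᶠ v : FinitePlace K, v.absValue ((x : AdeleRing K).2 v)

/-- The Schwartz functions on `K_v`, `v` Archimedean, through the identification of `K_v` with
`ℝ` or `ℂ`. -/
def IsSchwartz (v : NumberField.InfinitePlace K) (f : v.Completion → ℂ) : Prop :=
  (∃ hv : v.IsReal, ∃ g : SchwartzMap ℝ ℂ, ∀ x,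
    f x = g (NumberField.InfinitePlace.Completion.extensionEmbeddingOfIsReal hv x)) ∨
  (v.IsComplex ∧ ∃ g : SchwartzMap ℂ ℂ, ∀ x,
    f x = g (NumberField.InfinitePlace.Completion.extensionEmbedding v x))

/-- The pure tensors `x ↦ ∏_v f_v(x_v)`, where `f_v` is in the Schwartz-Bruhat space of `K_v` for
all `v` and is the characteristic function of `O_v` for almost all `v`. At each adele, all but
finitely many factors are `1`. -/
def IsPureTensor (f : AdeleRing K → ℂ) : Prop :=
  ∃ (g : ∀ v : NumberField.InfinitePlace K, v.Completion → ℂ)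
    (h : ∀ v : FinitePlace K, v.Completion → ℂ),
    (∀ v, IsSchwartz v (g v)) ∧ (∀ v, FinitePlace.IsSchwartzBruhat v (h v)) ∧
    (∀ᶠ v in Filter.cofinite, h v = Set.indicator (v.integers : Set v.Completion) 1) ∧
    ∀ x : AdeleRing K, f x = (∏ᶠ v, g v (x.1 v)) * ∏ᶠ v, h v (x.2 v)

variable (K) in
/-- The adelic Schwartz-Bruhat space: the restricted tensor product of the local Schwartz-Bruhat
spaces, i.e. the linear span of the pure tensors. -/
def schwartzBruhat : Submodule ℂ (AdeleRing K → ℂ) :=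
  Submodule.span ℂ {f | IsPureTensor f}

/-- The adelic Fourier transform `y ↦ ∫ f(x) ψ(xy) dx`. -/
def fourier (ψ : AddChar (AdeleRing K) Circle) (μ : MeasureTheory.Measure (AdeleRing K))
    (f : AdeleRing K → ℂ) (y : AdeleRing K) : ℂ :=
  ∫ x, f x * (ψ (x * y) : ℂ) ∂μ

/-- The measure `μ` is self-dual for `ψ`: Fourier inversion holds in the form
`(f^)^(x) = f(-x)`. -/
def IsSelfDual (ψ : AddChar (AdeleRing K) Circle) (μ : MeasureTheory.Measure (AdeleRing K)) :
    Prop :=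
  ∀ f ∈ schwartzBruhat K, ∀ x, fourier ψ μ (fourier ψ μ f) x = f (-x)

end GlobalField

end

open MeasureTheory Filter Topology Set
open scoped Pointwise

set_option linter.unusedSectionVars false

/-! ### Poisson summation for a discrete cocompact subgroup -/

section PoissonSummation

variable {A : Type*} [AddCommGroup A] [TopologicalSpace A] [IsTopologicalAddGroup A]

/-! The formula is Poisson summation for `K` inside its adele ring, applied to the dilated function
`y ↦ f (y * x)`. Multiplication by `x` scales Haar measure by `|x|` (`hasModulus_ideleNorm`), so the
transform of the dilated function is `|x|⁻¹` times the transform of `f` dilated by `x⁻¹`; this is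
where the factor comes from.

Poisson summation itself (`tsum_eq_tsum_fourierCoeff`) compares two continuous periodic functions:
the periodization of `f`, multiplied by the covolume, and the Fourier series of `f`. They have equal
coefficients, and on a compact quotient the coefficients determine the function, by
Stone–Weierstrass. The inputs are cocompactness of `K`, the fact that the characters `a ↦ ψ (a * k)`
have common kernel exactly `K`, and enough decay of `f` and its transform to sum them.

Cocompactness is proved by approximation over `ℤ` or `F[X]` (`exists_isCompact_of_approx`). The rest
about `K` is formal (`discrete_and_annihilator_eq`): if `ψ` is nondegenerate, the annihilator of a
cocompact field is discrete, hence meets finitely many classes modulo `K`, and being a vector space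
over the infinite field `K` it equals `K`.

Self-duality of the measure is used only as Fourier inversion for suitable functions, and in three
ways. It makes `ψ` nondegenerate, since a degenerate `ψ` would make all double transforms periodic
(`eq_zero_of_forall_mul_eq_one`). It makes the annihilator of the integral finite adeles compact,
since a transform must be integrable for its own transform to be nonzero (`isCompact_annihilator`).
And it makes the covolume `1`: Poisson summation for a positive even test function and then for its
transform shows that the square of the covolume is `1` (`tsum_eq_tsum_ringFourier`). No local
character or different has to be computed.

For the decay, every Schwartz–Bruhat function is a finite combination of boxes `g ⊗ 1_O(u a - c)`,
with `g` Schwartz on the Archimedean part and `O` the integral finite adeles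
(`mem_span_schwartzBox`). The transform of a box is a Schwartz-type factor times a phase times the
indicator of a multiple of the annihilator of `O` (`exists_ringFourier_schwartzBox`), so a box and
its transform have the same kind of bound. -/

/-- A discrete cocompact subgroup of a locally compact group has a relatively compact fundamental
domain. -/
theorem exists_isAddFundamentalDomain [LocallyCompactSpace A] [MeasurableSpace A] [BorelSpace A]
    (μ : Measure A) (Γ : AddSubgroup A) [DiscreteTopology Γ] {C : Set A} (hC : IsCompact C)
    (hΓC : ∀ a, ∃ γ ∈ Γ, γ + a ∈ C) :
    ∃ D : Set A, MeasurableSet D ∧ IsAddFundamentalDomain Γ D μ ∧ ∃ Q, IsCompact Q ∧ D ⊆ Q := by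
  obtain ⟨W, hW, hWΓ⟩ : ∃ W ∈ 𝓝 (0 : A), ∀ γ ∈ Γ, γ ∈ W → γ = 0 := by
    obtain ⟨W, hW, h⟩ := (mem_nhds_subtype (Γ : Set A) 0 {0}).1 (by
      rw [nhds_discrete]; exact rfl)
    exact ⟨W, hW, fun γ hγ hγW => congrArg Subtype.val (h (a := ⟨γ, hγ⟩) hγW)⟩
  obtain ⟨U, hU, hUW⟩ : ∃ U ∈ 𝓝 (0 : A), ∀ x ∈ U, ∀ y ∈ U, x - y ∈ W := by
    have h0 : Tendsto (fun p : A × A => p.1 - p.2) (𝓝 0 ×ˢ 𝓝 0) (𝓝 0) := by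
      have := (continuous_sub (G := A)).tendsto (0, 0)
      rwa [nhds_prod_eq, sub_zero] at this
    obtain ⟨U, hU, h⟩ := mem_prod_same_iff.1 (h0 hW)
    exact ⟨U, hU, fun x hx y hy => h (mk_mem_prod hx hy)⟩
  obtain ⟨Q, hQ, hQU, hQc⟩ := local_compact_nhds hU
  set V := interior Q
  have hV0 : (0 : A) ∈ V := mem_interior_iff_mem_nhds.2 hQ
  have hVo : IsOpen V := isOpen_interior
  obtain ⟨t, ht, htf, hCt⟩ := hC.elim_finite_subcover_image (b := C) (c := fun a => a +ᵥ V)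
    (fun a _ => hVo.vadd a) (fun a ha => mem_biUnion ha ⟨0, hV0, by simp⟩)
  obtain ⟨n, g, hg⟩ := htf.fin_param
  obtain ⟨hginj, hgr⟩ := hg
  let T : Fin n → Set A := fun i => {a | ∃ γ ∈ Γ, γ + a ∈ g i +ᵥ V}
  have hT (i) : IsOpen (T i) := by
    have : T i = ⋃ γ ∈ Γ, (fun a => γ + a) ⁻¹' (g i +ᵥ V) := by ext; simp [T]
    rw [this]
    exact isOpen_biUnion fun γ _ => (hVo.vadd _).preimage (continuous_const_add γ)
  have hTΓ (i) {γ a} (hγ : γ ∈ Γ) (h : γ + a ∈ T i) : a ∈ T i := by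
    obtain ⟨δ, hδ, h⟩ := h
    exact ⟨δ + γ, add_mem hδ hγ, by rwa [add_assoc]⟩
  have hTΓ' (i) {γ a} (hγ : γ ∈ Γ) (h : a ∈ T i) : γ + a ∈ T i :=
    hTΓ i (neg_mem hγ) (by simpa using h)
  -- `T i` is the `Γ`-saturation of the `i`-th translate of `V`. Removing the earlier saturations
  -- leaves each orbit only in the `S i` with `i` minimal; it meets that piece once, because
  -- differences of two points of a translate of `V` lie in `W`, which contains no nonzero element
  -- of `Γ`.
  let S : Fin n → Set A := fun i => (g i +ᵥ V) \ ⋃ j < i, T j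
  have hcov (a : A) : ∃ i, a ∈ T i := by
    obtain ⟨γ, hγ, h⟩ := hΓC a
    obtain ⟨b, hb, hab⟩ := mem_iUnion₂.1 (hCt h)
    obtain ⟨i, rfl⟩ := hgr.symm ▸ hb
    exact ⟨i, γ, hγ, hab⟩
  have hST {i a} (h : a ∈ S i) : a ∈ T i := ⟨0, zero_mem _, by simpa using h.1⟩
  refine ⟨⋃ i, S i, MeasurableSet.iUnion fun i => ((hVo.vadd _).measurableSet).diff
    (isOpen_biUnion fun j _ => hT j).measurableSet, IsAddFundamentalDomain.mk' ?_ ?_,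
    ⋃ i, g i +ᵥ Q, isCompact_iUnion fun i => hQc.vadd _, iUnion_mono fun i =>
      sdiff_subset.trans (vadd_set_mono interior_subset)⟩
  · exact (MeasurableSet.iUnion fun i => ((hVo.vadd _).measurableSet).diff
      (isOpen_biUnion fun j _ => hT j).measurableSet).nullMeasurableSet
  · intro a
    classical
    obtain ⟨i, hi, hmin⟩ := exists_minimal_of_wellFoundedLT (fun i => a ∈ T i) (hcov a)
    have hmin' : ∀ j < i, a ∉ T j := fun j hj h => (hmin h hj.le).not_gt hj
    have hSi {γ : A} (hγ : γ ∈ Γ) {j} (h : γ + a ∈ S j) : j = i := by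
      rcases lt_trichotomy j i with hj | hj | hj
      · exact (hmin' j hj (hTΓ j hγ (hST h))).elim
      · exact hj
      · exact (h.2 (mem_iUnion₂.2 ⟨i, hj, hTΓ' i hγ hi⟩)).elim
    obtain ⟨γ, hγ, hγa⟩ := hi
    refine ⟨⟨γ, hγ⟩, mem_iUnion.2 ⟨i, hγa, fun h => ?_⟩, ?_⟩
    · obtain ⟨j, hj, h⟩ := mem_iUnion₂.1 h
      exact hmin' j hj (hTΓ j hγ h)
    · rintro ⟨δ, hδ⟩ h
      obtain ⟨j, hj⟩ := mem_iUnion.1 h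
      obtain rfl := hSi hδ hj
      obtain ⟨x, hx, hx'⟩ := hj.1
      obtain ⟨y, hy, hy'⟩ := hγa
      have := hWΓ (δ - γ) (sub_mem hδ hγ) (by
        have h3 := hUW x (hQU (interior_subset hx)) y (hQU (interior_subset hy))
        have h4 : x - y = δ - γ := by
          have e1 : g j + x = δ + a := hx'
          have e2 : g j + y = γ + a := hy'
          have : (g j + x) - (g j + y) = (δ + a) - (γ + a) := by rw [e1, e2]
          simpa using this
        rwa [h4] at h3)
      exact Subtype.ext (sub_eq_zero.1 this)

variable [LocallyCompactSpace A] [T2Space A] [MeasurableSpace A] [BorelSpace A]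
  {μ : Measure A} [μ.IsAddHaarMeasure] {Γ : AddSubgroup A} [DiscreteTopology Γ] [Countable Γ]
  {D : Set A}

theorem Continuous.integrableOn_of_subset_isCompact {E : Type*} [NormedAddCommGroup E] {Q : Set A}
    (hQ : IsCompact Q) (hDQ : D ⊆ Q) {G : A → E} (hG : Continuous G) : IntegrableOn G D μ :=
  (hG.continuousOn.integrableOn_compact' hQ hQ.measurableSet).mono_set hDQ

/-- The integral over a fundamental domain of a periodic function is translation invariant. -/
theorem MeasureTheory.IsAddFundamentalDomain.setIntegral_translate
    (hD : IsAddFundamentalDomain Γ D μ) {G : A → ℂ} (hper : ∀ γ ∈ Γ, ∀ a, G (γ + a) = G a) (b : A) :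
    ∫ a in D, G (b + a) ∂μ = ∫ a in D, G a ∂μ := by
  have h1 : ∫ a in D, G (b + a) ∂μ = ∫ a in b +ᵥ D, G a ∂μ := by
    have := (measurePreserving_add_left μ b).setIntegral_image_emb
      (MeasurableEquiv.addLeft b).measurableEmbedding G D
    rw [← this]; rfl
  rw [h1]
  -- A translate of `D` is again a fundamental domain, and a periodic function has the same integral
  -- over any two of them.
  refine IsAddFundamentalDomain.setIntegral_eq (G := Γ) (hD.vadd_of_comm b) hD fun γ a => hper γ γ.2 a

variable {ι : Type*} [AddCommGroup ι] [Countable ι] {e : ι → AddChar A ℂ}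

/-- Uniqueness of Fourier coefficients on a compact quotient. -/
theorem eq_zero_of_fourierCoeff_eq_zero (hD : IsAddFundamentalDomain Γ D μ) {Q : Set A}
    (hQ : IsCompact Q) (hDQ : D ⊆ Q) {C : Set A} (hC : IsCompact C)
    (hΓC : ∀ a, ∃ γ ∈ Γ, γ + a ∈ C)
    (he_norm : ∀ i a, ‖e i a‖ = 1) (he_add : ∀ i j a, e (i + j) a = e i a * e j a) (he_cont : ∀ i, Continuous (e i))
    (he_Γ : ∀ i, ∀ γ ∈ Γ, e i γ = 1) (he_sep : ∀ a, (∀ i, e i a = 1) → a ∈ Γ)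
    {G : A → ℂ} (hG : Continuous G) (hper : ∀ γ ∈ Γ, ∀ a, G (γ + a) = G a)
    (h0 : ∀ i, ∫ a in D, G a * e i a ∂μ = 0) : G = 0 := by
  have hclosed : IsClosed (Γ : Set A) := AddSubgroup.isClosed_of_discrete
  let q : A → A ⧸ Γ := QuotientAddGroup.mk
  have hqc : Continuous q := continuous_quotient_mk'
  have : CompactSpace (A ⧸ Γ) := by
    refine ⟨(hC.image hqc).of_isClosed_subset isClosed_univ fun x _ => ?_⟩
    obtain ⟨a, rfl⟩ := QuotientAddGroup.mk_surjective x
    obtain ⟨γ, hγ, h⟩ := hΓC a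
    refine ⟨γ + a, h, ?_⟩
    rw [add_comm]
    exact QuotientAddGroup.mk_add_of_mem a hγ
  have hlift (F : A → ℂ) (hF : Continuous F) (hp : ∀ γ ∈ Γ, ∀ a, F (γ + a) = F a) :
      ∃ f : C(A ⧸ Γ, ℂ), ∀ a, f (q a) = F a := by
    have hp' : ∀ a b, (QuotientAddGroup.leftRel Γ) a b → F a = F b := fun a b hab => by
      rw [QuotientAddGroup.leftRel_apply] at hab
      have := hp _ hab a
      rwa [neg_add_cancel_comm, eq_comm] at this
    exact ⟨⟨Quotient.lift F hp', hF.quotient_lift hp'⟩, fun a => rfl⟩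
  obtain ⟨g, hg⟩ := hlift G hG hper
  choose χ hχ using fun i => hlift (fun a => e i a)
    (by have := he_cont i; fun_prop) (fun γ hγ a => by
      rw [AddChar.map_add_eq_mul, he_Γ i γ hγ, one_mul])
  have hq : Function.Surjective q := QuotientAddGroup.mk_surjective
  have he_zero (a) : e 0 a = 1 := by
    have h := he_add 0 0 a
    rw [add_zero, left_eq_mul₀] at h
    · exact h
    · exact fun h0 => by simpa [h0] using he_norm 0 a
  have he_neg (i a) : e (-i) a = star (e i a) := by
    have : e (-i) a = (e i a)⁻¹ := by
      refine eq_inv_of_mul_eq_one_left ?_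
      rw [← he_add, neg_add_cancel, he_zero]
    rw [this, Complex.inv_eq_conj (he_norm i a)]; rfl
  let S : StarSubalgebra ℂ C(A ⧸ Γ, ℂ) :=
    { Algebra.adjoin ℂ (range χ) with
      star_mem' := by
        change Algebra.adjoin ℂ (range χ) ≤ star (Algebra.adjoin ℂ (range χ))
        refine Algebra.adjoin_le ?_
        rintro - ⟨i, rfl⟩
        refine Algebra.subset_adjoin ⟨-i, ContinuousMap.ext fun x => ?_⟩
        obtain ⟨a, rfl⟩ := hq x
        rw [hχ, he_neg, ContinuousMap.star_apply, hχ] }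
  -- Stone–Weierstrass on the quotient: the algebra is stable under conjugation since `e (-i)` is
  -- the conjugate of `e i`, and it separates points by `he_sep`.
  have hS : S.topologicalClosure = ⊤ := by
    refine ContinuousMap.starSubalgebra_topologicalClosure_eq_top_of_separatesPoints S ?_
    intro x y hxy
    obtain ⟨a, rfl⟩ := hq x
    obtain ⟨b, rfl⟩ := hq y
    have : -a + b ∉ Γ := fun h => hxy (QuotientAddGroup.eq.2 h)
    obtain ⟨i, hi⟩ := not_forall.1 (mt (he_sep _) this)
    refine ⟨χ i, ⟨χ i, Algebra.subset_adjoin ⟨i, rfl⟩, rfl⟩, fun h => hi ?_⟩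
    rw [hχ, hχ] at h
    have hne : e i b ≠ 0 := fun h0 => by simpa [h0] using he_norm i b
    rw [AddChar.map_add_eq_mul, AddChar.map_neg_eq_inv, h, inv_mul_cancel₀ hne]
  have hint (h : C(A ⧸ Γ, ℂ)) : IntegrableOn (fun a => G a * h (q a)) D μ :=
    Continuous.integrableOn_of_subset_isCompact hQ hDQ (hG.mul (h.continuous.comp hqc))
  let P : Submodule ℂ C(A ⧸ Γ, ℂ) :=
    { carrier := {h | ∫ a in D, G a * h (q a) ∂μ = 0}
      zero_mem' := by simp
      add_mem' := fun {h k} hh hk => by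
        simp only [mem_ofPred_eq, ContinuousMap.add_apply, mul_add] at *
        rw [integral_add (hint h) (hint k), hh, hk, add_zero]
      smul_mem' := fun c h hh => by
        simp only [mem_ofPred_eq, ContinuousMap.smul_apply, smul_eq_mul] at *
        simp_rw [mul_left_comm _ c]
        rw [integral_const_mul, hh, mul_zero] }
  have hSP (h) (hh : h ∈ S) : h ∈ P := by
    have h1 : h ∈ Subalgebra.toSubmodule (Algebra.adjoin ℂ (range χ)) := hh
    -- The characters are closed under multiplication, so the algebra they generate is their linear
    -- span, and orthogonality to each character suffices.
    have h2 : (Submonoid.closure (range χ) : Set C(A ⧸ Γ, ℂ)) = range χ := by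
      let M : Submonoid C(A ⧸ Γ, ℂ) :=
        { carrier := range χ
          one_mem' := ⟨0, ContinuousMap.ext fun x => by
            obtain ⟨a, rfl⟩ := hq x
            rw [hχ, he_zero]; rfl⟩
          mul_mem' := by
            rintro _ _ ⟨i, rfl⟩ ⟨j, rfl⟩
            refine ⟨i + j, ContinuousMap.ext fun x => ?_⟩
            obtain ⟨a, rfl⟩ := hq x
            rw [ContinuousMap.mul_apply, hχ, hχ, hχ, he_add] }
      exact congrArg SetLike.coe (Submonoid.closure_eq M)
    rw [Algebra.adjoin_eq_span, h2] at h1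
    refine (Submodule.span_le.2 ?_) h1
    rintro - ⟨i, rfl⟩
    change ∫ a in D, G a * χ i (q a) ∂μ = 0
    simp_rw [hχ]
    exact h0 i
  -- `G` is orthogonal to a uniformly dense space; approximating the conjugate of `G` within `ε`
  -- bounds this integral by `M * ε`.
  have hzero : ∫ a in D, G a * star (G a) ∂μ = 0 := by
    have hmem : star g ∈ S.topologicalClosure := hS ▸ StarSubalgebra.mem_top
    set M := ∫ a in D, ‖G a‖ ∂μ
    have hM : 0 ≤ M := integral_nonneg fun _ => norm_nonneg _
    have hGi : IntegrableOn G D μ := Continuous.integrableOn_of_subset_isCompact hQ hDQ hG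
    have key (ε : ℝ) (hε : 0 < ε) : ‖∫ a in D, G a * star (G a) ∂μ‖ ≤ M * ε := by
      obtain ⟨h, hhS, hh⟩ := Metric.mem_closure_iff.1
        (show star g ∈ closure (S : Set C(A ⧸ Γ, ℂ)) from hmem) ε hε
      have e1 : ∫ a in D, G a * star (G a) ∂μ = ∫ a in D, G a * (star g - h) (q a) ∂μ := by
        simp_rw [ContinuousMap.sub_apply, mul_sub]
        rw [integral_sub (hint (star g)) (hint h), show ∫ a in D, G a * h (q a) ∂μ = 0 from
          hSP h hhS, sub_zero]
        simp_rw [ContinuousMap.star_apply, hg]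
      rw [e1]
      refine (norm_integral_le_integral_norm _).trans ?_
      rw [← integral_mul_const]
      refine integral_mono (hint (star g - h)).norm (hGi.norm.mul_const ε) fun a => ?_
      rw [norm_mul]
      refine mul_le_mul_of_nonneg_left ?_ (norm_nonneg _)
      exact ((star g - h).norm_coe_le_norm _).trans (by rw [← dist_eq_norm]; exact hh.le)
    rw [← norm_le_zero_iff]
    refine ge_of_tendsto (x := 𝓝[>] (0 : ℝ)) (f := fun ε => M * ε) ?_
      (eventually_nhdsWithin_of_forall key)
    have : Tendsto (fun ε : ℝ => M * ε) (𝓝 0) (𝓝 (M * 0)) := (continuous_const_mul M).tendsto 0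
    rw [mul_zero] at this
    exact this.mono_left nhdsWithin_le_nhds
  have hn : ∫ a in D, ‖G a‖ ^ 2 ∂μ = 0 := by
    have : ∀ a, G a * star (G a) = ((‖G a‖ ^ 2 : ℝ) : ℂ) := fun a => by
      rw [Complex.star_def, Complex.mul_conj, Complex.normSq_eq_norm_sq]
    simp_rw [this] at hzero
    rw [integral_complex_ofReal] at hzero
    exact_mod_cast hzero
  have hae := (setIntegral_eq_zero_iff_of_nonneg_ae (ae_of_all _ fun a => by positivity) (by
    have := (Continuous.integrableOn_of_subset_isCompact (μ := μ) hQ hDQ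
      (G := fun a => ‖G a‖ ^ 2) (by fun_prop))
    exact this)).1 hn
  -- `G` vanishes almost everywhere on `D`. By periodicity its support is a `Γ`-invariant null set;
  -- being open, it is empty.
  have hO : IsOpen {a | G a ≠ 0} := isOpen_ne_fun hG continuous_const
  have hnull : μ {a | G a ≠ 0} = 0 := by
    refine hD.measure_zero_of_invariant _ (fun γ => ?_) ?_
    · ext a
      rw [mem_vadd_set_iff_neg_vadd_mem]
      change G (((-γ : Γ) : A) + a) ≠ 0 ↔ G a ≠ 0
      rw [hper _ (-γ).2]
    · rw [← Measure.restrict_apply hO.measurableSet]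
      refine measure_mono_null ?_ (ae_iff.1 hae)
      intro a ha
      simpa using ha
  funext a
  by_contra ha
  have := (hO.measure_pos μ ⟨a, ha⟩).ne'
  exact this hnull

/-- The characters trivial on `Γ` are orthogonal over a fundamental domain. -/
theorem setIntegral_addChar_eq_zero (hD : IsAddFundamentalDomain Γ D μ) {χ : AddChar A ℂ}
    (hΓ : ∀ γ ∈ Γ, χ γ = 1) (hχ : χ ≠ 1) : ∫ a in D, χ a ∂μ = 0 := by
  obtain ⟨b, hb⟩ := AddChar.ne_one_iff.1 hχ
  have h := hD.setIntegral_translate (G := fun a => χ a) (fun γ hγ a => by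
    rw [AddChar.map_add_eq_mul, hΓ γ hγ, one_mul]) b
  simp_rw [AddChar.map_add_eq_mul] at h
  rw [integral_const_mul, mul_left_eq_self₀] at h
  exact h.resolve_left hb

/-- **Poisson summation** for a discrete cocompact subgroup `Γ`, with a family `e` of characters
that is the annihilator of `Γ`. -/
theorem tsum_eq_tsum_fourierCoeff (hD : IsAddFundamentalDomain Γ D μ) {Q : Set A}
    (hQ : IsCompact Q) (hDQ : D ⊆ Q) {C : Set A} (hC : IsCompact C)
    (hΓC : ∀ a, ∃ γ ∈ Γ, γ + a ∈ C)
    (he_norm : ∀ i a, ‖e i a‖ = 1) (he_add : ∀ i j a, e (i + j) a = e i a * e j a) (he_cont : ∀ i, Continuous (e i))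
    (he_ne : ∀ i, e i = 1 → i = 0)
    (he_Γ : ∀ i, ∀ γ ∈ Γ, e i γ = 1) (he_sep : ∀ a, (∀ i, e i a = 1) → a ∈ Γ)
    {f : A → ℂ} (hf : Continuous f) (hfi : Integrable f μ)
    (hfn : ∀ Q, IsCompact Q → ∃ b : Γ → ℝ, Summable b ∧ ∀ γ : Γ, ∀ a ∈ Q, ‖f (γ + a)‖ ≤ b γ)
    (hfs : Summable fun i => ∫ a, f a * e i a ∂μ) :
    (μ.real D : ℂ) * ∑' γ : Γ, f γ = ∑' i, ∫ a, f a * e i a ∂μ := by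
  have he_zero (a) : e 0 a = 1 := by
    have h := he_add 0 0 a
    rw [add_zero, left_eq_mul₀] at h
    · exact h
    · exact fun h0 => by simpa [h0] using he_norm 0 a
  classical
  let c : ι → ℂ := fun i => ∫ a, f a * e i a ∂μ
  -- `F` is the periodization of `f` and `H` its Fourier series without the factor `1 / μ D`; this
  -- is why the covolume multiplies `F` below. The formula is the equality `μ D * F = H` at `0`.
  let F : A → ℂ := fun a => ∑' γ : Γ, f (γ + a)
  let H : A → ℂ := fun a => ∑' i, c i * e (-i) a
  have hFc : Continuous F := by
    refine continuous_iff_continuousAt.2 fun a => ?_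
    obtain ⟨Q, hQc, hQa⟩ := exists_compact_mem_nhds a
    obtain ⟨b, hb, hfb⟩ := hfn Q hQc
    exact (continuousOn_tsum (fun γ => (by fun_prop)) hb hfb).continuousAt hQa
  have hHb (i a) : ‖c i * e (-i) a‖ ≤ ‖c i‖ := by rw [norm_mul, he_norm, mul_one]
  have hHc : Continuous H :=
    continuous_tsum (fun i => by have := he_cont (-i); fun_prop) hfs.norm hHb
  have hFp : ∀ γ ∈ Γ, ∀ a, F (γ + a) = F a := fun γ hγ a => by
    simp only [F, ← add_assoc]
    exact (Equiv.addRight (⟨γ, hγ⟩ : Γ)).tsum_eq (fun δ : Γ => f (δ + a))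
  have hHp : ∀ γ ∈ Γ, ∀ a, H (γ + a) = H a := fun γ hγ a => by
    simp only [H, AddChar.map_add_eq_mul, he_Γ _ γ hγ, one_mul]
  have hFi (i) : ∫ a in D, F a * e i a ∂μ = c i := by
    have hint : Integrable (fun a => f a * e i a) μ := by
      refine hfi.mul_bdd (c := 1) ?_ (ae_of_all _ fun a => (he_norm i a).le)
      have := he_cont i
      exact (Continuous.aestronglyMeasurable (by fun_prop))
    simp only [c]
    rw [hD.integral_eq_tsum'' _ hint]
    obtain ⟨b, hb, hfb⟩ := hfn Q hQ
    have hfin : μ D ≠ ⊤ := ((measure_mono hDQ).trans_lt hQ.measure_lt_top).ne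
    have e1 (a : A) : F a * e i a = ∑' γ : Γ, f (γ + a) * e i (γ + a) := by
      simp only [F]
      rw [← tsum_mul_right]
      exact tsum_congr fun γ => by rw [AddChar.map_add_eq_mul, he_Γ _ _ γ.2, one_mul]
    simp_rw [e1]
    have hDb (γ : Γ) : IntegrableOn (fun a => f (γ + a) * e i (γ + a)) D μ := by
      refine Continuous.integrableOn_of_subset_isCompact hQ hDQ ?_
      have := he_cont i
      fun_prop
    rw [← integral_tsum_of_summable_integral_norm hDb ?_]
    · rfl
    refine Summable.of_nonneg_of_le (fun γ => by positivity) (fun γ => ?_)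
      (hb.mul_left (μ.real D))
    have : ∫ a in D, ‖f (γ + a) * e i (γ + a)‖ ∂μ ≤ ∫ a in D, b γ ∂μ := by
      refine setIntegral_mono_on₀ (hDb γ).norm (integrableOn_const hfin) hD.nullMeasurableSet
        fun a ha => ?_
      rw [norm_mul, he_norm, mul_one]
      exact hfb γ a (hDQ ha)
    simpa [smul_eq_mul] using this
  have horth (i j) : ∫ a in D, e (-i) a * e j a ∂μ = if i = j then (μ.real D : ℂ) else 0 := by
    have : ∀ a, e (-i) a * e j a = e (-i + j) a := fun a => by
      rw [he_add]
    simp_rw [this]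
    split_ifs with h
    · subst h; simp [he_zero]
    · exact setIntegral_addChar_eq_zero hD (he_Γ _) fun h' =>
        h (neg_add_eq_zero.1 (he_ne _ h'))
  have hHi (j) : ∫ a in D, H a * e j a ∂μ = μ.real D * c j := by
    have hfin : μ D ≠ ⊤ := ((measure_mono hDQ).trans_lt hQ.measure_lt_top).ne
    have e1 (a : A) : H a * e j a = ∑' i, c i * (e (-i) a * e j a) := by
      simp only [H]
      rw [← tsum_mul_right]
      simp only [mul_assoc]
    have hcont (i) : IntegrableOn (fun a => c i * (e (-i) a * e j a)) D μ := by
      refine Continuous.integrableOn_of_subset_isCompact hQ hDQ ?_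
      have := he_cont (-i)
      have := he_cont j
      fun_prop
    simp_rw [e1]
    rw [← integral_tsum_of_summable_integral_norm hcont]
    · simp_rw [integral_const_mul, horth]
      rw [tsum_eq_single j fun i hi => by rw [if_neg hi, mul_zero], if_pos rfl, mul_comm]
    · simpa [he_norm] using hfs.norm.mul_left (μ.real D)
  have hzero := eq_zero_of_fourierCoeff_eq_zero hD hQ hDQ hC hΓC he_norm he_add he_cont he_Γ he_sep
    (G := fun a => μ.real D * F a - H a) (by fun_prop)
    (fun γ hγ a => by simp only [hFp γ hγ a, hHp γ hγ a]) (fun i => by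
      simp_rw [sub_mul, mul_assoc]
      have := he_cont i
      rw [integral_sub, integral_const_mul, hFi, hHi, sub_self] <;>
      exact Continuous.integrableOn_of_subset_isCompact hQ hDQ (by fun_prop))
  have := congrFun hzero 0
  simpa [F, H, c, sub_eq_zero] using this

end PoissonSummation

/-! ### A cocompact field is discrete and self-annihilating -/

section AddCharOnRing

/-- The circle group has no small subgroups. -/
theorem Circle.eq_one_of_forall_pow_dist_lt {z : Circle} (h : ∀ n : ℕ, dist (z ^ n) 1 < 1 / 2) :
    z = 1 := by
  by_contra hz
  have hd : 0 < dist z 1 := dist_pos.2 hz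
  have hdist (w : Circle) : dist w 1 = ‖(w : ℂ) - 1‖ := by
    rw [← dist_eq_norm]; rfl
  -- If `w` is within `1 / 2` of `1`, then `‖w + 1‖ ≥ 3 / 2`, so squaring expands the distance to
  -- `1` by at least `3 / 2`; iterating leaves the ball.
  have key (k : ℕ) : (3 / 2 : ℝ) ^ k * dist z 1 ≤ dist (z ^ 2 ^ k) 1 := by
    induction k with
    | zero => simp
    | succ k ih =>
      have hw := h (2 ^ k)
      set w := z ^ 2 ^ k
      have e1 : z ^ 2 ^ (k + 1) = w ^ 2 := by rw [pow_succ, pow_mul]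
      have e2 : ‖((w ^ 2 : Circle) : ℂ) - 1‖ = ‖(w : ℂ) - 1‖ * ‖(w : ℂ) + 1‖ := by
        rw [← norm_mul, Circle.coe_pow]; congr 1; ring
      have e3 : (3 / 2 : ℝ) ≤ ‖(w : ℂ) + 1‖ := by
        have h2 : ‖(2 : ℂ)‖ ≤ ‖(w : ℂ) + 1‖ + ‖(w : ℂ) - 1‖ := by
          have := norm_sub_le ((w : ℂ) + 1) ((w : ℂ) - 1)
          rwa [show (w : ℂ) + 1 - (w - 1) = 2 by ring] at this
        rw [hdist] at hw
        simp only [Complex.norm_ofNat] at h2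
        linarith
      rw [e1, hdist (w ^ 2), e2, ← hdist w]
      calc (3 / 2 : ℝ) ^ (k + 1) * dist z 1 = ((3 / 2) ^ k * dist z 1) * (3 / 2) := by ring
        _ ≤ _ := mul_le_mul ih e3 (by norm_num) dist_nonneg
  obtain ⟨k, hk⟩ := pow_unbounded_of_one_lt (1 / dist z 1) (show (1 : ℝ) < 3 / 2 by norm_num)
  have := (key k).trans_lt (h (2 ^ k))
  rw [div_lt_iff₀ hd] at hk
  linarith

/-- A subgroup with an isolated zero is discrete. -/
theorem AddSubgroup.discreteTopology_of_eventually {G : Type*} [AddCommGroup G] [TopologicalSpace G]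
    [IsTopologicalAddGroup G] (P : AddSubgroup G) (h : ∀ᶠ x in 𝓝 (0 : G), x ∈ P → x = 0) :
    DiscreteTopology P := by
  refine discreteTopology_of_isOpen_singleton_zero (isOpen_iff_mem_nhds.2 ?_)
  rintro x rfl
  refine (mem_nhds_subtype (P : Set G) 0 {0}).2 ⟨_, h, fun x hx => Subtype.ext (hx x.2)⟩

variable {A : Type*} [CommRing A] [TopologicalSpace A] [IsTopologicalRing A]

/-- If an additive character `ψ` is trivial on a set of the form `x * S`, with `S` a cocompact
additive subgroup, and `x` is small enough, then `ψ` is trivial on `x * A`. -/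
theorem AddChar.eventually_forall_mul_eq_one {ψ : AddChar A Circle} (hψ : Continuous ψ)
    {C : Set A} (hC : IsCompact C) {S : Set A} (hS : ∀ a, ∃ s ∈ S, s + a ∈ C) :
    ∀ᶠ x in 𝓝 (0 : A), (∀ s ∈ S, ψ (x * s) = 1) → ∀ a, ψ (x * a) = 1 := by
  have h1 : ∀ᶠ x in 𝓝 (0 : A), ∀ c ∈ C, dist (ψ (x * c)) 1 < 1 / 2 := by
    refine hC.eventually_forall_of_forall_eventually fun c _ => ?_
    have : Continuous fun p : A × A => dist (ψ (p.1 * p.2)) 1 := by fun_prop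
    exact this.continuousAt.eventually_lt continuousAt_const (by simp)
  filter_upwards [h1] with x hx hxS a
  -- `ψ (x * a) ^ n = ψ (x * (s + n • a))` for any `s ∈ S`, and `s` can be chosen to move `n • a`
  -- into `C`. So all powers of `ψ (x * a)` are near `1`.
  refine Circle.eq_one_of_forall_pow_dist_lt fun n => ?_
  obtain ⟨s, hs, h⟩ := hS (n • a)
  have := hx _ h
  rwa [mul_add, AddChar.map_add_eq_mul, hxS s hs, one_mul, mul_smul_comm,
    AddChar.map_nsmul_eq_pow] at this

variable {K : Type*} [Field K] [Algebra K A] {ψ : AddChar A Circle}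

/-- A cocompact field `K` in a topological ring is discrete and is its own annihilator for every
nondegenerate character trivial on `K`. -/
theorem discrete_and_annihilator_eq [T2Space A] [Infinite K] (hψ : Continuous ψ)
    (hK : ∀ k : K, ψ (algebraMap K A k) = 1) (hnd : ∀ x, (∀ a, ψ (x * a) = 1) → x = 0)
    {C : Set A} (hC : IsCompact C) (hKC : ∀ a, ∃ k : K, algebraMap K A k + a ∈ C) :
    DiscreteTopology (algebraMap K A).range.toAddSubgroup ∧
      ∀ x, (∀ k : K, ψ (x * algebraMap K A k) = 1) → ∃ k : K, algebraMap K A k = x := by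
  let P : AddSubgroup A :=
    { carrier := {x | ∀ k : K, ψ (x * algebraMap K A k) = 1}
      zero_mem' := by simp
      add_mem' := fun {x y} hx hy k => by
        rw [add_mul, AddChar.map_add_eq_mul, hx, hy, one_mul]
      neg_mem' := fun {x} hx k => by
        rw [neg_mul, AddChar.map_neg_eq_inv, hx, inv_one] }
  have hPK (x) (hx : x ∈ P) (k : K) : algebraMap K A k * x ∈ P := fun l => by
    rw [mul_right_comm, ← map_mul, mul_comm]; exact hx _
  have hKP (k : K) : algebraMap K A k ∈ P := fun l => by rw [← map_mul]; exact hK _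
  have hPd : DiscreteTopology P := by
    refine P.discreteTopology_of_eventually ?_
    filter_upwards [AddChar.eventually_forall_mul_eq_one hψ hC (S := range (algebraMap K A))
      (by simpa using hKC)] with x hx hxP
    exact hnd x (hx (by rintro - ⟨k, rfl⟩; exact hxP k))
  have hle : (algebraMap K A).range.toAddSubgroup ≤ P := by
    rintro - ⟨k, rfl⟩
    exact hKP k
  refine ⟨DiscreteTopology.of_subset hPd hle, fun x hx => ?_⟩
  -- `P` is a `K`-subspace containing `K`, and modulo `K` each of its elements is represented in
  -- this finite set. Hence two distinct multiples `s x` and `t x` agree modulo `K`, and `x = (s -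
  -- t)⁻¹ (g t - g s)`.
  have hfin : (C ∩ (P : Set A)).Finite := by
    have hc : IsCompact (C ∩ (P : Set A)) := hC.inter_right AddSubgroup.isClosed_of_discrete
    exact hc.finite ⟨DiscreteTopology.of_subset hPd inter_subset_right⟩
  choose g hg using fun t : K => hKC (algebraMap K A t * x)
  have hmaps : MapsTo (fun t => algebraMap K A (g t) + algebraMap K A t * x) univ
      (C ∩ (P : Set A)) := fun t _ => ⟨hg t, add_mem (hKP _) (hPK x hx t)⟩
  obtain ⟨s, -, t, -, hst, h⟩ :=
    (infinite_univ (α := K)).exists_ne_map_eq_of_mapsTo hmaps hfin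
  refine ⟨(s - t)⁻¹ * (g t - g s), ?_⟩
  have h1 : algebraMap K A (s - t) * x = algebraMap K A (g t - g s) := by
    simp only [map_sub, sub_mul] at h ⊢
    linear_combination h
  rw [map_mul, ← h1, ← mul_assoc, ← map_mul, inv_mul_cancel₀ (sub_ne_zero.2 hst), map_one, one_mul]

end AddCharOnRing

/-! ### Poisson summation in a ring and the value of the covolume -/

section FourierOnRing

variable {A : Type*} [CommRing A] [MeasurableSpace A]

/-- The Fourier transform on a ring with respect to an additive character. -/
noncomputable def ringFourier (ψ : AddChar A Circle) (μ : Measure A) (f : A → ℂ) (y : A) : ℂ :=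
  ∫ x, f x * (ψ (x * y) : ℂ) ∂μ

/-- A function all of whose translates by elements of a compact set have a common integrable
majorant. -/
def HasLocalMajorant [TopologicalSpace A] (μ : Measure A) (f : A → ℂ) : Prop :=
  ∀ Q, IsCompact Q → ∃ Φ : A → ℝ, Integrable Φ μ ∧ ∀ x, ∀ a ∈ Q, ‖f (x + a)‖ ≤ Φ x

variable [TopologicalSpace A] [IsTopologicalRing A] [BorelSpace A] [LocallyCompactSpace A]
  [T2Space A] {μ : Measure A} [μ.IsAddHaarMeasure] {ψ : AddChar A Circle}

theorem HasLocalMajorant.integrable {f : A → ℂ} (h : HasLocalMajorant μ f) (hf : Continuous f) :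
    Integrable f μ := by
  obtain ⟨Φ, hΦ, hfΦ⟩ := h {0} isCompact_singleton
  exact hΦ.mono' hf.aestronglyMeasurable (ae_of_all _ fun x => by simpa using hfΦ x 0 rfl)

/-- Sums over a discrete subgroup of a function with local majorants converge normally. -/
theorem HasLocalMajorant.exists_summable {f : A → ℂ} (h : HasLocalMajorant μ f)
    (Γ : AddSubgroup A) [DiscreteTopology Γ] [Countable Γ] {Q : Set A} (hQ : IsCompact Q) :
    ∃ b : Γ → ℝ, Summable b ∧ ∀ γ : Γ, ∀ a ∈ Q, ‖f (γ + a)‖ ≤ b γ := by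
  obtain ⟨W, hW, hWΓ⟩ : ∃ W ∈ 𝓝 (0 : A), ∀ γ ∈ Γ, γ ∈ W → γ = 0 := by
    obtain ⟨W, hW, h⟩ := (mem_nhds_subtype (Γ : Set A) 0 {0}).1 (by
      rw [nhds_discrete]; exact rfl)
    exact ⟨W, hW, fun γ hγ hγW => congrArg Subtype.val (h (a := ⟨γ, hγ⟩) hγW)⟩
  obtain ⟨U, hU, hUW⟩ : ∃ U ∈ 𝓝 (0 : A), ∀ x ∈ U, ∀ y ∈ U, x - y ∈ W := by
    have h0 : Tendsto (fun p : A × A => p.1 - p.2) (𝓝 0 ×ˢ 𝓝 0) (𝓝 0) := by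
      have := (continuous_sub (G := A)).tendsto (0, 0)
      rwa [nhds_prod_eq, sub_zero] at this
    obtain ⟨U, hU, h⟩ := mem_prod_same_iff.1 (h0 hW)
    exact ⟨U, hU, fun x hx y hy => h (mk_mem_prod hx hy)⟩
  obtain ⟨V, hV, hVU, hVc⟩ := local_compact_nhds hU
  -- For `u ∈ V`, `γ + a = (γ + u) + (a - u)`. So `‖f (γ + a)‖` is at most the mean of `|Φ|` over `γ
  -- + V`, and these translates are disjoint.
  obtain ⟨Φ, hΦ, hfΦ⟩ := h (Q - V) (by rw [sub_eq_add_neg]; exact hQ.add hVc.neg)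
  have hμ0 : 0 < μ.real V := ENNReal.toReal_pos (Measure.measure_pos_of_mem_nhds μ hV).ne'
    hVc.measure_lt_top.ne
  have hsum : Summable fun γ : Γ => ∫ x in (γ : A) +ᵥ V, |Φ x| ∂μ := by
    refine (hasSum_integral_iUnion (fun γ : Γ => ?_) ?_ hΦ.abs.integrableOn).summable
    · exact (hVc.vadd (γ : A)).measurableSet
    · intro γ δ hγδ
      refine Set.disjoint_left.2 ?_
      rintro x ⟨u, hu, hux⟩ ⟨w, hw, hwx⟩
      have e : u - w = δ - γ := by
        have e1 : (γ : A) + u = x := hux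
        have e2 : (δ : A) + w = x := hwx
        linear_combination e1 - e2
      refine hγδ (Subtype.ext (sub_eq_zero.1 (hWΓ _ (sub_mem δ.2 γ.2) ?_)).symm)
      rw [← e]
      exact hUW u (hVU hu) w (hVU hw)
  refine ⟨_, hsum.mul_left (μ.real V)⁻¹, fun γ a ha => ?_⟩
  rw [← div_eq_inv_mul, le_div_iff₀ hμ0]
  have hm : μ.real ((γ : A) +ᵥ V) = μ.real V := by simp [Measure.real, measure_vadd]
  have hfin : μ ((γ : A) +ᵥ V) ≠ ⊤ := (hVc.vadd (γ : A)).measure_lt_top.ne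
  calc ‖f (γ + a)‖ * μ.real V = ∫ x in (γ : A) +ᵥ V, ‖f (γ + a)‖ ∂μ := by
        rw [setIntegral_const, hm, smul_eq_mul, mul_comm]
    _ ≤ _ := by
      refine setIntegral_mono_on (integrableOn_const hfin) hΦ.abs.integrableOn
        (hVc.vadd (γ : A)).measurableSet ?_
      rintro x ⟨u, hu, rfl⟩
      refine le_trans ?_ (le_abs_self _)
      have := hfΦ ((γ : A) + u) (a - u) (sub_mem_sub ha hu)
      rwa [add_assoc, add_sub_cancel] at this

variable {K : Type*} [Field K] [Algebra K A]

theorem HasLocalMajorant.summable {f : A → ℂ} (h : HasLocalMajorant μ f) [Countable K] [Nontrivial A]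
    [DiscreteTopology (algebraMap K A).range.toAddSubgroup] :
    Summable fun k : K => f (algebraMap K A k) := by
  let e : K ≃ (algebraMap K A).range.toAddSubgroup :=
    Equiv.ofInjective _ (algebraMap K A).injective
  have : Countable (algebraMap K A).range.toAddSubgroup := e.symm.injective.countable
  obtain ⟨b, hb, hfb⟩ := h.exists_summable (algebraMap K A).range.toAddSubgroup
    (isCompact_singleton (x := (0 : A)))
  refine Summable.of_norm_bounded (e.summable_iff.2 hb) fun k => ?_
  have := hfb (e k) 0 rfl
  rwa [add_zero] at this

/-- **Poisson summation** for a cocompact field in a locally compact ring, up to the covolume. -/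
theorem exists_mul_tsum_eq_tsum_ringFourier [Countable K] [Infinite K] (hψ : Continuous ψ)
    (hψ1 : ψ ≠ 1)
    (hK : ∀ k : K, ψ (algebraMap K A k) = 1) (hnd : ∀ x, (∀ a, ψ (x * a) = 1) → x = 0)
    {C : Set A} (hC : IsCompact C) (hKC : ∀ a, ∃ k : K, algebraMap K A k + a ∈ C) :
    ∃ v : ℝ, 0 ≤ v ∧ ∀ f : A → ℂ, Continuous f → HasLocalMajorant μ f →
      HasLocalMajorant μ (ringFourier ψ μ f) →
      Summable (fun k : K => f (algebraMap K A k)) ∧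
      Summable (fun k : K => ringFourier ψ μ f (algebraMap K A k)) ∧
      v * ∑' k : K, f (algebraMap K A k) = ∑' k : K, ringFourier ψ μ f (algebraMap K A k) := by
  have : Nontrivial A := by
    obtain ⟨a, ha⟩ := AddChar.ne_one_iff.1 hψ1
    exact ⟨a, 0, fun h => ha (by rw [h, AddChar.map_zero_eq_one])⟩
  obtain ⟨hdisc, hann⟩ := discrete_and_annihilator_eq hψ hK hnd hC hKC
  set Γ := (algebraMap K A).range.toAddSubgroup
  let ε : K ≃ Γ := Equiv.ofInjective _ (algebraMap K A).injective
  have : Countable Γ := ε.symm.injective.countable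
  have hΓC : ∀ a, ∃ γ ∈ Γ, γ + a ∈ C := fun a => by
    obtain ⟨k, hk⟩ := hKC a
    exact ⟨_, ⟨k, rfl⟩, hk⟩
  obtain ⟨D, hDm, hD, Q, hQ, hDQ⟩ := exists_isAddFundamentalDomain μ Γ hC hΓC
  let e : K → AddChar A ℂ := fun k =>
    { toFun := fun a => (ψ (a * algebraMap K A k) : ℂ)
      map_zero_eq_one' := by simp
      map_add_eq_mul' := fun a b => by rw [add_mul, AddChar.map_add_eq_mul]; rfl }
  have he (k a) : e k a = (ψ (a * algebraMap K A k) : ℂ) := rfl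
  refine ⟨μ.real D, measureReal_nonneg, fun f hf hfm hfm' => ⟨hfm.summable, hfm'.summable, ?_⟩⟩
  have := tsum_eq_tsum_fourierCoeff (e := e) hD hQ hDQ hC hΓC
    (fun k a => Circle.norm_coe _)
    (fun k l a => by rw [he, map_add, mul_add, AddChar.map_add_eq_mul]; rfl)
    (fun k => by
      have : Continuous fun a => ψ (a * algebraMap K A k) := by fun_prop
      exact continuous_subtype_val.comp this)
    (fun k hk => by
      by_contra hk0
      refine hψ1 (DFunLike.ext _ _ fun a => ?_)
      have h := DFunLike.congr_fun hk (a * algebraMap K A k⁻¹)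
      rw [he, mul_assoc, ← map_mul, inv_mul_cancel₀ hk0, map_one, mul_one] at h
      exact Circle.ext h)
    (fun k γ hγ => by
      obtain ⟨l, rfl⟩ := hγ
      rw [he, ← map_mul, hK]; rfl)
    (fun a ha => by
      obtain ⟨k, rfl⟩ := hann a fun k => Circle.ext (ha k)
      exact ⟨k, rfl⟩)
    hf (hfm.integrable hf) (fun Q hQ => hfm.exists_summable Γ hQ) hfm'.summable
  rw [← ε.tsum_eq (fun γ : Γ => f γ)] at this
  exact this

/-- The covolume in Poisson summation is determined by Fourier inversion for a single function. -/
theorem tsum_eq_tsum_ringFourier [Countable K] [Infinite K] (hψ : Continuous ψ)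
    (hψ1 : ψ ≠ 1)
    (hK : ∀ k : K, ψ (algebraMap K A k) = 1) (hnd : ∀ x, (∀ a, ψ (x * a) = 1) → x = 0)
    {C : Set A} (hC : IsCompact C) (hKC : ∀ a, ∃ k : K, algebraMap K A k + a ∈ C)
    {f₀ : A → ℝ} (hf₀ : Continuous f₀) (h0 : ∀ x, 0 ≤ f₀ x) (h00 : 0 < f₀ 0)
    (hf₀m : HasLocalMajorant μ fun x => (f₀ x : ℂ))
    (hf₀' : Continuous (ringFourier ψ μ fun x => (f₀ x : ℂ)))
    (hf₀m' : HasLocalMajorant μ (ringFourier ψ μ fun x => (f₀ x : ℂ)))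
    (hinv : ∀ x, ringFourier ψ μ (ringFourier ψ μ fun x => (f₀ x : ℂ)) x = f₀ x)
    {f : A → ℂ} (hf : Continuous f) (hfm : HasLocalMajorant μ f)
    (hfm' : HasLocalMajorant μ (ringFourier ψ μ f)) :
      Summable (fun k : K => f (algebraMap K A k)) ∧
      Summable (fun k : K => ringFourier ψ μ f (algebraMap K A k)) ∧
      ∑' k : K, f (algebraMap K A k) = ∑' k : K, ringFourier ψ μ f (algebraMap K A k) := by
  obtain ⟨v, hv0, hv⟩ := exists_mul_tsum_eq_tsum_ringFourier (μ := μ) hψ hψ1 hK hnd hC hKC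
  have hneg : ringFourier ψ μ (ringFourier ψ μ fun x => (f₀ x : ℂ)) = fun x => (f₀ x : ℂ) :=
    funext hinv
  obtain ⟨hs, -, h1⟩ := hv _ (by fun_prop) hf₀m hf₀m'
  -- Poisson summation for the transform of `f₀`, whose own transform is `f₀`. Together with the
  -- formula for `f₀` this gives `v * v * ∑ f₀ = ∑ f₀`, and the sum is positive.
  obtain ⟨-, -, h2⟩ := hv _ hf₀' hf₀m' (by rwa [hneg])
  rw [hneg, ← h1] at h2
  have hS : 0 < ∑' k : K, f₀ (algebraMap K A k) := by
    have hs' : Summable fun k : K => f₀ (algebraMap K A k) := by exact_mod_cast hs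
    refine hs'.tsum_pos (fun k => h0 _) 0 (by rwa [map_zero])
  rw [← Complex.ofReal_tsum, ← mul_assoc] at h2
  have hv1 : v * v = 1 := by
    have : v * v * ∑' k : K, f₀ (algebraMap K A k) = 1 * ∑' k : K, f₀ (algebraMap K A k) := by
      rw [one_mul]; exact_mod_cast h2
    exact mul_right_cancel₀ hS.ne' this
  have hv1 : v = 1 := by nlinarith
  have := hv f hf hfm hfm'
  rwa [hv1, Complex.ofReal_one, one_mul] at this

end FourierOnRing

/-! ### Unitary characters of real vector spaces -/

section CharactersOfVectorSpaces

/-- A continuous homomorphism `ℝ → ℂˣ` satisfies a first-order linear differential equation. -/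
theorem AddChar.exists_hasDerivAt {φ : AddChar ℝ ℂ} (hφ : Continuous φ) :
    ∃ c : ℂ, ∀ t, HasDerivAt φ (φ t * c) t := by
  let F : ℝ → ℂ := fun t => ∫ s in (0 : ℝ)..t, φ s
  have hF (t) : HasDerivAt F (φ t) t := hφ.integral_hasStrictDerivAt 0 t |>.hasDerivAt
  obtain ⟨δ, hδ⟩ : ∃ δ, F δ ≠ 0 := by
    by_contra! h
    have h0 : F = fun _ => 0 := funext h
    have := (hF 0).unique (h0 ▸ hasDerivAt_const 0 0)
    simp at this
  -- Integrating `φ (t + s) = φ t * φ s` over `s` in `[0, δ]` expresses `φ` through its primitive,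
  -- so continuity upgrades to differentiability.
  have key (t) : φ t = (F (t + δ) - F t) / F δ := by
    rw [eq_div_iff hδ]
    have h1 : F (t + δ) - F t = ∫ s in t..(t + δ), φ s :=
      intervalIntegral.integral_interval_sub_left (hφ.intervalIntegrable _ _)
        (hφ.intervalIntegrable _ _)
    have h2 : ∫ s in t..(t + δ), φ s = ∫ s in (0 : ℝ)..δ, φ (t + s) := by
      rw [intervalIntegral.integral_comp_add_left, add_zero]
    rw [h1, h2]
    simp_rw [AddChar.map_add_eq_mul]
    rw [intervalIntegral.integral_const_mul]
  refine ⟨(φ δ - 1) / F δ, fun t => ?_⟩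
  have h := (((hF (t + δ)).comp_add_const t δ).sub (hF t)).div_const (F δ)
  have h3 : φ t * ((φ δ - 1) / F δ) = (φ (t + δ) - φ t) / F δ := by
    rw [AddChar.map_add_eq_mul]; ring
  rw [h3]
  exact h.congr_of_eventuallyEq (Eventually.of_forall key)

/-- A continuous homomorphism `ℝ → ℂˣ` is an exponential. -/
theorem AddChar.exists_eq_exp {φ : AddChar ℝ ℂ} (hφ : Continuous φ) :
    ∃ c : ℂ, ∀ t : ℝ, φ t = Complex.exp (c * t) := by
  obtain ⟨c, hc⟩ := AddChar.exists_hasDerivAt hφ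
  refine ⟨c, fun t => ?_⟩
  have hd (s : ℝ) : HasDerivAt (fun s : ℝ => φ s * Complex.exp (-(c * s))) 0 s := by
    have h1 : HasDerivAt (fun s : ℝ => Complex.exp (-(c * s))) (Complex.exp (-(c * s)) * (-(c * 1))) s :=
      ((Complex.ofRealCLM.hasDerivAt.const_mul c).neg).cexp
    have h := (hc s).mul h1
    have e : φ s * c * Complex.exp (-(c * s)) + φ s * (Complex.exp (-(c * s)) * (-(c * 1))) = 0 := by
      ring
    rwa [e] at h
  have := is_const_of_deriv_eq_zero (fun s => (hd s).differentiableAt) (fun s => (hd s).deriv) t 0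
  simp only [Complex.ofReal_zero, mul_zero, neg_zero, Complex.exp_zero, mul_one,
    AddChar.map_zero_eq_one] at this
  rw [Complex.exp_neg, mul_inv_eq_one₀ (Complex.exp_ne_zero _)] at this
  exact this

variable {E : Type*} [NormedAddCommGroup E] [NormedSpace ℝ E] [FiniteDimensional ℝ E]

/-- The unitary characters of a finite-dimensional real vector space. -/
theorem AddChar.exists_eq_fourierChar {χ : AddChar E Circle} (hχ : Continuous χ) :
    ∃ L : E →L[ℝ] ℝ, ∀ x, χ x = Real.fourierChar (-L x) := by
  let φ (v : E) : AddChar ℝ ℂ :=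
    { toFun := fun t => (χ (t • v) : ℂ)
      map_zero_eq_one' := by simp
      map_add_eq_mul' := fun s t => by rw [add_smul, AddChar.map_add_eq_mul]; rfl }
  have hφc (v) : Continuous (φ v) :=
    continuous_subtype_val.comp (hχ.comp (by fun_prop : Continuous fun t : ℝ => t • v))
  have hφ (v t) : φ v t = (χ (t • v) : ℂ) := rfl
  have hφn (v t) : ‖φ v t‖ = 1 := Circle.norm_coe _
  choose c hc using fun v => AddChar.exists_eq_exp (hφc v)
  have hd (v) : HasDerivAt (φ v) (c v) 0 := by
    have h1 : HasDerivAt (fun s : ℝ => Complex.exp (c v * s))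
        (Complex.exp (c v * (0 : ℝ)) * (c v * 1)) 0 :=
      (Complex.ofRealCLM.hasDerivAt.const_mul (c v)).cexp
    rw [show ⇑(φ v) = fun s : ℝ => Complex.exp (c v * s) from funext (hc v)]
    simpa using h1
  have hre (v) : (c v).re = 0 := by
    have := hφn v 1
    rw [hc, Complex.norm_exp] at this
    simpa using this
  have hadd (v w) : c (v + w) = c v + c w := by
    have h := (hd v).mul (hd w)
    have e : ⇑(φ v) * ⇑(φ w) = φ (v + w) := funext fun t => by
      simp only [Pi.mul_apply, hφ, smul_add, AddChar.map_add_eq_mul]; rfl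
    rw [e] at h
    have := (hd (v + w)).unique h
    simpa using this
  have hsmul (r : ℝ) (v) : c (r • v) = r * c v := by
    have h : HasDerivAt (fun t : ℝ => φ v (t * r)) (r • c v) 0 := by
      have h1 : HasDerivAt (fun t : ℝ => t * r) r 0 := by simpa using (hasDerivAt_id (0 : ℝ)).mul_const r
      have h2 := hd v
      rw [← zero_mul r] at h2
      exact h2.scomp (0 : ℝ) h1
    have e : (fun t : ℝ => φ v (t * r)) = φ (r • v) := funext fun t => by
      rw [hφ, hφ, mul_smul]
    rw [e] at h
    simpa using (hd (r • v)).unique h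
  -- `c v` is purely imaginary because `χ` is unitary. The sign is chosen to match the kernel
  -- `e(-L)` of `VectorFourier.fourierIntegral`.
  let L : E →ₗ[ℝ] ℝ :=
    { toFun := fun v => -(c v).im / (2 * Real.pi)
      map_add' := fun v w => by rw [hadd, Complex.add_im]; ring
      map_smul' := fun r v => by rw [hsmul, Complex.im_ofReal_mul, RingHom.id_apply, smul_eq_mul]; ring }
  refine ⟨L.toContinuousLinearMap, fun x => Circle.ext ?_⟩
  have h := hc x 1
  rw [hφ, one_smul] at h
  rw [h, Real.fourierChar_apply]
  congr 1
  have hL : L.toContinuousLinearMap x = -(c x).im / (2 * Real.pi) := rfl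
  rw [hL]
  have h1 : 2 * Real.pi * -(-(c x).im / (2 * Real.pi)) = (c x).im := by
    have := Real.pi_ne_zero
    field_simp
  rw [h1]
  apply Complex.ext <;> simp [hre]

end CharactersOfVectorSpaces

/-! ### Rapid decay of Schwartz functions and their transforms -/

section SchwartzDecay
open scoped SchwartzMap

variable {E : Type*} [NormedCommRing E] [NormedAlgebra ℝ E]

theorem SchwartzMap.exists_norm_le_inv_pow (g : 𝓢(E, ℂ)) (k : ℕ) :
    ∃ C, ∀ x, ‖g x‖ ≤ C * ((1 + ‖x‖) ^ k)⁻¹ := by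
  refine ⟨2 ^ k * (Finset.Iic (k, 0)).sup (fun m => SchwartzMap.seminorm ℝ m.1 m.2) g, fun x => ?_⟩
  have h := SchwartzMap.one_add_le_sup_seminorm_apply (𝕜 := ℝ) (m := (k, 0)) (k := k) (n := 0) le_rfl
    le_rfl g x
  rw [norm_iteratedFDeriv_zero] at h
  rw [← div_eq_mul_inv, le_div_iff₀ (by positivity), mul_comm]
  exact h

variable [FiniteDimensional ℝ E] [MeasurableSpace E] [BorelSpace E]

theorem integrable_inv_one_add_norm_pow (ν : Measure E) [ν.IsAddHaarMeasure] :
    Integrable (fun x : E => ((1 + ‖x‖) ^ (Module.finrank ℝ E + 1))⁻¹) ν := by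
  have h := integrable_one_add_norm (μ := ν) (E := E) (r := (Module.finrank ℝ E + 1 : ℕ))
    (by push_cast; linarith)
  refine h.congr (ae_of_all _ fun x => ?_)
  simp only
  rw [Real.rpow_neg (by positivity), Real.rpow_natCast]

/-- The Fourier transform of a Schwartz function on a finite-dimensional real algebra, with respect
to a nondegenerate character, decays rapidly. -/
theorem SchwartzMap.exists_norm_integral_mul_addChar_le (g : 𝓢(E, ℂ)) {χ : AddChar E Circle}
    (hχ : Continuous χ) (hnd : ∀ y, (∀ x, χ (x * y) = 1) → y = 0) (ν : Measure E)
    [ν.IsAddHaarMeasure] (k : ℕ) :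
    ∃ C, ∀ y, ‖∫ x, g x * (χ (x * y) : ℂ) ∂ν‖ ≤ C * ((1 + ‖y‖) ^ k)⁻¹ := by
  obtain ⟨L, hL⟩ := AddChar.exists_eq_fourierChar hχ
  let B : E →L[ℝ] E →L[ℝ] ℝ := (ContinuousLinearMap.compL ℝ E E ℝ L).comp (ContinuousLinearMap.mul ℝ E)
  have hB (x y) : B x y = L (x * y) := rfl
  have hF (y) : ∫ x, g x * (χ (x * y) : ℂ) ∂ν =
      VectorFourier.fourierIntegral Real.fourierChar ν B.toLinearMap₁₂ g y := by
    refine integral_congr_ae (ae_of_all _ fun x => ?_)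
    change g x * (χ (x * y) : ℂ) = Real.fourierChar (-L (x * y)) • g x
    rw [hL, Circle.smul_def, smul_eq_mul, mul_comm]
  set M := ∑ p ∈ Finset.range (0 + 1) ×ˢ Finset.range (k + 1),
    ∫ v, ‖v‖ ^ p.1 * ‖iteratedFDeriv ℝ p.2 g v‖ ∂ν
  set M₀ := ∫ v, ‖g v‖ ∂ν
  have hM : 0 ≤ M := Finset.sum_nonneg fun _ _ => integral_nonneg fun _ => by positivity
  have hM₀ : 0 ≤ M₀ := integral_nonneg fun _ => norm_nonneg _
  have h0 (y) : ‖∫ x, g x * (χ (x * y) : ℂ) ∂ν‖ ≤ M₀ := by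
    refine (norm_integral_le_integral_norm _).trans (le_of_eq ?_)
    refine integral_congr_ae (ae_of_all _ fun x => ?_)
    change ‖g x * (χ (x * y) : ℂ)‖ = ‖g x‖
    rw [norm_mul, Circle.norm_coe, mul_one]
  -- Integration by parts `k` times in the direction `v`. `M` collects the integrals of the
  -- derivatives of `g` up to order `k`.
  have h1 (v y) : |B v y| ^ k * ‖∫ x, g x * (χ (x * y) : ℂ) ∂ν‖ ≤ ‖v‖ ^ k * (2 ^ k * M) := by
    have := VectorFourier.pow_mul_norm_iteratedFDeriv_fourierIntegral_le (μ := ν) B (f := g)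
      (K := ⊤) (N := ⊤) (g.smooth ⊤) (fun i j _ _ => g.integrable_pow_mul_iteratedFDeriv ν i j)
      (k := 0) (n := k) le_top le_top v y
    rw [norm_iteratedFDeriv_zero, ← hF] at this
    simpa only [Nat.cast_zero, mul_zero, zero_add, pow_zero, mul_one, mul_assoc] using this
  -- Nondegeneracy of `χ` makes `y ↦ B(·, y)` injective, hence bounded below in finite dimension.
  -- This turns decay in `B v y`, for a well chosen `v` of norm less than `1`, into decay in `‖y‖`.
  obtain ⟨c, hc, hcanti⟩ := (B.flip : E →ₗ[ℝ] E →L[ℝ] ℝ).exists_antilipschitzWith (by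
    rw [LinearMap.ker_eq_bot']
    intro y hy
    refine hnd y fun x => ?_
    have : L (x * y) = 0 := by rw [← hB]; exact DFunLike.congr_fun hy x
    rw [hL, this, neg_zero, AddChar.map_zero_eq_one])
  have hcy (y) : ‖y‖ ≤ c * ‖B.flip y‖ := by
    simpa using hcanti.le_mul_dist y 0
  have h2 (y) : ‖y‖ ^ k * ‖∫ x, g x * (χ (x * y) : ℂ) ∂ν‖ ≤ (2 * c) ^ k * (2 ^ k * M) + M₀ := by
    rcases eq_or_ne y 0 with rfl | hy
    · rcases Nat.eq_zero_or_pos k with hk | hk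
      · rw [hk, pow_zero, one_mul]
        exact (h0 0).trans (le_add_of_nonneg_left (by positivity))
      · rw [norm_zero, zero_pow hk.ne', zero_mul]; positivity
    have hpos : 0 < ‖B.flip y‖ := by
      by_contra h
      have h3 := hcy y
      rw [le_antisymm (not_lt.1 h) (norm_nonneg _), mul_zero] at h3
      exact hy (norm_le_zero_iff.1 h3)
    obtain ⟨v, hv1, hv⟩ := (B.flip y).exists_lt_apply_of_lt_opNorm (half_lt_self hpos)
    have hv' : ‖y‖ ≤ 2 * c * |B v y| := by
      refine (hcy y).trans ?_
      have : ‖B.flip y‖ ≤ 2 * |B v y| := by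
        have : ‖(B.flip y) v‖ = |B v y| := rfl
        linarith
      calc (c : ℝ) * ‖B.flip y‖ ≤ c * (2 * |B v y|) := by gcongr
        _ = _ := by ring
    calc ‖y‖ ^ k * ‖∫ x, g x * (χ (x * y) : ℂ) ∂ν‖
        ≤ (2 * c * |B v y|) ^ k * ‖∫ x, g x * (χ (x * y) : ℂ) ∂ν‖ := by gcongr
      _ = (2 * c) ^ k * (|B v y| ^ k * ‖∫ x, g x * (χ (x * y) : ℂ) ∂ν‖) := by rw [mul_pow]; ring
      _ ≤ (2 * c) ^ k * (‖v‖ ^ k * (2 ^ k * M)) := mul_le_mul_of_nonneg_left (h1 v y) (by positivity)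
      _ ≤ (2 * c) ^ k * (1 * (2 ^ k * M)) := by gcongr; exact pow_le_one₀ (norm_nonneg _) hv1.le
      _ ≤ _ := by rw [one_mul]; exact le_add_of_nonneg_right hM₀
  -- The power of two comes from `(1 + a) ^ k ≤ 2 ^ (k - 1) * (1 + a ^ k)`, which holds also for `k
  -- = 0` with truncated subtraction.
  refine ⟨2 ^ (k - 1) * (M₀ + ((2 * c) ^ k * (2 ^ k * M) + M₀)), fun y => ?_⟩
  rw [← div_eq_mul_inv, le_div_iff₀ (by positivity), mul_comm]
  calc (1 + ‖y‖) ^ k * ‖∫ x, g x * (χ (x * y) : ℂ) ∂ν‖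
      ≤ (2 ^ (k - 1) * (1 ^ k + ‖y‖ ^ k)) * ‖∫ x, g x * (χ (x * y) : ℂ) ∂ν‖ := by
        gcongr; exact add_pow_le zero_le_one (norm_nonneg _) k
    _ = 2 ^ (k - 1) * (‖∫ x, g x * (χ (x * y) : ℂ) ∂ν‖ +
          ‖y‖ ^ k * ‖∫ x, g x * (χ (x * y) : ℂ) ∂ν‖) := by rw [one_pow]; ring
    _ ≤ _ := by gcongr; exacts [h0 y, h2 y]

end SchwartzDecay

/-! ### Slicing Haar measure along the Archimedean factor -/

section MeasureOnProduct

variable {E R : Type*} [NormedCommRing E] [NormedAlgebra ℝ E] [FiniteDimensional ℝ E]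
  [MeasurableSpace E] [BorelSpace E] [CommRing R] [TopologicalSpace R] [IsTopologicalRing R]
  [T2Space R] [MeasurableSpace (E × R)] [BorelSpace (E × R)]

/-- Slicing a Haar measure on `E × R` along a compact subset of `R` gives a multiple of the Haar
measure on `E`. -/
theorem exists_map_fst_restrict_eq_smul (μ : Measure (E × R)) [μ.IsAddHaarMeasure] {Q : Set R}
    (hQ : IsCompact Q) :
    ∃ c : NNReal, (μ.restrict (univ ×ˢ Q)).map Prod.fst = c • (Measure.addHaar : Measure E) := by
  have hm : Measurable (Prod.fst : E × R → E) := continuous_fst.measurable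
  set ν := (μ.restrict (univ ×ˢ Q)).map Prod.fst
  have hν (S : Set E) (hS : MeasurableSet S) : ν S = μ (S ×ˢ Q) := by
    rw [Measure.map_apply hm hS, Measure.restrict_apply (hm hS)]
    congr 1
    ext x; simp
  -- `R` carries no measure and `μ` is not assumed to be a product; the slice over `Q` is invariant
  -- under translations of `E` alone, which suffices to identify it up to a constant.
  have : ν.IsAddLeftInvariant := by
    refine ⟨fun a => Measure.ext fun S hS => ?_⟩
    rw [Measure.map_apply (measurable_const_add a) hS, hν _ (measurable_const_add a hS), hν _ hS,
      ← measure_preimage_add μ (a, 0) (S ×ˢ Q)]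
    congr 1
    ext x; simp
  have : IsFiniteMeasureOnCompacts ν := ⟨fun S hS => by
    rw [hν S hS.measurableSet]; exact (hS.prod hQ).measure_lt_top⟩
  exact ⟨_, Measure.isAddLeftInvariant_eq_smul ν Measure.addHaar⟩

/-- A Fubini-type formula. -/
theorem exists_integral_prod_indicator (μ : Measure (E × R)) [μ.IsAddHaarMeasure] {Q : Set R}
    (hQ : IsCompact Q) : ∃ c : NNReal, ∀ h : E → ℂ, Continuous h →
      ∫ x : E × R, h x.1 * Q.indicator 1 x.2 ∂μ = c * ∫ x, h x ∂Measure.addHaar := by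
  obtain ⟨c, hc⟩ := exists_map_fst_restrict_eq_smul μ hQ
  have hQm : MeasurableSet (univ ×ˢ Q : Set (E × R)) :=
    (hQ.isClosed.preimage continuous_snd).measurableSet.congr (by ext; simp)
  refine ⟨c, fun h hh => ?_⟩
  have h1 : ∫ x, h x ∂(c • (Measure.addHaar : Measure E)) = c * ∫ x, h x ∂Measure.addHaar := by
    rw [integral_smul_nnreal_measure]; rfl
  rw [← h1, ← hc, integral_map continuous_fst.aemeasurable hh.aestronglyMeasurable,
    ← integral_indicator hQm]
  refine integral_congr_ae (ae_of_all _ fun x => ?_)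
  by_cases hx : x.2 ∈ Q <;> simp [hx, indicator]

theorem integrable_prod_indicator (μ : Measure (E × R)) [μ.IsAddHaarMeasure] {Q : Set R}
    (hQ : IsCompact Q) {h : E → ℝ} (hh : Integrable h Measure.addHaar) :
    Integrable (fun x : E × R => h x.1 * Q.indicator 1 x.2) μ := by
  obtain ⟨c, hc⟩ := exists_map_fst_restrict_eq_smul μ hQ
  have hQm : MeasurableSet (univ ×ˢ Q : Set (E × R)) :=
    (hQ.isClosed.preimage continuous_snd).measurableSet.congr (by ext; simp)
  have h1 : Integrable h ((μ.restrict (univ ×ˢ Q)).map Prod.fst) := by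
    rw [hc]; exact hh.smul_measure_nnreal
  have h2 := (integrable_indicator_iff hQm).2 (h1.comp_measurable continuous_fst.measurable)
  refine h2.congr (ae_of_all _ fun x => ?_)
  by_cases hx : x.2 ∈ Q <;> simp [hx, indicator]

/-- A function with rapid decay along `E` and compact support along `R` has local majorants. -/
theorem HasLocalMajorant.of_norm_le (μ : Measure (E × R)) [μ.IsAddHaarMeasure] {Q : Set R}
    (hQ : IsCompact Q) {f : E × R → ℂ} {C : ℝ}
    (hf : ∀ x, ‖f x‖ ≤ C * ((1 + ‖x.1‖) ^ (Module.finrank ℝ E + 1))⁻¹ * Q.indicator 1 x.2) :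
    HasLocalMajorant μ f := by
  intro P hP
  set n := Module.finrank ℝ E + 1
  obtain ⟨r, hr⟩ := (hP.image continuous_fst).isBounded.exists_norm_le
  have hr' (a) (ha : a ∈ P) : ‖a.1‖ ≤ |r| := (hr _ ⟨a, ha, rfl⟩).trans (le_abs_self r)
  have hQ' : IsCompact (Q - Prod.snd '' P) := by
    rw [sub_eq_add_neg]; exact hQ.add (hP.image continuous_snd).neg
  refine ⟨_, integrable_prod_indicator μ hQ'
    ((integrable_inv_one_add_norm_pow Measure.addHaar).const_mul (|C| * (1 + |r|) ^ n)),
    fun x a ha => ?_⟩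
  refine (hf (x + a)).trans ?_
  -- Peetre's inequality `1 + ‖x‖ ≤ (1 + |r|) * (1 + ‖x + a‖)` for `‖a‖ ≤ |r|`.
  have h1 : ((1 + ‖(x + a).1‖) ^ n)⁻¹ ≤ (1 + |r|) ^ n * ((1 + ‖x.1‖) ^ n)⁻¹ := by
    rw [← div_eq_mul_inv, inv_le_comm₀ (by positivity) (by positivity), inv_div,
      div_le_iff₀ (by positivity), ← mul_pow]
    gcongr
    have h2 : ‖x.1‖ ≤ ‖x.1 + a.1‖ + ‖a.1‖ := by simpa using norm_sub_le (x.1 + a.1) a.1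
    have h3 := hr' a ha
    rw [Prod.fst_add]
    nlinarith [norm_nonneg (x.1 + a.1), abs_nonneg r]
  have h4 : Q.indicator 1 (x + a).2 ≤ (Q - Prod.snd '' P).indicator (1 : R → ℝ) x.2 := by
    by_cases h : (x + a).2 ∈ Q
    · have : x.2 ∈ Q - Prod.snd '' P := ⟨_, h, a.2, ⟨a, ha, rfl⟩, by simp⟩
      rw [indicator_of_mem h, indicator_of_mem this]
      exact le_rfl
    · rw [indicator_of_notMem h]
      exact indicator_nonneg (fun _ _ => zero_le_one) _
  calc _ ≤ |C| * ((1 + |r|) ^ n * ((1 + ‖x.1‖) ^ n)⁻¹) * (Q - Prod.snd '' P).indicator 1 x.2 := by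
        gcongr
        · exact indicator_nonneg (fun _ _ => zero_le_one) _
        · exact le_abs_self C
    _ = _ := by ring

end MeasureOnProduct

/-! ### Boxes `g ⊗ 1_O(u a - c)` and their Fourier transforms -/

section SchwartzBox
open scoped SchwartzMap

variable {E R : Type*} [NormedCommRing E] [NormedAlgebra ℝ E] [CommRing R]

/-- The function `(x, a) ↦ g x * 1_O(u * a - c)`. -/
noncomputable def schwartzBox (O : AddSubgroup R) (g : 𝓢(E, ℂ)) (u : Rˣ) (c : R) (x : E × R) : ℂ :=
  g x.1 * (O : Set R).indicator 1 (u * x.2 - c)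

/-- The annihilator of `O` with respect to a character of `E × R`. -/
def annihilator (ψ : AddChar (E × R) Circle) (O : AddSubgroup R) : AddSubgroup R where
  carrier := {z | ∀ o ∈ O, ψ (0, o * z) = 1}
  zero_mem' := fun o _ => by
    rw [mul_zero]; exact AddChar.map_zero_eq_one ψ
  add_mem' := fun {y z} hy hz o ho => by
    have : ((0 : E), o * (y + z)) = (0, o * y) + (0, o * z) := by simp [mul_add]
    rw [this, AddChar.map_add_eq_mul, hy o ho, hz o ho, one_mul]
  neg_mem' := fun {y} hy o ho => by
    have : ((0 : E), o * -y) = -(0, o * y) := by simp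
    rw [this, AddChar.map_neg_eq_inv, hy o ho, inv_one]

theorem mem_annihilator {ψ : AddChar (E × R) Circle} {O : AddSubgroup R} {z : R} :
    z ∈ annihilator ψ O ↔ ∀ o ∈ O, ψ (0, o * z) = 1 := Iff.rfl

/-- The restriction of a character of `E × R` to `E`. -/
noncomputable def AddChar.restrictFst (ψ : AddChar (E × R) Circle) : AddChar E Circle where
  toFun x := ψ (x, 0)
  map_zero_eq_one' := AddChar.map_zero_eq_one ψ
  map_add_eq_mul' x y := by rw [← AddChar.map_add_eq_mul, Prod.mk_add_mk, add_zero]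

theorem AddChar.restrictFst_apply (ψ : AddChar (E × R) Circle) (x : E) :
    ψ.restrictFst x = ψ (x, 0) := rfl

theorem AddChar.apply_prod (ψ : AddChar (E × R) Circle) (x : E × R) :
    ψ x = ψ.restrictFst x.1 * ψ (0, x.2) := by
  rw [restrictFst_apply, ← AddChar.map_add_eq_mul, Prod.mk_add_mk, add_zero, zero_add]

variable [TopologicalSpace R] [IsTopologicalRing R] [T2Space R] {O : AddSubgroup R}

theorem isCompact_preimage_unit_mul_sub (hOc : IsCompact (O : Set R)) (u : Rˣ) (c : R) :
    IsCompact {a | u * a - c ∈ O} := by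
  convert hOc.image (f := fun o => (u⁻¹ : Rˣ) * (o + c)) (by fun_prop) using 1
  ext a
  constructor
  · exact fun ha => ⟨_, ha, by simp⟩
  · rintro ⟨o, ho, rfl⟩
    simpa using ho

theorem continuous_schwartzBox (hOo : IsOpen (O : Set R)) (g : 𝓢(E, ℂ)) (u : Rˣ) (c : R) :
    Continuous (schwartzBox O g u c) := by
  have h1 : Continuous ((O : Set R).indicator (1 : R → ℂ)) :=
    (continuous_const (y := (1 : ℂ))).indicator fun a ha => by
      rw [IsClopen.frontier_eq ⟨O.isClosed_of_isOpen hOo, hOo⟩] at ha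
      exact ha.elim
  exact (g.continuous.comp continuous_fst).mul (h1.comp (by fun_prop))

variable [FiniteDimensional ℝ E]
  [MeasurableSpace E] [BorelSpace E] [MeasurableSpace (E × R)] [BorelSpace (E × R)]
  {μ : Measure (E × R)} [μ.IsAddHaarMeasure]

theorem hasLocalMajorant_schwartzBox (hOc : IsCompact (O : Set R)) (g : 𝓢(E, ℂ)) (u : Rˣ) (c : R) :
    HasLocalMajorant μ (schwartzBox O g u c) := by
  obtain ⟨C, hC⟩ := g.exists_norm_le_inv_pow (Module.finrank ℝ E + 1)
  refine HasLocalMajorant.of_norm_le μ (isCompact_preimage_unit_mul_sub hOc u c) (C := C)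
    fun x => ?_
  by_cases h : u * x.2 - c ∈ O
  · rw [schwartzBox, indicator_of_mem (show u * x.2 - c ∈ (O : Set R) from h),
      indicator_of_mem (show x.2 ∈ {a | u * a - c ∈ O} from h)]
    simpa using hC x.1
  · rw [schwartzBox, indicator_of_notMem (show u * x.2 - c ∉ (O : Set R) from h),
      indicator_of_notMem (show x.2 ∉ {a | u * a - c ∈ O} from h)]
    simp

variable {ψ : AddChar (E × R) Circle}

/-- The Fourier transform of `g ⊗ 1_O(u a - c)`. -/
theorem exists_ringFourier_schwartzBox (hψ : Continuous ψ) (hOc : IsCompact (O : Set R)) (u : Rˣ)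
    (c : R) : ∃ r : NNReal, ∀ (g : 𝓢(E, ℂ)) y, ringFourier ψ μ (schwartzBox O g u c) y =
      (annihilator ψ O : Set R).indicator 1 (u⁻¹ * y.2) * (ψ (0, u⁻¹ * c * y.2) : ℂ) *
        (r * ∫ x, g x * (ψ.restrictFst (x * y.1) : ℂ) ∂Measure.addHaar) := by
  obtain ⟨r, hr⟩ := exists_integral_prod_indicator μ (isCompact_preimage_unit_mul_sub hOc u c)
  have hψE : Continuous ψ.restrictFst :=
    hψ.comp (by fun_prop : Continuous fun x : E => (x, (0 : R)))
  refine ⟨r, fun g y => ?_⟩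
  by_cases hy : u⁻¹ * y.2 ∈ annihilator ψ O
  · have hr' := hr (fun x => g x * (ψ.restrictFst (x * y.1) : ℂ))
      (g.continuous.mul (continuous_subtype_val.comp (hψE.comp (continuous_mul_const _))))
    rw [indicator_of_mem (show _ ∈ (annihilator ψ O : Set R) from hy), Pi.one_apply, one_mul,
      ← hr', ringFourier, ← integral_const_mul]
    refine integral_congr_ae (ae_of_all _ fun x => ?_)
    simp only
    by_cases h : u * x.2 - c ∈ O
    · rw [schwartzBox, indicator_of_mem (show u * x.2 - c ∈ (O : Set R) from h),
        indicator_of_mem (show x.2 ∈ {a | u * a - c ∈ O} from h), Pi.one_apply, Pi.one_apply,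
        mul_one, mul_one, ψ.apply_prod (x * y)]
      -- On the box `u * x.2 - c` lies in `O`, so the first summand pairs trivially with the
      -- annihilator and only the constant phase from `u⁻¹ * c * y.2` remains.
      have e1 : (x * y).2 = (u * x.2 - c) * (u⁻¹ * y.2) + u⁻¹ * c * y.2 := by
        rw [Prod.snd_mul]
        have : (u : R) * (u⁻¹ : Rˣ) = 1 := u.mul_inv
        linear_combination (-x.2 * y.2) * this
      have e2 : ψ (0, (x * y).2) = ψ (0, u⁻¹ * c * y.2) := by
        rw [e1, show ((0 : E), (u * x.2 - c) * (u⁻¹ * y.2) + u⁻¹ * c * y.2) =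
          (0, (u * x.2 - c) * (u⁻¹ * y.2)) + (0, u⁻¹ * c * y.2) by simp,
          AddChar.map_add_eq_mul, hy _ h, one_mul]
      rw [e2, Circle.coe_mul, Prod.fst_mul]
      ring
    · rw [schwartzBox, indicator_of_notMem (show u * x.2 - c ∉ (O : Set R) from h),
        indicator_of_notMem (show x.2 ∉ {a | u * a - c ∈ O} from h)]
      simp
  · rw [indicator_of_notMem (show _ ∉ (annihilator ψ O : Set R) from hy), zero_mul, zero_mul]
    obtain ⟨o, ho, h⟩ := by
      rw [mem_annihilator] at hy
      push Not at hy
      exact hy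
    -- Translating `x` by `(0, u⁻¹ * o)` preserves the box and multiplies the integral by `ψ (0, o *
    -- (u⁻¹ * y.2))`, which differs from `1`; so the integral is zero.
    have h1 : ringFourier ψ μ (schwartzBox O g u c) y =
        ringFourier ψ μ (schwartzBox O g u c) y * (ψ (0, o * (u⁻¹ * y.2)) : ℂ) := by
      unfold ringFourier
      rw [← integral_mul_const, ← integral_add_right_eq_self _ ((0 : E), (u⁻¹ : Rˣ) * o)]
      refine integral_congr_ae (ae_of_all _ fun x => ?_)
      simp only
      have e1 : schwartzBox O g u c (x + (0, (u⁻¹ : Rˣ) * o)) = schwartzBox O g u c x := by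
        have e3 : u * (x + ((0 : E), (u⁻¹ : Rˣ) * o)).2 - c = (u * x.2 - c) + o := by
          simp only [Prod.snd_add, mul_add, Units.mul_inv_cancel_left]; ring
        rw [schwartzBox, schwartzBox, e3, Prod.fst_add, add_zero]
        congr 1
        by_cases h : u * x.2 - c ∈ O
        · rw [indicator_of_mem (show _ ∈ (O : Set R) from h),
            indicator_of_mem (show _ ∈ (O : Set R) from add_mem h ho)]; rfl
        · rw [indicator_of_notMem (show _ ∉ (O : Set R) from h), indicator_of_notMem]
          exact fun h' => h ((O.add_mem_cancel_right ho).1 h')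
      have e2 : (x + ((0 : E), (u⁻¹ : Rˣ) * o)) * y = x * y + (0, o * (u⁻¹ * y.2)) := by
        ext
        · simp
        · simp; ring
      rw [e1, e2, AddChar.map_add_eq_mul, Circle.coe_mul, mul_assoc]
    by_contra h0
    exact h (Circle.ext (mul_left_cancel₀ h0 (h1.symm.trans (mul_one _).symm)))

/-- The annihilator of a compact subgroup is open. -/
theorem isOpen_annihilator (hψ : Continuous ψ) (hOc : IsCompact (O : Set R)) :
    IsOpen (annihilator ψ O : Set R) := by
  refine AddSubgroup.isOpen_of_mem_nhds _ (g := 0) ?_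
  have h1 : ∀ᶠ z in 𝓝 (0 : R), ∀ o ∈ (O : Set R), dist (ψ (0, o * z)) 1 < 1 / 2 := by
    refine hOc.eventually_forall_of_forall_eventually fun o _ => ?_
    have : Continuous fun p : R × R => dist (ψ (0, p.2 * p.1)) 1 := by fun_prop
    refine this.continuousAt.eventually_lt continuousAt_const ?_
    have : ψ (0, o * 0) = 1 := by rw [mul_zero]; exact AddChar.map_zero_eq_one ψ
    simp only [this, dist_self]
    norm_num
  filter_upwards [h1] with z hz o ho
  -- `O` is a subgroup, so the powers of `ψ (0, o * z)` are the values at `n • o`, all near `1` by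
  -- the choice of `z`.
  refine Circle.eq_one_of_forall_pow_dist_lt fun n => ?_
  have h2 := hz _ (O.nsmul_mem ho n)
  have : ((0 : E), (n • o) * z) = n • (0, o * z) := by
    rw [Prod.smul_mk, smul_zero, smul_mul_assoc]
  rwa [this, AddChar.map_nsmul_eq_pow] at h2

end SchwartzBox

/-! ### Fourier inversion makes the character nondegenerate -/

section Nondegenerate

variable {A : Type*} [CommRing A] [MeasurableSpace A] {μ : Measure A} {ψ : AddChar A Circle}

/-- Fourier inversion for a family of functions that separates points from zero forces the
character to be nondegenerate. -/
theorem eq_zero_of_forall_mul_eq_one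
    (hsep : ∀ x : A, x ≠ 0 → ∃ f : A → ℂ,
      (∀ z, ringFourier ψ μ (ringFourier ψ μ f) z = f (-z)) ∧ f x ≠ f 0)
    (x : A) (hx : ∀ a, ψ (x * a) = 1) : x = 0 := by
  by_contra h0
  obtain ⟨f, hf, hne⟩ := hsep x h0
  refine hne ?_
  have h1 := hf (-x)
  have h2 := hf 0
  rw [neg_neg] at h1
  rw [neg_zero] at h2
  -- If `ψ` is trivial on `x * A`, a double transform takes the same value at `-x` and at `0`, so
  -- inversion would give `f x = f 0`.
  rw [← h1, ← h2]
  refine integral_congr_ae (ae_of_all _ fun y => ?_)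
  have : ψ (y * -x) = ψ (y * 0) := by
    rw [mul_zero, AddChar.map_zero_eq_one, mul_neg, AddChar.map_neg_eq_inv, mul_comm, hx, inv_one]
  simp only [this]

end Nondegenerate

/-! ### Poisson summation for combinations of boxes -/

section PoissonOnProduct
open scoped SchwartzMap

variable {E R : Type*} [NormedCommRing E] [NormedAlgebra ℝ E] [FiniteDimensional ℝ E]
  [MeasurableSpace E] [BorelSpace E]
  [CommRing R] [TopologicalSpace R] [IsTopologicalRing R] [T2Space R]
  [MeasurableSpace (E × R)] [BorelSpace (E × R)]
  {μ : Measure (E × R)} [μ.IsAddHaarMeasure] {O : AddSubgroup R} {ψ : AddChar (E × R) Circle}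

theorem AddChar.continuous_restrictFst (hψ : Continuous ψ) : Continuous ψ.restrictFst :=
  hψ.comp (by fun_prop : Continuous fun x : E => (x, (0 : R)))

theorem continuous_integral_mul_addChar (g : 𝓢(E, ℂ)) {χ : AddChar E Circle} (hχ : Continuous χ)
    (ν : Measure E) [ν.IsAddHaarMeasure] :
    Continuous fun y => ∫ x, g x * (χ (x * y) : ℂ) ∂ν := by
  have hc (y) : Continuous fun x => g x * (χ (x * y) : ℂ) :=
    g.continuous.mul (continuous_subtype_val.comp (hχ.comp (continuous_mul_const y)))
  refine continuous_of_dominated (bound := fun x => ‖g x‖)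
    (fun y => (hc y).aestronglyMeasurable) (fun y => ae_of_all _ fun x => ?_)
    (g.integrable (μ := ν)).norm (ae_of_all _ fun x => ?_)
  · rw [norm_mul, Circle.norm_coe, mul_one]
  · exact continuous_const.mul (continuous_subtype_val.comp (hχ.comp (continuous_const_mul x)))

/-- An open subgroup `H` of `R` such that `W × H` has finite measure for some open `W` is
compact. -/
theorem AddSubgroup.isCompact_of_measure_prod_ne_top (hOc : IsCompact (O : Set R))
    (hOo : IsOpen (O : Set R)) {H : AddSubgroup R} (hH : IsOpen (H : Set R)) {W : Set E}
    (hW : IsOpen W) (hW0 : W.Nonempty) (hfin : μ (W ×ˢ (H : Set R)) ≠ ⊤) :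
    IsCompact (H : Set R) := by
  -- `P` is open and compact, so `H` is compact as soon as `H / P` is finite. Otherwise infinitely
  -- many disjoint translates of `W × P`, all of the same positive measure, lie in `W × H`.
  let P := O ⊓ H
  have hPo : IsOpen (P : Set R) := hOo.inter hH
  have hPc : IsCompact (P : Set R) := hOc.inter_right (H.isClosed_of_isOpen hH)
  let Q := H ⧸ P.addSubgroupOf H
  let s : Q → H := Quotient.out
  have hs (q : Q) : (s q : Q) = q := Quotient.out_eq q
  rcases finite_or_infinite Q with hfinQ | hinf
  · have : (H : Set R) = ⋃ q : Q, (s q : R) +ᵥ (P : Set R) := by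
      ext x
      simp only [mem_iUnion]
      constructor
      · intro hx
        refine ⟨((⟨x, hx⟩ : H) : Q), x - s ((⟨x, hx⟩ : H) : Q), ?_, by simp⟩
        have := QuotientAddGroup.eq.1 (hs ((⟨x, hx⟩ : H) : Q))
        rw [AddSubgroup.mem_addSubgroupOf] at this
        rw [sub_eq_neg_add]
        exact this
      · rintro ⟨q, p, hp, rfl⟩
        exact H.add_mem (s q).2 hp.2
    rw [this]
    exact isCompact_iUnion fun q => hPc.vadd _
  · refine (hfin (top_unique ?_)).elim
    let T : ℕ → Set (E × R) := fun n => ((0 : E), (s (Infinite.natEmbedding Q n) : R)) +ᵥ (W ×ˢ (P : Set R))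
    have hT (n) : T n ⊆ W ×ˢ (H : Set R) := by
      rintro _ ⟨x, hx, rfl⟩
      refine ⟨?_, H.add_mem (s _).2 hx.2.2⟩
      simpa using hx.1
    have hWP : IsOpen (W ×ˢ (P : Set R)) := hW.prod hPo
    have hTm (n) : MeasurableSet (T n) := (hWP.vadd _).measurableSet
    have hTd : Pairwise (Function.onFun Disjoint T) := by
      intro m n hmn
      refine Set.disjoint_left.2 ?_
      rintro _ ⟨x, hx, rfl⟩ ⟨y, hy, hxy⟩
      refine hmn ((Infinite.natEmbedding Q).injective ?_)
      rw [← hs (Infinite.natEmbedding Q m), ← hs (Infinite.natEmbedding Q n)]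
      refine QuotientAddGroup.eq.2 ?_
      rw [AddSubgroup.mem_addSubgroupOf]
      have h2 : (s (Infinite.natEmbedding Q n) : R) + y.2 = s (Infinite.natEmbedding Q m) + x.2 :=
        congrArg Prod.snd hxy
      have : ((-s (Infinite.natEmbedding Q m) + s (Infinite.natEmbedding Q n) : H) : R) =
          x.2 - y.2 := by
        push_cast
        linear_combination h2
      rw [this]
      exact P.sub_mem hx.2 hy.2
    have hpos : μ (W ×ˢ (P : Set R)) ≠ 0 := (hWP.measure_pos μ (hW0.prod ⟨0, P.zero_mem⟩)).ne'
    calc ⊤ = ∑' n : ℕ, μ (T n) := by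
          simp_rw [T, measure_vadd]
          exact (ENNReal.tsum_const_eq_top_of_ne_zero hpos).symm
      _ = μ (⋃ n, T n) := (measure_iUnion hTd hTm).symm
      _ ≤ _ := measure_mono (iUnion_subset hT)

/-- Fourier inversion for a single function makes the annihilator of `O` compact. -/
theorem isCompact_annihilator (hψ : Continuous ψ) (hOc : IsCompact (O : Set R))
    (hOo : IsOpen (O : Set R)) {g : 𝓢(E, ℂ)}
    (hg : ringFourier ψ μ (ringFourier ψ μ (schwartzBox O g 1 0)) 0 ≠ 0) :
    IsCompact (annihilator ψ O : Set R) := by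
  obtain ⟨r, hr⟩ := exists_ringFourier_schwartzBox (μ := μ) hψ hOc 1 0
  set F := ringFourier ψ μ (schwartzBox O g 1 0)
  have h1 : ringFourier ψ μ F 0 = ∫ y, F y ∂μ := by
    refine integral_congr_ae (ae_of_all _ fun x => ?_)
    simp only [mul_zero, AddChar.map_zero_eq_one, Circle.coe_one, mul_one]
  rw [h1] at hg
  -- The integral of a non-integrable function is `0` by convention, so a nonzero double transform
  -- at `0` forces the transform `F` to be integrable. As `F` is `G` times the indicator of the
  -- annihilator, the product of the annihilator with an open set where `G` is bounded below has
  -- finite measure.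
  have hint : Integrable F μ := by
    by_contra h
    exact hg (integral_undef h)
  obtain ⟨y₀, hy₀⟩ : ∃ y, F y ≠ 0 := by
    by_contra! h
    exact hg (by simp [h])
  let G : E → ℂ := fun y => r * ∫ x, g x * (ψ.restrictFst (x * y) : ℂ) ∂Measure.addHaar
  have hG : Continuous G :=
    continuous_const.mul (continuous_integral_mul_addChar g (AddChar.continuous_restrictFst hψ) _)
  have hF (y) : F y = (annihilator ψ O : Set R).indicator 1 y.2 * G y.1 := by
    have := hr g y
    have h0 : ψ ((0 : E), ((1⁻¹ : Rˣ) : R) * 0 * y.2) = 1 := by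
      rw [mul_zero, zero_mul]; exact AddChar.map_zero_eq_one ψ
    rw [h0, inv_one, Units.val_one, one_mul, Circle.coe_one, mul_one] at this
    exact this
  have hG0 : G y₀.1 ≠ 0 := fun h => hy₀ (by rw [hF, h, mul_zero])
  have hε : 0 < ‖G y₀.1‖ / 2 := half_pos (norm_pos_iff.2 hG0)
  refine AddSubgroup.isCompact_of_measure_prod_ne_top (μ := μ) hOc hOo (isOpen_annihilator hψ hOc)
    (W := {y | ‖G y₀.1‖ / 2 < ‖G y‖}) (isOpen_lt continuous_const hG.norm)
    ⟨y₀.1, half_lt_self (norm_pos_iff.2 hG0)⟩ ?_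
  refine ((measure_mono ?_).trans_lt (hint.measure_norm_ge_lt_top hε)).ne
  rintro y ⟨hy1, hy2⟩
  rw [mem_ofPred_eq, hF, indicator_of_mem hy2, Pi.one_apply, one_mul]
  exact le_of_lt hy1

/-- The finite part of the transform is supported on `u` times the annihilator of `O`, which is
compact. The Archimedean part decays rapidly because `ψ` remains nondegenerate on `E`: testing `(y,
0)` against `E × R` only sees `E`. -/
theorem hasLocalMajorant_ringFourier_schwartzBox (hψ : Continuous ψ)
    (hnd : ∀ x, (∀ a, ψ (x * a) = 1) → x = 0) (hOc : IsCompact (O : Set R))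
    (hann : IsCompact (annihilator ψ O : Set R)) (g : 𝓢(E, ℂ)) (u : Rˣ) (c : R) :
    HasLocalMajorant μ (ringFourier ψ μ (schwartzBox O g u c)) := by
  obtain ⟨r, hr⟩ := exists_ringFourier_schwartzBox (μ := μ) hψ hOc u c
  obtain ⟨C, hC⟩ := g.exists_norm_integral_mul_addChar_le (χ := ψ.restrictFst)
    (AddChar.continuous_restrictFst hψ) (fun y hy => by
      have := hnd (y, 0) fun a => by
        have h := hy a.1
        rw [AddChar.restrictFst_apply] at h
        rw [← h]
        congr 1
        ext <;> simp [mul_comm]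
      exact congrArg Prod.fst this) Measure.addHaar (Module.finrank ℝ E + 1)
  refine HasLocalMajorant.of_norm_le μ (isCompact_preimage_unit_mul_sub hann u⁻¹ 0) (C := r * C)
    fun y => ?_
  rw [hr]
  by_cases h : (u⁻¹ : Rˣ) * y.2 ∈ annihilator ψ O
  · rw [indicator_of_mem (show _ ∈ (annihilator ψ O : Set R) from h),
      indicator_of_mem (show y.2 ∈ {a : R | ((u⁻¹ : Rˣ) : R) * a - 0 ∈ annihilator ψ O} by simpa using h),
      Pi.one_apply, Pi.one_apply, one_mul, mul_one, norm_mul, Circle.norm_coe, one_mul, norm_mul,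
      mul_assoc]
    have hrn : ‖((r : ℝ) : ℂ)‖ = r := by simp
    rw [hrn]
    exact mul_le_mul_of_nonneg_left (hC y.1) r.2
  · rw [indicator_of_notMem (show _ ∉ (annihilator ψ O : Set R) from h),
      indicator_of_notMem (show y.2 ∉ {a : R | ((u⁻¹ : Rˣ) : R) * a - 0 ∈ annihilator ψ O} by
        simpa using h)]
    simp

/-- Only the test function that fixes the covolume needs a continuous transform, since Poisson
summation is applied to that transform; hence `u = 1` and `c = 0`. -/
theorem continuous_ringFourier_schwartzBox (hψ : Continuous ψ) (hOc : IsCompact (O : Set R))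
    (g : 𝓢(E, ℂ)) :
    Continuous (ringFourier ψ μ (schwartzBox O g 1 0)) := by
  obtain ⟨r, hr⟩ := exists_ringFourier_schwartzBox (μ := μ) hψ hOc 1 0
  have h : ringFourier ψ μ (schwartzBox O g 1 0) = fun y => (annihilator ψ O : Set R).indicator 1 y.2 *
      (r * ∫ x, g x * (ψ.restrictFst (x * y.1) : ℂ) ∂Measure.addHaar) := by
    funext y
    have := hr g y
    have h0 : ψ ((0 : E), ((1⁻¹ : Rˣ) : R) * 0 * y.2) = 1 := by
      rw [mul_zero, zero_mul]; exact AddChar.map_zero_eq_one ψ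
    rw [h0, inv_one, Units.val_one, one_mul, Circle.coe_one, mul_one] at this
    exact this
  rw [h]
  have ho := isOpen_annihilator hψ hOc
  have h1 : Continuous ((annihilator ψ O : Set R).indicator (1 : R → ℂ)) :=
    (continuous_const (y := (1 : ℂ))).indicator fun a ha => by
      rw [IsClopen.frontier_eq ⟨(annihilator ψ O).isClosed_of_isOpen ho, ho⟩] at ha
      exact ha.elim
  exact (h1.comp continuous_snd).mul (continuous_const.mul ((continuous_integral_mul_addChar g
    (AddChar.continuous_restrictFst hψ) _).comp continuous_fst))

/-- Dilation by a unit preserves the functions `g ⊗ 1_O(u a - c)`. -/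
theorem exists_schwartzBox_comp_mul (g : 𝓢(E, ℂ)) (u : Rˣ) (c : R) (t : (E × R)ˣ) :
    ∃ (g' : 𝓢(E, ℂ)) (u' : Rˣ), ∀ x, schwartzBox O g u c (x * t) = schwartzBox O g' u' c x := by
  let T : E ≃L[ℝ] E := ContinuousLinearEquiv.equivOfInverse
    ((ContinuousLinearMap.mul ℝ E).flip (t : E × R).1)
    ((ContinuousLinearMap.mul ℝ E).flip ((t⁻¹ : (E × R)ˣ) : E × R).1)
    (fun x => by
      change x * (t : E × R).1 * ((t⁻¹ : (E × R)ˣ) : E × R).1 = x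
      rw [mul_assoc, ← Prod.fst_mul, Units.mul_inv, Prod.fst_one, mul_one])
    (fun x => by
      change x * ((t⁻¹ : (E × R)ˣ) : E × R).1 * (t : E × R).1 = x
      rw [mul_assoc, ← Prod.fst_mul, Units.inv_mul, Prod.fst_one, mul_one])
  refine ⟨SchwartzMap.compCLMOfContinuousLinearEquiv ℝ T g, u * Units.map (RingHom.snd E R) t,
    fun x => ?_⟩
  have : SchwartzMap.compCLMOfContinuousLinearEquiv ℝ T g x.1 = g (x.1 * (t : E × R).1) := rfl
  rw [schwartzBox, schwartzBox, this]
  congr 2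
  simp only [Prod.snd_mul, Units.val_mul, Units.coe_map]
  simp
  ring

variable {K : Type*} [Field K] [Countable K] [Infinite K] [Algebra K (E × R)]

/-- Poisson summation for the span of the functions `g ⊗ 1_O(u a - c)`. -/
theorem tsum_eq_tsum_ringFourier_of_mem_span [LocallyCompactSpace R] (hψ : Continuous ψ) (hψ1 : ψ ≠ 1)
    (hK : ∀ k : K, ψ (algebraMap K (E × R) k) = 1) (hnd : ∀ x, (∀ a, ψ (x * a) = 1) → x = 0)
    {C : Set (E × R)} (hC : IsCompact C) (hKC : ∀ a, ∃ k : K, algebraMap K (E × R) k + a ∈ C)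
    (hOc : IsCompact (O : Set R)) (hOo : IsOpen (O : Set R))
    {g₀ : 𝓢(E, ℂ)} {p₀ : E → ℝ} (hp₀ : ∀ x, g₀ x = p₀ x) (hp₀0 : ∀ x, 0 ≤ p₀ x) (hp₀1 : 0 < p₀ 0)
    (hp₀n : ∀ x, p₀ (-x) = p₀ x)
    (hinv : ∀ x, ringFourier ψ μ (ringFourier ψ μ (schwartzBox O g₀ 1 0)) x =
      schwartzBox O g₀ 1 0 (-x))
    {f : E × R → ℂ} (hf : f ∈ Submodule.span ℂ {f | ∃ (g : 𝓢(E, ℂ)) (u : Rˣ) (c : R),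
      f = schwartzBox O g u c})
    (t : (E × R)ˣ) {m : ℂ} (hm0 : m ≠ 0) (hm : ∀ h : E × R → ℂ, ∫ x, h (x * t) ∂μ = 1 / m * ∫ x, h x ∂μ) :
    Integrable f μ ∧
    Summable (fun k : K => f (algebraMap K (E × R) k * t)) ∧
      Summable (fun k : K => ringFourier ψ μ f (algebraMap K (E × R) k * (t⁻¹ : (E × R)ˣ))) ∧
      ∑' k : K, f (algebraMap K (E × R) k * t) =
        1 / m * ∑' k : K, ringFourier ψ μ f (algebraMap K (E × R) k * (t⁻¹ : (E × R)ˣ)) := by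
  have hbox (x) : ((p₀ x.1 * (O : Set R).indicator 1 x.2 : ℝ) : ℂ) = schwartzBox O g₀ 1 0 x := by
    rw [schwartzBox, hp₀, Units.val_one, one_mul, sub_zero]
    by_cases h : x.2 ∈ (O : Set R) <;> simp [h]
  have hbox' : (fun x => ((p₀ x.1 * (O : Set R).indicator 1 x.2 : ℝ) : ℂ)) =
    schwartzBox O g₀ 1 0 := funext hbox
  -- By inversion the double transform of the test box at `0` is `p₀ 0`, which is nonzero.
  have hann : IsCompact (annihilator ψ O : Set R) := isCompact_annihilator (μ := μ) hψ hOc hOo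
    (g := g₀) (by
      rw [hinv, neg_zero, ← hbox]
      simpa using hp₀1.ne')
  have hcont := continuous_schwartzBox (E := E) hOo
  have hp (f : E × R → ℂ) (hf : Continuous f) (hfm : HasLocalMajorant μ f)
      (hfm' : HasLocalMajorant μ (ringFourier ψ μ f)) :=
    tsum_eq_tsum_ringFourier (μ := μ) hψ hψ1 hK hnd hC hKC
      (f₀ := fun x => p₀ x.1 * (O : Set R).indicator 1 x.2)
      (by
        have := Complex.continuous_re.comp (hcont g₀ 1 0)
        refine this.congr fun x => ?_
        rw [Function.comp_apply, ← hbox, Complex.ofReal_re])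
      (fun x => mul_nonneg (hp₀0 _) (indicator_nonneg (fun _ _ => zero_le_one) _))
      (by simpa using hp₀1)
      (by rw [hbox']; exact hasLocalMajorant_schwartzBox hOc g₀ 1 0)
      (by rw [hbox']; exact continuous_ringFourier_schwartzBox hψ hOc g₀)
      (by rw [hbox']; exact hasLocalMajorant_ringFourier_schwartzBox hψ hnd hOc hann g₀ 1 0)
      -- Inversion yields the value at `-x`; the test box is even since `p₀` is even and `O` is a
      -- subgroup.
      (fun x => by
        rw [hbox', hinv, hbox, ← hbox, ← hbox]
        simp only [Prod.fst_neg, hp₀n, Prod.snd_neg]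
        have : (O : Set R).indicator (1 : R → ℝ) (-x.2) = (O : Set R).indicator 1 x.2 := by
          by_cases h : x.2 ∈ O
          · rw [indicator_of_mem (show -x.2 ∈ (O : Set R) from O.neg_mem h),
              indicator_of_mem (show x.2 ∈ (O : Set R) from h)]; rfl
          · rw [indicator_of_notMem (show -x.2 ∉ (O : Set R) by simpa using h),
              indicator_of_notMem (show x.2 ∉ (O : Set R) from h)]
        rw [this]) hf hfm hfm'
  have hint (g u c) : Integrable (schwartzBox (E := E) O g u c) μ :=
    (hasLocalMajorant_schwartzBox hOc g u c).integrable (hcont g u c)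
  have hψ' (f : E × R → ℂ) (hf : Integrable f μ) (y : E × R) :
      Integrable (fun x => f x * (ψ (x * y) : ℂ)) μ :=
    hf.mul_bdd (c := 1) (continuous_subtype_val.comp
      (hψ.comp (continuous_mul_const y))).aestronglyMeasurable
      (ae_of_all _ fun x => (Circle.norm_coe _).le)
  -- Integrability is carried along because the transform is additive only on integrable functions.
  induction hf using Submodule.span_induction with
  | mem f hf =>
    obtain ⟨g, u, c, rfl⟩ := hf
    obtain ⟨g', u', ht⟩ := exists_schwartzBox_comp_mul (O := O) g u c t
    -- Change of variables `x ↦ x * t` in the transform of the dilated box; `hm` supplies the factor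
    -- `1 / m`.
    have hF (y) : ringFourier ψ μ (schwartzBox O g' u' c) y =
        1 / m * ringFourier ψ μ (schwartzBox O g u c) (y * (t⁻¹ : (E × R)ˣ)) := by
      rw [ringFourier, ringFourier, ← hm]
      refine integral_congr_ae (ae_of_all _ fun x => ?_)
      have : x * t * (y * (t⁻¹ : (E × R)ˣ)) = x * y := by
        rw [mul_mul_mul_comm, Units.mul_inv, mul_one]
      simp only [ht, this]
    obtain ⟨h1, h2, h3⟩ := hp _ (hcont g' u' c) (hasLocalMajorant_schwartzBox hOc g' u' c)
      (hasLocalMajorant_ringFourier_schwartzBox hψ hnd hOc hann g' u' c)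
    simp only [hF, tsum_mul_left] at h2 h3
    simp only [ht]
    exact ⟨hint g u c, h1, (summable_mul_left_iff (one_div_ne_zero hm0)).1 h2, h3⟩
  | zero =>
    have h0 : ringFourier ψ μ 0 = 0 := by funext y; simp [ringFourier]
    refine ⟨integrable_zero _ _ _, ?_, ?_, ?_⟩ <;> simp [h0, summable_zero]
  | add f g _ _ hf hg =>
    obtain ⟨f1, f2, f3, f4⟩ := hf
    obtain ⟨g1, g2, g3, g4⟩ := hg
    have h0 (y) : ringFourier ψ μ (f + g) y = ringFourier ψ μ f y + ringFourier ψ μ g y := by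
      rw [ringFourier, ringFourier, ringFourier, ← integral_add (hψ' f f1 y) (hψ' g g1 y)]
      simp only [Pi.add_apply, add_mul]
    simp only [h0, Pi.add_apply]
    refine ⟨f1.add g1, f2.add g2, f3.add g3, ?_⟩
    rw [f2.tsum_add g2, f3.tsum_add g3, f4, g4, mul_add]
  | smul a f _ hf =>
    obtain ⟨f1, f2, f3, f4⟩ := hf
    have h0 (y) : ringFourier ψ μ (a • f) y = a * ringFourier ψ μ f y := by
      rw [ringFourier, ringFourier, ← integral_const_mul]
      simp only [Pi.smul_apply, smul_eq_mul, mul_assoc]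
    simp only [h0, Pi.smul_apply, smul_eq_mul]
    refine ⟨f1.smul a, f2.mul_left a, f3.mul_left a, ?_⟩
    rw [tsum_mul_left, tsum_mul_left, f4, mul_left_comm]

end PoissonOnProduct

/-! ### Finiteness of residue fields and compactness of `O_v` -/

namespace GlobalField

variable {K : Type*} [Field K]

section Center

variable {R₀ L : Type*} [CommRing R₀] [IsDomain R₀] [Field L] [Algebra R₀ L]
    [IsFractionRing R₀ L] [Algebra R₀ K] [Algebra L K] [IsScalarTower R₀ L K]

/-- Infinite descent: in any relation all coefficients are divisible by `π`, and dividing them gives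
another relation, so they are divisible by every power of `π`. -/
theorem linearIndependent_of_forall_dvd (hinj : Function.Injective (algebraMap R₀ K)) {ι : Type*}
    [Fintype ι] {π : R₀} (hπ : π ≠ 0) (hπ0 : ∀ c : R₀, (∀ n : ℕ, π ^ n ∣ c) → c = 0) {e : ι → K}
    (key : ∀ c : ι → R₀, ∑ i, c i • e i = 0 → ∀ i, π ∣ c i) : LinearIndependent R₀ e := by
  have key2 (m : ℕ) : ∀ c : ι → R₀, ∑ i, c i • e i = 0 → ∀ i, π ^ m ∣ c i := by
    induction m with
    | zero => simp
    | succ m ih =>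
      intro c hc i
      choose d hd using key c hc
      have hd0 : ∑ i, d i • e i = 0 := by
        have h3 : π • ∑ i, d i • e i = 0 := by
          rw [Finset.smul_sum, ← hc]
          exact Finset.sum_congr rfl fun i _ => by rw [smul_smul, ← hd]
        rw [Algebra.smul_def] at h3
        exact (mul_eq_zero.1 h3).resolve_left fun h => hπ (hinj (by rw [h, map_zero]))
      rw [pow_succ', hd i]
      exact mul_dvd_mul_left _ (ih d hd0 i)
  exact Fintype.linearIndependent_iff.2 fun c hc i => hπ0 _ fun m => key2 m c hc i

/-- The map from a ring of `v`-integral elements to the residue field. -/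
noncomputable def FinitePlace.toResidueField (v : FinitePlace K)
    (hle : ∀ c : R₀, algebraMap R₀ K c ∈ v.1) : R₀ →+* IsLocalRing.ResidueField v.1 :=
  (IsLocalRing.residue v.1).comp ((algebraMap R₀ K).codRestrict v.1.toSubring hle)

theorem FinitePlace.residue_eq_zero_iff (v : FinitePlace K) (x : v.1) :
    IsLocalRing.residue v.1 x = 0 ↔ v.prime.valuation K (x : K) < 1 := by
  rw [IsLocalRing.residue_eq_zero_iff]
  exact (v.prime.valuation_lt_one_iff_mem (K := K) x).symm

/-- Residues independent over the image of `R₀` lift to elements of `K` that are independent over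
`R₀`, hence over `L`: a relation reduces modulo `v` to the trivial one, so `π` divides its
coefficients and descent applies. Thus the residue field has degree at most `[K : L]` over a finite
field. -/
theorem FinitePlace.finite_residueField_of_center [FiniteDimensional L K] (v : FinitePlace K)
    (hle : ∀ c : R₀, algebraMap R₀ K c ∈ v.1) {π : R₀} (hπ : π ≠ 0)
    (hπ0 : ∀ c : R₀, (∀ n : ℕ, π ^ n ∣ c) → c = 0)
    (hlt : ∀ c : R₀, v.prime.valuation K (algebraMap R₀ K c) < 1 → π ∣ c)
    (hfin : Finite (v.toResidueField hle).range) : Finite (IsLocalRing.ResidueField v.1) := by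
  set k := (v.toResidueField hle).range
  have hinj : Function.Injective (algebraMap R₀ K) := by
    rw [IsScalarTower.algebraMap_eq R₀ L K]
    exact (algebraMap L K).injective.comp (IsFractionRing.injective R₀ L)
  let _ : Field k := (Finite.isField_of_domain k).toField
  by_contra hinf
  have hnf : ¬ Module.Finite k (IsLocalRing.ResidueField v.1) := fun _ =>
    hinf (Module.finite_of_finite k)
  have hrank : ((Module.finrank L K + 1 : ℕ) : Cardinal) ≤
      Module.rank k (IsLocalRing.ResidueField v.1) := by
    refine (Cardinal.natCast_lt_aleph0).le.trans (not_lt.1 fun h => hnf ?_)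
    exact Module.rank_lt_aleph0_iff.1 h
  obtain ⟨b, hb⟩ := Module.le_rank_iff.1 hrank
  choose e he using fun i => IsLocalRing.residue_surjective (b i)
  have key (c : Fin (Module.finrank L K + 1) → R₀) (hc : ∑ i, c i • (e i : K) = 0) (i) :
      π ∣ c i := by
    have h1 : ∑ i, (⟨v.toResidueField hle (c i), c i, rfl⟩ : k) • b i = 0 := by
      have h2 : ∑ i, (algebraMap R₀ K).codRestrict v.1.toSubring hle (c i) * e i = 0 := by
        refine Subtype.ext ?_
        rw [AddSubmonoidClass.coe_finsetSum, ZeroMemClass.coe_zero, ← hc]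
        exact Finset.sum_congr rfl fun i _ => (Algebra.smul_def _ _).symm
      have h3 := congrArg (IsLocalRing.residue v.1) h2
      rw [map_sum, map_zero] at h3
      rw [← h3]
      refine Finset.sum_congr rfl fun i _ => ?_
      rw [map_mul, he]
      rfl
    have h4 := congrArg Subtype.val (Fintype.linearIndependent_iff.1 hb _ h1 i)
    exact hlt _ ((v.residue_eq_zero_iff _).1 h4)
  have hli := linearIndependent_of_forall_dvd hinj hπ hπ0 key
  have := ((LinearIndependent.iff_fractionRing R₀ L).1 hli).fintype_card_le_finrank
  simp at this

end Center

namespace FinitePlace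

theorem exists_uniformizer (v : FinitePlace K) : ∃ y : K, y ≠ 0 ∧ y ∈ v.1 ∧
    v.prime.valuation K y = WithZero.exp (-1 : ℤ) := by
  obtain ⟨y, hy⟩ := v.prime.valuation_exists_uniformizer K
  refine ⟨y, fun h => ?_, (valuation_le_one_iff v y).1 ?_, hy⟩
  · rw [h, map_zero] at hy
    exact WithZero.exp_ne_zero hy.symm
  · rw [hy, ← WithZero.exp_zero, WithZero.exp_le_exp]; norm_num

theorem exp_neg_one_lt_one : WithZero.exp (-1 : ℤ) < 1 := by
  rw [← WithZero.exp_zero, WithZero.exp_lt_exp]; norm_num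

/-- Valuation rings are integrally closed. -/
theorem mem_of_isIntegral {R₀ : Type*} [CommRing R₀] [Algebra R₀ K] (v : FinitePlace K)
    (hle : ∀ c : R₀, algebraMap R₀ K c ∈ v.1) {k : K} (hk : IsIntegral R₀ k) : k ∈ v.1 := by
  have : IsIntegral v.1 k := by
    obtain ⟨q, hqm, hq⟩ := hk
    let φ : R₀ →+* v.1 := (algebraMap R₀ K).codRestrict v.1.toSubring hle
    exact ⟨q.map φ, hqm.map _, by rw [Polynomial.eval₂_map]; exact hq⟩
  obtain ⟨y, hy⟩ := IsIntegrallyClosed.isIntegral_iff.1 this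
  rw [← hy]
  exact y.2

theorem finite_residueField_of_numberField [NumberField K] (v : FinitePlace K) :
    Finite (IsLocalRing.ResidueField v.1) := by
  have hle (c : ℤ) : algebraMap ℤ K c ∈ v.1 := intCast_mem v.1 c
  -- If all nonzero integers were units at `v`, clearing the denominator of the inverse of a
  -- uniformizer would make that inverse `v`-integral.
  obtain ⟨p, hp, hpv⟩ : ∃ p : ℤ, p ≠ 0 ∧ v.prime.valuation K (p : K) < 1 := by
    by_contra! h
    obtain ⟨y, hy0, -, hy⟩ := v.exists_uniformizer
    obtain ⟨d, hd0, hd⟩ := ((IsFractionRing.isAlgebraic_iff ℤ ℚ K).2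
      (Algebra.IsAlgebraic.isAlgebraic y⁻¹)).exists_integral_multiple
    have h1 := (valuation_le_one_iff v _).2 (v.mem_of_isIntegral hle hd)
    rw [zsmul_eq_mul, map_mul, map_inv₀, hy] at h1
    have h2 := (mul_le_mul_left (h d hd0) ((WithZero.exp (-1 : ℤ))⁻¹)).trans h1
    rw [one_mul] at h2
    exact h2.not_gt ((one_lt_inv₀ (zero_lt_iff.2 WithZero.exp_ne_zero)).2 exp_neg_one_lt_one)
  let I : Ideal ℤ := (IsLocalRing.maximalIdeal v.1).comap
    ((algebraMap ℤ K).codRestrict v.1.toSubring hle)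
  have hI (c : ℤ) : c ∈ I ↔ v.prime.valuation K (c : K) < 1 :=
    (v.prime.valuation_lt_one_iff_mem (K := K) _).symm
  have hmem (c : ℤ) : c ∈ I ↔ Submodule.IsPrincipal.generator I ∣ c :=
    Submodule.IsPrincipal.mem_iff_generator_dvd I
  set π := Submodule.IsPrincipal.generator I with hπdef
  have hπ0 : π ≠ 0 := by
    intro h
    have := (hmem p).1 ((hI p).2 hpv)
    rw [h, zero_dvd_iff] at this
    exact hp this
  have hπ1 : π.natAbs ≠ 1 := by
    intro h
    have : (1 : ℤ) ∈ I := (hmem 1).2 (Int.isUnit_iff_natAbs_eq.2 h).dvd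
    rw [hI] at this
    simp at this
  refine v.finite_residueField_of_center (R₀ := ℤ) (L := ℚ) hle hπ0 ?_
    (fun c hc => (hmem c).1 ((hI c).2 hc)) ?_
  · intro c hc
    by_contra h0
    exact (Int.finiteMultiplicity_iff.2 ⟨hπ1, h0⟩ : FiniteMultiplicity π c
      ).not_pow_dvd_of_multiplicity_lt (Nat.lt_succ_self _) (hc _)
  · refine ((Set.finite_Ico 0 |π|).image (v.toResidueField hle)).subset ?_
    rintro _ ⟨c, rfl⟩
    refine ⟨c % π, ⟨Int.emod_nonneg _ hπ0, Int.emod_lt_abs _ hπ0⟩, ?_⟩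
    rw [← sub_eq_zero, ← map_sub]
    exact (v.residue_eq_zero_iff _).2 ((hI _).1 ((hmem _).2 (by
      rw [Int.emod_def, sub_sub_cancel_left]
      exact (dvd_mul_right _ _).neg_right)))

/-- The base ring is `F[y]` with `y` a uniformizer at `v`. Nonzero constants are roots of unity,
hence units at `v`; so `y` is transcendental, `K` is finite over `F(y)`, and modulo `y` only the
finitely many constants survive. -/
theorem finite_residueField_of_functionField (F : Type) [Field F] [Finite F] [Algebra (RatFunc F) K]
    [FunctionField F K] (v : FinitePlace K) : Finite (IsLocalRing.ResidueField v.1) := by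
  let _ : Algebra F K := Algebra.compHom K (algebraMap F (RatFunc F))
  have : IsScalarTower F (RatFunc F) K := IsScalarTower.of_algebraMap_eq fun _ => rfl
  have hF (c : F) (hc : c ≠ 0) : v.prime.valuation K (algebraMap F K c) = 1 := by
    have := Fintype.ofFinite F
    have h : (v.prime.valuation K (algebraMap F K c)) ^ (Fintype.card F - 1) = 1 := by
      rw [← map_pow, ← map_pow, FiniteField.pow_card_sub_one_eq_one c hc, map_one, map_one]
    exact (pow_eq_one_iff_of_nonneg zero_le (Nat.sub_ne_zero_of_lt Fintype.one_lt_card)).1 h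
  have hF' (c : F) : v.prime.valuation K (algebraMap F K c) ≤ 1 := by
    by_cases hc : c = 0
    · simp [hc]
    · exact (hF c hc).le
  obtain ⟨y, hy0, -, hyv⟩ := v.exists_uniformizer
  have hlt : v.prime.valuation K y < 1 := by rw [hyv]; exact exp_neg_one_lt_one
  have hk : Transcendental F y := by
    intro h
    have h1 : IsIntegral F y⁻¹ := h.inv.isIntegral
    have h2 := (valuation_le_one_iff v _).2
      (v.mem_of_isIntegral (fun c => (valuation_le_one_iff v _).1 (hF' c)) h1)
    rw [map_inv₀, inv_le_one₀ (by rw [hyv]; exact zero_lt_iff.2 WithZero.exp_ne_zero)] at h2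
    exact h2.not_gt hlt
  have hfin := FunctionField.finiteDimensional_of_adjoin_transcendental hk
  open scoped IntermediateField.algebraAdjoinAdjoin in
  let R₀ := Algebra.adjoin F {y}
  let π : R₀ := ⟨y, Algebra.self_mem_adjoin_singleton F y⟩
  have hsurj (c : R₀) : ∃ p : Polynomial F, Polynomial.aeval y p = (c : K) :=
    (AlgHom.mem_range _).1 (Algebra.adjoin_singleton_eq_range_aeval F y ▸ c.2)
  have hinj := transcendental_iff_injective.1 hk
  have hpoly (p : Polynomial F) : v.prime.valuation K (Polynomial.aeval y p) ≤ 1 := by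
    rw [Polynomial.aeval_eq_sum_range]
    refine Valuation.map_sum_le _ fun i _ => ?_
    rw [Algebra.smul_def, map_mul, map_pow]
    exact mul_le_one' (hF' _) (pow_le_one' hlt.le _)
  have hsplit (p : Polynomial F) : Polynomial.aeval y p =
      y * Polynomial.aeval y p.divX + algebraMap F K (p.coeff 0) := by
    have := congrArg (Polynomial.aeval y) (Polynomial.X_mul_divX_add p)
    rw [← this, map_add, map_mul, Polynomial.aeval_X, Polynomial.aeval_C]
  have hsmall (p : Polynomial F) : v.prime.valuation K (y * Polynomial.aeval y p) < 1 := by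
    rw [map_mul]
    exact mul_lt_one_of_lt_of_le hlt (hpoly _)
  have hle (c : R₀) : algebraMap R₀ K c ∈ v.1 := by
    obtain ⟨p, hp⟩ := hsurj c
    rw [← valuation_le_one_iff]
    change v.prime.valuation K (c : K) ≤ 1
    rw [← hp]; exact hpoly p
  refine v.finite_residueField_of_center (R₀ := R₀) (L := IntermediateField.adjoin F {y}) hle
    (π := π) ?_ ?_ ?_ ?_
  · exact fun h => hy0 (congrArg Subtype.val h)
  · intro c hc
    obtain ⟨p, hp⟩ := hsurj c
    have : p = 0 := by
      by_contra hp0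
      obtain ⟨d, hd⟩ := hc (p.natDegree + 1)
      obtain ⟨q, hq⟩ := hsurj d
      have h1 : p = Polynomial.X ^ (p.natDegree + 1) * q := hinj (by
        rw [hp, hd]; simp [hq, π])
      have := Polynomial.natDegree_le_of_dvd (Dvd.intro _ h1.symm) hp0
      simp at this
    exact Subtype.ext (by rw [← hp, this]; simp)
  · intro c hc
    obtain ⟨p, hp⟩ := hsurj c
    change v.prime.valuation K (c : K) < 1 at hc
    have h2 : v.prime.valuation K (algebraMap F K (p.coeff 0)) < 1 := by
      rw [eq_sub_of_add_eq' (hsplit p).symm, hp]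
      exact Valuation.map_sub_lt _ hc (hsmall _)
    have h3 : p.coeff 0 = 0 := by
      by_contra h
      exact h2.ne (hF _ h)
    refine ⟨⟨Polynomial.aeval y p.divX, Polynomial.aeval_mem_adjoin_singleton F y⟩,
      Subtype.ext ?_⟩
    rw [← hp, hsplit, h3]; simp [π]
  · refine (Set.finite_range fun c : F => IsLocalRing.residue v.1
      ⟨algebraMap F K c, (valuation_le_one_iff v _).1 (hF' c)⟩).subset ?_
    rintro _ ⟨c, rfl⟩
    obtain ⟨p, hp⟩ := hsurj c
    refine ⟨p.coeff 0, ?_⟩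
    change IsLocalRing.residue v.1 _ = IsLocalRing.residue v.1 _
    rw [← sub_eq_zero, ← map_sub, v.residue_eq_zero_iff]
    change v.prime.valuation K (algebraMap F K (p.coeff 0) - (c : K)) < 1
    rw [← hp, hsplit, sub_add_cancel_right, Valuation.map_neg]
    exact hsmall _

instance finite_residueField [IsGlobalField K] (v : FinitePlace K) :
    Finite (IsLocalRing.ResidueField v.1) := by
  rcases IsGlobalField.numberField_or_functionField (K := K) with h | ⟨F, _, _, _, h⟩
  · exact v.finite_residueField_of_numberField
  · exact v.finite_residueField_of_functionField F

section Completion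

variable (v : FinitePlace K)

theorem valued_algebraMap (k : K) :
    Valued.v (algebraMap K v.Completion k) = v.prime.valuation K k :=
  v.prime.valuedAdicCompletion_eq_valuation' k

theorem mem_integers {x : v.Completion} : x ∈ v.integers ↔ Valued.v x ≤ 1 := Iff.rfl

theorem isOpen_valued_lt_one : IsOpen {x : v.Completion | Valued.v x < 1} := by
  have := Valued.isOpen_ball v.Completion 1
  simpa only [Valuation.restrict_lt_one_iff] using this

theorem exists_valued_sub_lt (x : v.Completion) {b : v.Completion} (hb : b ≠ 0) :
    ∃ k : K, Valued.v (x - algebraMap K v.Completion k) < Valued.v b := by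
  have hO : IsOpen {z : v.Completion | Valued.v (b⁻¹ * (x - z)) < 1} :=
    v.isOpen_valued_lt_one.preimage
      (f := fun z => b⁻¹ * (x - z)) (continuous_const.mul (continuous_const.sub continuous_id))
  obtain ⟨k, hk⟩ := (HeightOneSpectrum.denseRange_algebraMap K v.prime).exists_mem_open hO
    ⟨x, by simp⟩
  refine ⟨k, ?_⟩
  change Valued.v (b⁻¹ * (x - algebraMap K v.Completion k)) < 1 at hk
  rw [map_mul, map_inv₀, inv_mul_lt_one₀ (by simpa [zero_lt_iff] using hb)] at hk
  exact hk

/-- Every element of `O_v` is congruent to exactly one representative of the residue field. -/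
theorem existsUnique_residue {r : IsLocalRing.ResidueField v.1 → v.1}
    (hr : ∀ c, IsLocalRing.residue v.1 (r c) = c) {x : v.Completion} (hx : x ∈ v.integers) :
    ∃! c, Valued.v (x - algebraMap K v.Completion (r c)) < 1 := by
  obtain ⟨k, hk⟩ := v.exists_valued_sub_lt x (one_ne_zero)
  rw [map_one] at hk
  have hk1 : k ∈ v.1 := by
    rw [← valuation_le_one_iff, ← valued_algebraMap]
    have : algebraMap K v.Completion k = x - (x - algebraMap K v.Completion k) := by ring
    rw [this]
    exact Valuation.map_sub_le _ hx hk.le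
  have hdist (c c') (h : Valued.v (algebraMap K v.Completion (c : v.1) -
      algebraMap K v.Completion (c' : v.1)) < 1) :
      IsLocalRing.residue v.1 c = IsLocalRing.residue v.1 c' := by
    rw [← sub_eq_zero, ← map_sub, residue_eq_zero_iff, ← valued_algebraMap]
    simpa using h
  refine ⟨IsLocalRing.residue v.1 ⟨k, hk1⟩, ?_, fun c hc => ?_⟩
  · have h1 : Valued.v (algebraMap K v.Completion k -
        algebraMap K v.Completion (r (IsLocalRing.residue v.1 ⟨k, hk1⟩))) < 1 := by
      rw [← map_sub, valued_algebraMap]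
      exact (v.residue_eq_zero_iff (⟨k, hk1⟩ - r _)).1 (by rw [map_sub, hr, sub_self])
    have := Valuation.map_add_lt _ hk h1
    rwa [sub_add_sub_cancel] at this
  · rw [← hr c]
    refine hdist (r c) ⟨k, hk1⟩ ?_
    have := Valuation.map_sub_lt _ hk hc
    rwa [sub_sub_sub_cancel_left] at this

/-- A complete discrete valuation ring with finite residue field is compact. Representatives from
`K` show that completion produces no new residue classes. -/
instance [IsGlobalField K] : CompactSpace v.integers := by
  let _ := Valuation.IsRankOneDiscrete.rankOne (Valued.v : Valuation v.Completion _) one_lt_two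
  refine Valued.integer.compactSpace_iff_completeSpace_and_isDiscreteValuationRing_and_finite_residueField.2
    ⟨?_, inferInstanceAs (IsDiscreteValuationRing v.integers), ?_⟩
  · exact (Valued.isClosed_integer v.Completion).completeSpace_coe
  · choose r hr using IsLocalRing.residue_surjective (R := v.1)
    let g : IsLocalRing.ResidueField v.1 → Valued.ResidueField v.Completion := fun c =>
      IsLocalRing.residue _ ⟨algebraMap K v.Completion (r c), by
        have : Valued.v (algebraMap K v.Completion (r c)) ≤ 1 := by
          rw [valued_algebraMap, valuation_le_one_iff]; exact (r c).2
        exact this⟩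
    refine Finite.of_surjective g fun c => ?_
    obtain ⟨x, rfl⟩ := IsLocalRing.residue_surjective c
    obtain ⟨c, hc, -⟩ := v.existsUnique_residue hr (x := x) x.2
    refine ⟨c, Eq.symm ?_⟩
    rw [← sub_eq_zero, ← map_sub, IsLocalRing.residue_eq_zero_iff]
    exact (Valuation.mem_maximalIdeal_iff _ _).2 hc

end Completion

end FinitePlace

end GlobalField

/-! ### Topology and units of the finite adele ring -/

namespace GlobalField

variable {K : Type*} [Field K]

namespace FinitePlace

theorem isOpen_integers (v : FinitePlace K) : IsOpen (v.integers : Set v.Completion) :=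
  Valued.isOpen_valuationSubring _

end FinitePlace

namespace FiniteAdeleRing

@[ext]
theorem ext {a b : FiniteAdeleRing K} (h : ∀ v, a v = b v) : a = b := DFunLike.ext _ _ h

@[simp] theorem one_apply (v : FinitePlace K) : (1 : FiniteAdeleRing K) v = 1 := rfl
@[simp] theorem add_apply (a b : FiniteAdeleRing K) (v : FinitePlace K) : (a + b) v = a v + b v := rfl
@[simp] theorem mul_apply (a b : FiniteAdeleRing K) (v : FinitePlace K) : (a * b) v = a v * b v := rfl
@[simp] theorem sub_apply (a b : FiniteAdeleRing K) (v : FinitePlace K) : (a - b) v = a v - b v := rfl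

theorem algebraMap_apply [IsGlobalField K] (k : K) (v : FinitePlace K) :
    algebraMap K (FiniteAdeleRing K) k v = algebraMap K v.Completion k := rfl

theorem finite_not_mem_integers (a : FiniteAdeleRing K) : {v | a v ∉ v.integers}.Finite :=
  eventually_cofinite.1 a.2

instance : T2Space (FiniteAdeleRing K) :=
  inferInstanceAs (T2Space (Πʳ v : FinitePlace K, [v.Completion, v.integers]))

variable (K) in
/-- The integral finite adeles. -/
def integers : AddSubgroup (FiniteAdeleRing K) where
  carrier := {a | ∀ v, a v ∈ v.integers}
  zero_mem' v := v.integers.zero_mem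
  add_mem' ha hb v := v.integers.add_mem _ _ (ha v) (hb v)
  neg_mem' ha v := v.integers.neg_mem _ (ha v)

theorem mem_integers {a : FiniteAdeleRing K} : a ∈ integers K ↔ ∀ v, a v ∈ v.integers := Iff.rfl

theorem isOpen_integers : IsOpen (integers K : Set (FiniteAdeleRing K)) :=
  RestrictedProduct.isOpen_forall_mem fun v : FinitePlace K => v.isOpen_integers

/-- Tychonoff: the restricted product topology induces the product topology on the product of the
`O_v`. -/
theorem isCompact_integers [IsGlobalField K] : IsCompact (integers K : Set (FiniteAdeleRing K)) := by
  have (v : FinitePlace K) : CompactSpace (v.integers : Set v.Completion) :=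
    inferInstanceAs (CompactSpace v.integers)
  have h := isCompact_range (RestrictedProduct.isEmbedding_structureMap
    (R := fun v : FinitePlace K => v.Completion) (A := fun v => (v.integers : Set v.Completion))
    (𝓕 := cofinite)).continuous
  rwa [RestrictedProduct.range_structureMap] at h

instance [IsGlobalField K] : LocallyCompactSpace (FiniteAdeleRing K) :=
  isCompact_integers.locallyCompactSpace_of_mem_nhds_of_addGroup (x := 0)
    (isOpen_integers.mem_nhds (integers K).zero_mem)

section Units

variable (K) in
/-- The finite idele with given nonzero components, almost all of them units. -/
theorem exists_unit (x : ∀ v : FinitePlace K, v.Completion) (hx0 : ∀ v, x v ≠ 0)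
    (hx : {v | Valued.v (x v) ≠ 1}.Finite) : ∃ u : (FiniteAdeleRing K)ˣ, ∀ v, u.1 v = x v := by
  have h1 : ∀ᶠ v in cofinite, x v ∈ v.integers :=
    hx.subset fun v hv h => hv (v.mem_integers.2 h.le)
  have h2 : ∀ᶠ v in cofinite, (x v)⁻¹ ∈ v.integers :=
    hx.subset fun v hv h => hv (v.mem_integers.2 (by rw [map_inv₀, h, inv_one]))
  let a : FiniteAdeleRing K := ⟨x, h1⟩
  let b : FiniteAdeleRing K := ⟨fun v => (x v)⁻¹, h2⟩
  exact ⟨⟨a, b, ext fun v => mul_inv_cancel₀ (hx0 v), ext fun v => inv_mul_cancel₀ (hx0 v)⟩,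
    fun v => rfl⟩

theorem unit_apply_ne_zero (u : (FiniteAdeleRing K)ˣ) (v : FinitePlace K) : u.1 v ≠ 0 := by
  intro h
  have := congrArg (fun a : FiniteAdeleRing K => a v) u.mul_inv
  simp only [mul_apply, h, zero_mul, one_apply] at this
  exact zero_ne_one this

theorem unit_inv_apply (u : (FiniteAdeleRing K)ˣ) (v : FinitePlace K) : u⁻¹.1 v = (u.1 v)⁻¹ := by
  have := congrArg (fun a : FiniteAdeleRing K => a v) u.mul_inv
  exact eq_inv_of_mul_eq_one_right this

theorem finite_valued_unit_ne_one (u : (FiniteAdeleRing K)ˣ) :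
    {v | Valued.v (u.1 v) ≠ 1}.Finite := by
  refine ((finite_not_mem_integers u.1).union (finite_not_mem_integers u⁻¹.1)).subset fun v hv => ?_
  by_contra h
  simp only [mem_union, mem_ofPred_eq, not_or, not_not] at h
  refine hv (le_antisymm h.1 ?_)
  have h2 : Valued.v (u⁻¹.1 v) ≤ 1 := h.2
  rw [unit_inv_apply, map_inv₀, inv_le_one₀ (by simpa [zero_lt_iff] using unit_apply_ne_zero u v)] at h2
  exact h2

/-- A family of bounded sets, almost all of them integral, can be scaled into the integers. -/
theorem exists_unit_forall_mul_mem {S : Set (FinitePlace K)} (hS : S.Finite)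
    {b : ∀ v : FinitePlace K, v.Completion} (hb : ∀ v ∈ S, b v ≠ 0) :
    ∃ u : (FiniteAdeleRing K)ˣ, ∀ a : FiniteAdeleRing K,
      u.1 * a ∈ integers K ↔
      (∀ v ∉ S, a v ∈ v.integers) ∧ ∀ v ∈ S, Valued.v (a v) ≤ Valued.v (b v) := by
  classical
  obtain ⟨u, hu⟩ := exists_unit K (fun v => if v ∈ S then (b v)⁻¹ else 1)
    (fun v => by split_ifs with h; exacts [inv_ne_zero (hb v h), one_ne_zero])
    (hS.subset fun v hv => by
      by_contra h
      simp [h] at hv)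
  refine ⟨u, fun a => ?_⟩
  have h1 (v) (hv : v ∉ S) : (u.1 * a) v ∈ v.integers ↔ a v ∈ v.integers := by
    rw [mul_apply, hu, if_neg hv, one_mul]
  have h2 (v) (hv : v ∈ S) : (u.1 * a) v ∈ v.integers ↔ Valued.v (a v) ≤ Valued.v (b v) := by
    rw [mul_apply, hu, if_pos hv, v.mem_integers, map_mul, map_inv₀,
      inv_mul_le_one₀ (by simpa [zero_lt_iff] using hb v hv)]
  rw [mem_integers]
  refine ⟨fun h => ⟨fun v hv => (h1 v hv).1 (h v), fun v hv => (h2 v hv).1 (h v)⟩, fun h v => ?_⟩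
  by_cases hv : v ∈ S
  · exact (h2 v hv).2 (h.2 v hv)
  · exact (h1 v hv).2 (h.1 v hv)

end Units

end FiniteAdeleRing

end GlobalField

/-! ### Approximation and a criterion for cocompactness -/

namespace GlobalField

variable {K : Type*} [Field K]

/-- Weak approximation at finitely many finite places. -/
theorem FinitePlace.exists_forall_valuation_sub_le {S : Set (FinitePlace K)} (hS : S.Finite)
    (a : FinitePlace K → K) : ∃ k, ∀ v ∈ S, v.prime.valuation K (k - a v) ≤ 1 := by
  have h2 : (1 : NNReal) < 2 := one_lt_two
  have hlt (w : FinitePlace K) (a : K) :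
      w.prime.adicAbv h2 a < 1 ↔ w.prime.valuation K a < 1 := by
    rw [← WithZeroMulInt.toNNReal_lt_one_iff h2, ← NNReal.coe_lt_coe]; rfl
  have hle (w : FinitePlace K) (a : K) :
      w.prime.adicAbv h2 a ≤ 1 ↔ w.prime.valuation K a ≤ 1 := by
    rw [← WithZeroMulInt.toNNReal_le_one_iff h2, ← NNReal.coe_le_coe]; rfl
  have := hS.fintype
  have hd := AbsoluteValue.denseRange_algebraMap_pi
    (v := fun w : S => w.1.prime.adicAbv (K := K) h2) (fun w => by
      obtain ⟨π, hπ0, -, hπ⟩ := w.1.exists_uniformizer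
      exact ⟨π, hπ0, ((hlt _ _).2 (by rw [hπ]; exact exp_neg_one_lt_one)).ne⟩)
    (fun j k hjk h => hjk (Subtype.ext (Subtype.ext (SetLike.ext fun x => by
      rw [← valuation_le_one_iff, ← valuation_le_one_iff, ← hle, ← hle]
      exact h.le_one_iff))))
  obtain ⟨k, hk⟩ := Metric.denseRange_iff.1 hd
    (fun w : S => (WithAbs.equiv (w.1.prime.adicAbv (K := K) h2)).symm (a w.1)) 1 one_pos
  refine ⟨k, fun v hv => ?_⟩
  have := (dist_le_pi_dist _ _ (⟨v, hv⟩ : S)).trans hk.le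
  rw [dist_comm, dist_eq_norm] at this
  exact (hle _ _).1 this

section Integral

variable (R₀ : Type*) [CommRing R₀] [IsDomain R₀] [IsPrincipalIdealRing R₀] [Algebra R₀ K]
    [Algebra.IsAlgebraic R₀ K] [FaithfulSMul R₀ K]

/-- The image of `R₀` is integral at `v`. -/
def FinitePlace.IsIntegralOver (v : FinitePlace K) : Prop := ∀ c : R₀, algebraMap R₀ K c ∈ v.1

variable {R₀}

/-- The contraction of the maximal ideal to the principal ideal domain `R₀` is prime. It is nonzero:
otherwise nonzero denominators from `R₀` would be units at `v`, and the algebraic element inverse to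
a uniformizer would be integral there. -/
theorem FinitePlace.exists_prime_center {v : FinitePlace K} (hv : v.IsIntegralOver R₀) :
    ∃ π : R₀, Prime π ∧ ∀ c, v.prime.valuation K (algebraMap R₀ K c) < 1 ↔ π ∣ c := by
  let I : Ideal R₀ := (IsLocalRing.maximalIdeal v.1).comap
    ((algebraMap R₀ K).codRestrict v.1.toSubring hv)
  have hIp : I.IsPrime := Ideal.comap_isPrime _ _
  have hI (c : R₀) : c ∈ I ↔ v.prime.valuation K (algebraMap R₀ K c) < 1 :=
    (v.prime.valuation_lt_one_iff_mem (K := K) _).symm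
  obtain ⟨p, hp, hpv⟩ : ∃ p : R₀, p ≠ 0 ∧ v.prime.valuation K (algebraMap R₀ K p) < 1 := by
    by_contra! h
    obtain ⟨y, hy0, -, hy⟩ := v.exists_uniformizer
    obtain ⟨d, hd0, hd⟩ :=
      (Algebra.IsAlgebraic.isAlgebraic (R := R₀) y⁻¹).exists_integral_multiple
    have h1 := (valuation_le_one_iff v _).2 (v.mem_of_isIntegral hv hd)
    rw [Algebra.smul_def, map_mul, map_inv₀, hy] at h1
    have h2 := (mul_le_mul_left (h d hd0) ((WithZero.exp (-1 : ℤ))⁻¹)).trans h1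
    rw [one_mul] at h2
    exact h2.not_gt ((one_lt_inv₀ (zero_lt_iff.2 WithZero.exp_ne_zero)).2 exp_neg_one_lt_one)
  have hI0 : I ≠ ⊥ := fun h => hp (by simpa [h] using (hI p).2 hpv)
  refine ⟨Submodule.IsPrincipal.generator I, Submodule.IsPrincipal.prime_generator_of_isPrime I hI0,
    fun c => ?_⟩
  rw [← hI, Submodule.IsPrincipal.mem_iff_generator_dvd]

theorem algebraMap_ne_zero {c : R₀} (hc : c ≠ 0) : algebraMap R₀ K c ≠ 0 := fun h =>
  hc (FaithfulSMul.algebraMap_injective R₀ K (by rw [h, map_zero]))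

variable [IsGlobalField K]

/-- Polar parts: an element of `K` can be changed by a `v`-integral element so as to become
integral at all other places over `R₀`. -/
theorem FinitePlace.exists_polar_part {v : FinitePlace K} (hv : v.IsIntegralOver R₀) (k₀ : K) :
    ∃ k : K, k₀ - k ∈ v.1 ∧ ∀ w : FinitePlace K, w.IsIntegralOver R₀ → w ≠ v → k ∈ w.1 := by
  classical
  obtain ⟨π, hπ, hπv⟩ := exists_prime_center hv
  have hπ0 := algebraMap_ne_zero (K := K) hπ.ne_zero
  -- The approximation is imposed only at the finitely many places where `π` is not a unit.
  -- Elsewhere over `R₀` the denominator of `k₁` is controlled by `d = π ^ m * r`.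
  obtain ⟨k₁, hk₁⟩ := exists_forall_valuation_sub_le (finite_not_mem (algebraMap R₀ K π)⁻¹)
    (fun w => if w = v then k₀ else 0)
  have hT (w : FinitePlace K) : (algebraMap R₀ K π)⁻¹ ∉ w.1 ↔
      w.prime.valuation K (algebraMap R₀ K π) < 1 := by
    rw [← valuation_le_one_iff, map_inv₀, inv_le_one₀ (by simpa [zero_lt_iff] using hπ0), not_le]
  obtain ⟨d, hd0, hd⟩ :=
    (Algebra.IsAlgebraic.isAlgebraic (R := R₀) k₁).exists_integral_multiple
  obtain ⟨m, r, hr, rfl⟩ : ∃ (m : ℕ) (r : R₀), ¬ π ∣ r ∧ d = π ^ m * r := by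
    obtain ⟨r, hdr, hr⟩ := (FiniteMultiplicity.of_not_isUnit hπ.not_isUnit hd0
      ).exists_eq_pow_mul_and_not_dvd
    exact ⟨_, r, hr, hdr⟩
  have hcop : IsCoprime r (π ^ m) :=
    (hπ.irreducible.coprime_iff_not_dvd.2 hr).symm.pow_right
  obtain ⟨a, b, hab⟩ := hcop
  have hab' := congrArg (algebraMap R₀ K) hab
  simp only [map_add, map_mul, map_pow, map_one] at hab'
  have hint (w : FinitePlace K) (hw : w.IsIntegralOver R₀) :=
    (valuation_le_one_iff w _).2 (w.mem_of_isIntegral hw hd)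
  simp only [Algebra.smul_def, map_mul, map_pow] at hint
  have hle (w : FinitePlace K) (hw : w.IsIntegralOver R₀) (c : R₀) :=
    (valuation_le_one_iff w _).2 (hw c)
  -- With `a r + b π ^ m = 1`, the multiplier `a r` clears the poles of `k₁` away from `π`, while `1
  -- - a r = b π ^ m` clears its pole at `v`, where `r` is a unit.
  refine ⟨algebraMap R₀ K a * algebraMap R₀ K r * k₁, ?_, fun w hw hwv => ?_⟩
  · have h1 : k₀ - algebraMap R₀ K a * algebraMap R₀ K r * k₁ =
        -(k₁ - k₀) + algebraMap R₀ K b * algebraMap R₀ K π ^ m * k₁ := by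
      linear_combination -k₁ * hab'
    rw [h1]
    have h2 := hk₁ v ((hT v).2 ((hπv π).2 dvd_rfl))
    rw [if_pos rfl] at h2
    refine v.1.add_mem _ _ (v.1.neg_mem _ ((valuation_le_one_iff v _).1 h2)) ?_
    rw [← valuation_le_one_iff]
    have h3 : v.prime.valuation K (algebraMap R₀ K r) = 1 :=
      (hle v hv r).antisymm (not_lt.1 fun h => hr ((hπv r).1 h))
    have h4 := hint v hv
    rw [h3, mul_one] at h4
    simp only [map_mul, map_pow, mul_assoc]
    exact mul_le_one' (hle v hv b) h4
  · by_cases hwT : (algebraMap R₀ K π)⁻¹ ∉ w.1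
    · have h2 := hk₁ w hwT
      rw [if_neg hwv, sub_zero] at h2
      exact w.1.mul_mem _ _ (w.1.mul_mem _ _ (hw a) (hw r)) ((valuation_le_one_iff w _).1 h2)
    · rw [hT, not_lt] at hwT
      have h3 : w.prime.valuation K (algebraMap R₀ K π) = 1 := (hle w hw π).antisymm hwT
      have h4 := hint w hw
      rw [h3, one_pow, one_mul] at h4
      rw [← valuation_le_one_iff]
      simp only [map_mul, mul_assoc]
      exact mul_le_one' (hle w hw a) h4

/-- Partial fractions: induction on the set of places over `R₀` where `x` is not integral,
subtracting a polar part at one place without creating poles at the other places over `R₀`. -/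
theorem FiniteAdeleRing.exists_forall_sub_mem (x : FiniteAdeleRing K) :
    ∃ k : K, ∀ v : FinitePlace K, v.IsIntegralOver R₀ →
      x v - algebraMap K v.Completion k ∈ v.integers := by
  suffices H : ∀ B : Set (FinitePlace K), B.Finite → ∀ x : FiniteAdeleRing K,
      (∀ v : FinitePlace K, v.IsIntegralOver R₀ → v ∉ B → x v ∈ v.integers) →
      ∃ k : K, ∀ v : FinitePlace K, v.IsIntegralOver R₀ →
        x v - algebraMap K v.Completion k ∈ v.integers from
    H _ (finite_not_mem_integers x) x fun v _ hv => not_not.1 hv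
  intro B hB
  induction B, hB using Set.Finite.induction_on with
  | empty => exact fun x hx => ⟨0, fun v hv => by simpa using hx v hv (notMem_empty v)⟩
  | @insert v B _ _ ih =>
    intro x hx
    by_cases hv : v.IsIntegralOver R₀
    · obtain ⟨k₀, hk₀⟩ := v.exists_valued_sub_lt (x v) one_ne_zero
      obtain ⟨k, hk, hkw⟩ := FinitePlace.exists_polar_part hv k₀
      have hcoe (w : FinitePlace K) (c : K) (hc : c ∈ w.1) :
          algebraMap K w.Completion c ∈ w.integers := by
        rw [w.mem_integers, w.valued_algebraMap, w.valuation_le_one_iff]; exact hc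
      obtain ⟨k', hk'⟩ := ih (x - algebraMap K _ k) fun w hw hwB => by
        rw [sub_apply, algebraMap_apply]
        by_cases hwv : w = v
        · subst hwv
          rw [← sub_add_sub_cancel _ (algebraMap K w.Completion k₀), ← map_sub]
          refine w.integers.add_mem _ _ ?_ (hcoe w _ hk)
          rw [map_one] at hk₀
          exact hk₀.le
        · exact sub_mem (hx w hw (by simp [hwv, hwB])) (hcoe w _ (hkw w hw hwv))
      refine ⟨k + k', fun w hw => ?_⟩
      have := hk' w hw
      rwa [sub_apply, algebraMap_apply, sub_sub, ← map_add] at this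
    · refine ih x fun w hw hwB => hx w hw ?_
      rintro (rfl | h)
      exacts [hv hw, hwB h]

end Integral

theorem isCompact_closedBall_completion (v : NumberField.InfinitePlace K) (r : ℝ) :
    IsCompact (Metric.closedBall (0 : v.Completion) r) := by
  have h := (NumberField.InfinitePlace.Completion.isometry_extensionEmbedding v
    ).isClosedEmbedding.isCompact_preimage (isCompact_closedBall 0 r)
  convert h using 1
  ext x
  have := (NumberField.InfinitePlace.Completion.isometry_extensionEmbedding v).dist_eq x 0
  rw [map_zero] at this
  simp only [Metric.mem_closedBall, mem_preimage, this]

section Cocompact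

variable {R₀ L : Type*} [CommRing R₀] [IsDomain R₀] [IsPrincipalIdealRing R₀] [Field L]
    [Algebra R₀ L] [IsFractionRing R₀ L] [Algebra R₀ K] [Algebra L K] [IsScalarTower R₀ L K]
    [FiniteDimensional L K] [IsGlobalField K]

theorem norm_algebraMap_completion (v : NumberField.InfinitePlace K) (k : K) :
    ‖algebraMap K v.Completion k‖ = v k :=
  NumberField.InfinitePlace.Completion.norm_coe v _

/-- A criterion for the cocompactness of `K` in its adele ring, in terms of a principal ideal
domain `R₀`: approximation at the places that are not over `R₀`, and approximation of fractions by
elements of `R₀` at these places. -/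
theorem exists_isCompact_of_approx
    (hS : {v : FinitePlace K | ¬ v.IsIntegralOver R₀}.Finite)
    (happ : ∀ x : AdeleRing K, ∃ k : K,
      (∀ v : FinitePlace K, ¬ v.IsIntegralOver R₀ →
        Valued.v (x.2 v - algebraMap K v.Completion k) ≤ 1) ∧
      ∀ v : NumberField.InfinitePlace K, ‖x.1 v - algebraMap K v.Completion k‖ ≤ 1)
    (hfrac : ∀ c : L, ∃ p : R₀,
      (∀ v : FinitePlace K, ¬ v.IsIntegralOver R₀ →
        v.prime.valuation K (algebraMap L K c - algebraMap R₀ K p) ≤ 1) ∧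
      ∀ v : NumberField.InfinitePlace K, v (algebraMap L K c - algebraMap R₀ K p) ≤ 1) :
    ∃ C : Set (AdeleRing K), IsCompact C ∧
      ∀ a, ∃ k : K, algebraMap K (AdeleRing K) k + a ∈ C := by
  have hinj : Function.Injective (algebraMap R₀ K) := by
    rw [IsScalarTower.algebraMap_eq R₀ L K]
    exact (algebraMap L K).injective.comp (IsFractionRing.injective R₀ L)
  have : FaithfulSMul R₀ K := (faithfulSMul_iff_algebraMap_injective R₀ K).2 hinj
  have halg : Algebra.IsAlgebraic R₀ K := ⟨fun k =>
    (IsFractionRing.isAlgebraic_iff R₀ L K).2 (Algebra.IsAlgebraic.isAlgebraic k)⟩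
  let b := Module.finBasis L K
  choose d hd0 hd using fun i => (halg.isAlgebraic (b i)).exists_integral_multiple
  -- A basis of `K` over `L` scaled to be integral over `R₀`, so that `R₀`-combinations of the `e i`
  -- disturb nothing at the places over `R₀`.
  set e := fun i => d i • b i
  have he (k : K) : ∃ c : Fin (Module.finrank L K) → L, k = ∑ i, algebraMap L K (c i) * e i := by
    refine ⟨fun i => b.repr k i * (algebraMap R₀ L (d i))⁻¹, ?_⟩
    conv_lhs => rw [← b.sum_repr k]
    refine Finset.sum_congr rfl fun i _ => ?_
    have hne : algebraMap R₀ K (d i) ≠ 0 := algebraMap_ne_zero (hd0 i)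
    simp only [e, Algebra.smul_def, map_mul, map_inv₀,
      ← IsScalarTower.algebraMap_apply R₀ L K]
    field_simp
  -- The value `1` at `none` accounts for the error of `happ`; at each remaining finite place the
  -- box in `C` has radius the maximum of `1` and the sizes of the `e i`.
  let f : Option (Fin (Module.finrank L K)) → K := fun i => i.elim 1 e
  choose i₀ hi₀ using fun v : FinitePlace K => Finite.exists_max fun i => v.prime.valuation K (f i)
  have hf0 (v : FinitePlace K) : f (i₀ v) ≠ 0 := by
    intro h
    have := hi₀ v none
    simp [h, f] at this
  obtain ⟨u, hu⟩ := FiniteAdeleRing.exists_unit_forall_mul_mem hS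
    (b := fun v => algebraMap K v.Completion (f (i₀ v))) (fun v _ => by simpa using hf0 v)
  let C : Set (AdeleRing K) :=
    (Set.pi univ fun v : NumberField.InfinitePlace K =>
      Metric.closedBall (0 : v.Completion) (1 + ∑ i, v (e i))) ×ˢ
      {a | u.1 * a ∈ FiniteAdeleRing.integers K}
  have hC : IsCompact C := by
    refine IsCompact.prod (isCompact_univ_pi fun v => isCompact_closedBall_completion v _) ?_
    simpa using isCompact_preimage_unit_mul_sub (R := FiniteAdeleRing K)
      FiniteAdeleRing.isCompact_integers u 0
  refine ⟨C, hC, fun a => ?_⟩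
  obtain ⟨k₁, hk₁⟩ := FiniteAdeleRing.exists_forall_sub_mem (R₀ := R₀) a.2
  obtain ⟨k₂, hk₂, hk₂'⟩ := happ (a - algebraMap K (AdeleRing K) k₁)
  obtain ⟨c, hc⟩ := he k₂
  choose p hp hp' using fun i => hfrac (c i)
  set k₃ := ∑ i, algebraMap R₀ K (p i) * e i
  have hk₃ : k₂ - k₃ = ∑ i, (algebraMap L K (c i) - algebraMap R₀ K (p i)) * e i := by
    simp only [sub_mul, Finset.sum_sub_distrib, ← hc, k₃]
  -- `k₁` corrects the places over `R₀` and `k₂` the others, but `k₂` may have poles over `R₀`.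
  -- Replacing its coordinates by their integral parts gives `k₃`, integral over `R₀`, at the cost
  -- of the bounded error `k₂ - k₃` elsewhere.
  refine ⟨-(k₁ + k₃), fun v _ => ?_, ?_⟩
  · rw [mem_closedBall_zero_iff]
    have h1 : (algebraMap K (AdeleRing K) (-(k₁ + k₃)) + a).1 v =
        ((a - algebraMap K (AdeleRing K) k₁).1 v - algebraMap K v.Completion k₂) +
          algebraMap K v.Completion (k₂ - k₃) := by
      change algebraMap K v.Completion (-(k₁ + k₃)) + a.1 v =
        (a.1 v - algebraMap K v.Completion k₁ - algebraMap K v.Completion k₂) + _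
      simp only [map_neg, map_add, map_sub]
      ring
    rw [h1]
    refine (norm_add_le _ _).trans (add_le_add (hk₂' v) ?_)
    rw [norm_algebraMap_completion, hk₃]
    refine (v.1.sum_le _ _).trans (Finset.sum_le_sum fun i _ => ?_)
    change v _ ≤ v _
    rw [map_mul]
    exact mul_le_of_le_one_left (apply_nonneg v _) (hp' i v)
  · refine (hu _).2 ⟨fun v hv => ?_, fun v hv => ?_⟩
    · have hv' : v.IsIntegralOver R₀ := not_not.1 hv
      have h1 : (algebraMap K (AdeleRing K) (-(k₁ + k₃)) + a).2 v =
          (a.2 v - algebraMap K v.Completion k₁) - algebraMap K v.Completion k₃ := by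
        change algebraMap K v.Completion (-(k₁ + k₃)) + a.2 v = _
        simp only [map_neg, map_add]
        ring
      rw [h1]
      refine sub_mem (hk₁ v hv') ?_
      rw [v.mem_integers, v.valued_algebraMap, v.valuation_le_one_iff]
      exact sum_mem fun i _ => v.1.mul_mem _ _ (hv' _) (v.mem_of_isIntegral hv' (hd i))
    · have h1 : (algebraMap K (AdeleRing K) (-(k₁ + k₃)) + a).2 v =
          ((a - algebraMap K (AdeleRing K) k₁).2 v - algebraMap K v.Completion k₂) +
            algebraMap K v.Completion (k₂ - k₃) := by
        change algebraMap K v.Completion (-(k₁ + k₃)) + a.2 v =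
          (a.2 v - algebraMap K v.Completion k₁ - algebraMap K v.Completion k₂) + _
        simp only [map_neg, map_add, map_sub]
        ring
      rw [h1, v.valued_algebraMap]
      refine Valuation.map_add_le _ ((hk₂ v hv).trans ?_) ?_
      · simpa [f] using hi₀ v none
      · rw [v.valued_algebraMap, hk₃]
        refine Valuation.map_sum_le _ fun i _ => ?_
        rw [map_mul]
        exact (mul_le_of_le_one_left zero_le (hp i v hv)).trans (hi₀ v (some i))

end Cocompact

end GlobalField

/-! ### Cocompactness, countability and infinitude of `K` -/

namespace GlobalField

variable {K : Type*} [Field K]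

/-- Over `ℤ` every finite place is integral, the Archimedean places are handled by density of `K`,
and the integral part of a rational number is its floor. -/
theorem exists_isCompact_of_numberField [IsGlobalField K] [NumberField K] :
    ∃ C : Set (AdeleRing K), IsCompact C ∧
      ∀ a, ∃ k : K, algebraMap K (AdeleRing K) k + a ∈ C := by
  have hint (v : FinitePlace K) : v.IsIntegralOver ℤ := fun c => intCast_mem v.1 c
  refine exists_isCompact_of_approx (R₀ := ℤ) (L := ℚ) ?_ (fun x => ?_) (fun c => ?_)
  · simp [hint]
  · have hO : IsOpen {y : NumberField.InfiniteAdeleRing K |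
        ∀ v : NumberField.InfinitePlace K, ‖x.1 v - y v‖ < 1} := by
      rw [ofPred_forall]
      exact isOpen_iInter_of_finite fun v => isOpen_lt
        (continuous_const.sub (continuous_apply v)).norm continuous_const
    obtain ⟨k, hk⟩ := (NumberField.InfiniteAdeleRing.denseRange_algebraMap K).exists_mem_open hO
      ⟨x.1, fun v => by simp⟩
    exact ⟨k, fun v hv => (hv (hint v)).elim, fun v => (hk v).le⟩
  · refine ⟨⌊c⌋, fun v hv => (hv (hint v)).elim, fun v => ?_⟩
    rw [← v.norm_embedding_eq]
    have : algebraMap ℚ K c - algebraMap ℤ K ⌊c⌋ = algebraMap ℚ K (Int.fract c) := by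
      rw [← Int.self_sub_floor, map_sub, map_intCast]
      simp
    rw [this, eq_ratCast, map_ratCast, Complex.norm_ratCast]
    have h0 := Int.fract_nonneg c
    have h1 := (Int.fract_lt_one c).le
    rw [abs_of_nonneg (by exact_mod_cast h0)]
    exact_mod_cast h1

theorem isEmpty_infinitePlace_of_functionField (F : Type) [Field F] [Finite F]
    [Algebra (RatFunc F) K] : IsEmpty (NumberField.InfinitePlace K) := by
  refine ⟨fun v => ?_⟩
  obtain ⟨p, hp⟩ := CharP.exists F
  have hp0 : p ≠ 0 := CharP.char_ne_zero_of_finite F p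
  have h := congrArg (v.embedding.comp ((algebraMap (RatFunc F) K).comp (algebraMap F (RatFunc F))))
    (CharP.cast_eq_zero F p)
  rw [map_natCast, map_zero] at h
  exact hp0 (Nat.cast_eq_zero.1 h)

/-- Over `F[X]` the exceptional places are poles of `X`, finite in number. The integral part of a
fraction is the quotient by polynomial division: at a pole of `X` the valuation of a polynomial is
governed by its degree, so remainder over denominator is integral. -/
theorem exists_isCompact_of_functionField [IsGlobalField K] (F : Type) [Field F] [Finite F]
    [Algebra (RatFunc F) K] [FunctionField F K] :
    ∃ C : Set (AdeleRing K), IsCompact C ∧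
      ∀ a, ∃ k : K, algebraMap K (AdeleRing K) k + a ∈ C := by
  let _ : Algebra F K := Algebra.compHom K (algebraMap F (RatFunc F))
  have : IsScalarTower F (RatFunc F) K := IsScalarTower.of_algebraMap_eq fun _ => rfl
  let _ : Algebra (Polynomial F) K := Algebra.compHom K (algebraMap (Polynomial F) (RatFunc F))
  have : IsScalarTower (Polynomial F) (RatFunc F) K := IsScalarTower.of_algebraMap_eq fun _ => rfl
  have := isEmpty_infinitePlace_of_functionField (K := K) F
  have hC (c : F) : algebraMap (Polynomial F) K (Polynomial.C c) = algebraMap F K c := by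
    rw [IsScalarTower.algebraMap_apply (Polynomial F) (RatFunc F) K, ← Polynomial.algebraMap_eq,
      ← IsScalarTower.algebraMap_apply F (Polynomial F) (RatFunc F)]
    rfl
  have hF (v : FinitePlace K) (c : F) (hc : c ≠ 0) :
      v.prime.valuation K (algebraMap F K c) = 1 := by
    have := Fintype.ofFinite F
    have h : (v.prime.valuation K (algebraMap F K c)) ^ (Fintype.card F - 1) = 1 := by
      rw [← map_pow, ← map_pow, FiniteField.pow_card_sub_one_eq_one c hc, map_one, map_one]
    exact (pow_eq_one_iff_of_nonneg zero_le (Nat.sub_ne_zero_of_lt Fintype.one_lt_card)).1 h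
  have hF' (v : FinitePlace K) (c : F) : v.prime.valuation K (algebraMap F K c) ≤ 1 := by
    by_cases hc : c = 0
    · simp [hc]
    · exact (hF v c hc).le
  set t := algebraMap (Polynomial F) K Polynomial.X
  have hsum (p : Polynomial F) {n : ℕ} (hn : p.natDegree < n) :
      algebraMap (Polynomial F) K p =
        ∑ i ∈ Finset.range n, algebraMap F K (p.coeff i) * t ^ i := by
    conv_lhs => rw [p.as_sum_range' n hn]
    simp only [← Polynomial.C_mul_X_pow_eq_monomial, map_sum, map_mul, map_pow, hC, t]
  have hint (v : FinitePlace K) (ht : t ∈ v.1) : v.IsIntegralOver (Polynomial F) := fun p => by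
    rw [hsum p (Nat.lt_succ_self _)]
    exact sum_mem fun i _ => v.1.mul_mem _ _ ((v.valuation_le_one_iff _).1 (hF' v _))
      (pow_mem ht i)
  have hlt (v : FinitePlace K) (ht : t ∉ v.1) (p : Polynomial F) {n : ℕ} (hn : p.degree < n) :
      v.prime.valuation K (algebraMap (Polynomial F) K p) < v.prime.valuation K t ^ n := by
    have ht1 : 1 < v.prime.valuation K t := not_le.1 fun h => ht ((v.valuation_le_one_iff _).1 h)
    rcases eq_or_ne p 0 with rfl | hp
    · rw [map_zero, map_zero]
      exact pow_pos (zero_lt_one.trans ht1) n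
    rw [hsum p ((Polynomial.natDegree_lt_iff_degree_lt hp).2 hn)]
    refine Valuation.map_sum_lt _ (pow_pos (zero_lt_one.trans ht1) n).ne' fun i hi => ?_
    rw [map_mul, map_pow]
    exact (mul_le_of_le_one_left zero_le (hF' v _)).trans_lt
      (pow_lt_pow_right₀ ht1 (Finset.mem_range.1 hi))
  have hmonic (v : FinitePlace K) (ht : t ∉ v.1) (q : Polynomial F) (hq : q.Monic) :
      v.prime.valuation K (algebraMap (Polynomial F) K q) =
        v.prime.valuation K t ^ q.natDegree := by
    have h1 : algebraMap (Polynomial F) K q =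
        algebraMap (Polynomial F) K (q - Polynomial.X ^ q.natDegree) + t ^ q.natDegree := by
      rw [map_sub, map_pow, sub_add_cancel]
    rw [h1, Valuation.map_add_eq_of_lt_right, map_pow]
    rw [map_pow]
    refine hlt v ht _ ?_
    refine (Polynomial.degree_sub_lt_left ?_ hq.ne_zero ?_).trans_eq ?_
    · rw [Polynomial.degree_X_pow, Polynomial.degree_eq_natDegree hq.ne_zero]
    · rw [hq.leadingCoeff, Polynomial.leadingCoeff_X_pow]
    · exact Polynomial.degree_eq_natDegree hq.ne_zero
  have hS : {v : FinitePlace K | ¬ v.IsIntegralOver (Polynomial F)}.Finite :=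
    (FinitePlace.finite_not_mem t).subset fun v hv ht => hv (hint v ht)
  refine exists_isCompact_of_approx (R₀ := Polynomial F) (L := RatFunc F) hS (fun x => ?_)
    (fun c => ?_)
  · choose a ha using fun v : FinitePlace K => v.exists_valued_sub_lt (x.2 v) one_ne_zero
    obtain ⟨k, hk⟩ := FinitePlace.exists_forall_valuation_sub_le hS a
    refine ⟨k, fun v hv => ?_, fun v => isEmptyElim v⟩
    rw [← sub_sub_sub_cancel_right _ _ (algebraMap K v.Completion (a v)), ← map_sub]
    refine Valuation.map_sub_le _ ((ha v).le.trans_eq (map_one _)) ?_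
    rw [v.valued_algebraMap]
    exact hk v hv
  · refine ⟨c.num /ₘ c.denom, fun v hv => ?_, fun v => isEmptyElim v⟩
    have ht : t ∉ v.1 := fun h => hv (hint v h)
    have hd := c.monic_denom
    have hd0 : algebraMap (Polynomial F) K c.denom ≠ 0 := by
      intro h
      have := hmonic v ht _ hd
      rw [h, map_zero] at this
      refine (pow_pos ?_ _).ne this
      exact zero_lt_one.trans (not_le.1 fun h => ht ((v.valuation_le_one_iff _).1 h))
    have h1 : algebraMap (RatFunc F) K c =
        algebraMap (Polynomial F) K c.num / algebraMap (Polynomial F) K c.denom := by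
      conv_lhs => rw [← RatFunc.num_div_denom c]
      rw [map_div₀, ← IsScalarTower.algebraMap_apply, ← IsScalarTower.algebraMap_apply]
    have h2 := congrArg (algebraMap (Polynomial F) K) (Polynomial.modByMonic_add_div c.num c.denom)
    rw [map_add, map_mul] at h2
    have h3 : algebraMap (RatFunc F) K c - algebraMap (Polynomial F) K (c.num /ₘ c.denom) =
        algebraMap (Polynomial F) K (c.num %ₘ c.denom) / algebraMap (Polynomial F) K c.denom := by
      rw [h1, eq_div_iff hd0, sub_mul, div_mul_cancel₀ _ hd0, ← h2]
      ring
    rw [h3, map_div₀]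
    refine div_le_one_of_le₀ ?_ zero_le
    rw [hmonic v ht _ hd]
    refine (hlt v ht _ ?_).le
    rw [← Polynomial.degree_eq_natDegree hd.ne_zero]
    exact Polynomial.degree_modByMonic_lt _ hd

variable [IsGlobalField K]

variable (K) in
/-- `K` is cocompact in its adele ring. -/
theorem exists_isCompact_forall_exists_add_mem : ∃ C : Set (AdeleRing K), IsCompact C ∧
    ∀ a, ∃ k : K, algebraMap K (AdeleRing K) k + a ∈ C := by
  rcases IsGlobalField.numberField_or_functionField (K := K) with h | ⟨F, _, _, _, h⟩
  · exact exists_isCompact_of_numberField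
  · exact exists_isCompact_of_functionField F

variable (K) in
theorem finite_infinitePlace : Finite (NumberField.InfinitePlace K) := by
  rcases IsGlobalField.numberField_or_functionField (K := K) with h | ⟨F, _, _, _, h⟩
  · infer_instance
  · have := isEmpty_infinitePlace_of_functionField (K := K) F
    infer_instance

variable (K) in
theorem countable : Countable K := by
  rcases IsGlobalField.numberField_or_functionField (K := K) with h | ⟨F, _, _, _, h⟩
  · exact Finsupp.Countable.of_moduleFinite (R := ℚ) (M := K)
  · have : Countable (Polynomial F) :=
      Polynomial.toFinsuppIso F |>.toEquiv.trans AddMonoidAlgebra.coeffEquiv |>.countable_iff.2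
        inferInstance
    have : Countable (RatFunc F) := by
      have hinj : Function.Injective fun c : RatFunc F => (c.num, c.denom) := fun c d h => by
        rw [← RatFunc.num_div_denom c, ← RatFunc.num_div_denom d, (Prod.mk.inj h).1,
          (Prod.mk.inj h).2]
      exact hinj.countable
    have : FiniteDimensional (RatFunc F) K := h
    exact Finsupp.Countable.of_moduleFinite (R := RatFunc F) (M := K)

variable (K) in
theorem infinite : Infinite K := by
  rcases IsGlobalField.numberField_or_functionField (K := K) with h | ⟨F, _, _, _, h⟩
  · exact CharZero.infinite K
  · exact Infinite.of_injective _ ((algebraMap (RatFunc F) K).injective.comp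
      (RatFunc.algebraMap_injective F))

end GlobalField

/-! ### Tensor products of Schwartz functions -/

section SchwartzPi
open scoped SchwartzMap ContDiff

variable {ι : Type*} [Fintype ι] {V : ι → Type*} [∀ i, NormedAddCommGroup (V i)]
  [∀ i, NormedSpace ℝ (V i)]

/-- The tensor product of Schwartz functions is a Schwartz function. -/
theorem SchwartzMap.exists_pi (g : ∀ i, 𝓢(V i, ℂ)) :
    ∃ G : 𝓢(∀ i, V i, ℂ), ∀ x, G x = ∏ i, g i (x i) := by
  classical
  let pr (i : ι) : (∀ i, V i) →L[ℝ] V i := ContinuousLinearMap.proj i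
  have hpr (i) : ‖pr i‖ ≤ 1 :=
    ContinuousLinearMap.opNorm_le_bound _ zero_le_one fun x => by
      rw [one_mul]; exact norm_le_pi_norm x i
  have hsm (i) : ContDiff ℝ ∞ fun x : ∀ i, V i => g i (x i) :=
    (g i).smooth'.comp (pr i).contDiff
  refine ⟨⟨fun x => ∏ i, g i (x i), contDiff_prod fun i _ => hsm i, fun k n => ?_⟩, fun x => rfl⟩
  choose C hC using fun (i : ι) (m : ℕ) => show ∃ C, ∀ x : V i,
      (1 + ‖x‖) ^ k * ‖iteratedFDeriv ℝ m (g i) x‖ ≤ C from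
    ⟨_, fun x => SchwartzMap.one_add_le_sup_seminorm_apply (𝕜 := ℝ) (m := (k, m)) le_rfl le_rfl
      (g i) x⟩
  refine ⟨∑ p ∈ (Finset.univ : Finset ι).sym n, (p : Multiset ι).countPerms *
    ∏ j, C j ((p : Multiset ι).count j), fun x => ?_⟩
  -- Leibniz's rule splits the derivative over the factors, and the product of the `1 + ‖x i‖`
  -- dominates the sup norm, so each factor can absorb its own weight.
  have h1 := norm_iteratedFDeriv_prod_le (𝕜 := ℝ) (N := ∞) (u := Finset.univ)
    (f := fun i (x : ∀ i, V i) => g i (x i)) (fun i _ => hsm i) (x := x) (n := n)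
    (mod_cast le_top)
  have hx : ‖x‖ ^ k ≤ ∏ i, (1 + ‖x i‖) ^ k := by
    rw [Finset.prod_pow]
    refine pow_le_pow_left₀ (norm_nonneg _) ?_ k
    have h0 : ∀ j ∈ Finset.univ, 1 ≤ 1 + ‖x j‖ := fun j _ => by
      linarith [norm_nonneg (x j)]
    refine (pi_norm_le_iff_of_nonneg (Finset.prod_nonneg fun i hi => zero_le_one.trans (h0 i hi))).2
      fun i => ?_
    have h2 : 1 + ‖x i‖ ≤ ∏ j, (1 + ‖x j‖) :=
      by
        rw [← Finset.mul_prod_erase _ _ (Finset.mem_univ i)]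
        exact le_mul_of_one_le_right (zero_le_one.trans (h0 i (Finset.mem_univ i)))
          (Finset.one_le_prod fun j _ => h0 j (Finset.mem_univ j))
    linarith
  calc ‖x‖ ^ k * ‖iteratedFDeriv ℝ n (fun x : ∀ i, V i => ∏ i, g i (x i)) x‖
      ≤ (∏ i, (1 + ‖x i‖) ^ k) * ∑ p ∈ (Finset.univ : Finset ι).sym n,
          (p : Multiset ι).countPerms *
          ∏ j, ‖iteratedFDeriv ℝ ((p : Multiset ι).count j) (fun x : ∀ i, V i => g j (x j)) x‖ :=
        mul_le_mul hx h1 (norm_nonneg _) (Finset.prod_nonneg fun i _ => by positivity)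
    _ ≤ _ := by
      rw [Finset.mul_sum]
      refine Finset.sum_le_sum fun p _ => ?_
      rw [mul_left_comm, ← Finset.prod_mul_distrib]
      refine mul_le_mul_of_nonneg_left (Finset.prod_le_prod (fun i _ => by positivity)
        fun i _ => ?_) (Nat.cast_nonneg _)
      refine le_trans ?_ (hC i _ (x i))
      refine mul_le_mul_of_nonneg_left ?_ (by positivity)
      set m := (p : Multiset ι).count i
      have h3 := (pr i).iteratedFDeriv_comp_right (f := g i) (n := ∞) (g i).smooth' x (i := m)
        (mod_cast le_top)
      change ‖iteratedFDeriv ℝ m (g i ∘ pr i) x‖ ≤ _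
      rw [h3]
      refine (ContinuousMultilinearMap.norm_compContinuousLinearMap_le _ _).trans ?_
      refine mul_le_of_le_one_right (norm_nonneg _) (Finset.prod_le_one (fun _ _ => norm_nonneg _)
        fun _ _ => hpr i)

end SchwartzPi

/-! ### Archimedean completions as real algebras -/

namespace GlobalField
open NumberField InfinitePlace.Completion
open scoped SchwartzMap ContDiff

variable {K : Type*} [Field K]

section InfinitePlaces

variable (v : InfinitePlace K)

theorem exists_extensionEmbedding_eq_ofReal (r : ℝ) :
    ∃ x : v.Completion, extensionEmbedding v x = r := by
  by_cases hv : v.IsReal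
  · obtain ⟨x, hx⟩ := surjective_extensionEmbeddingOfIsReal hv r
    exact ⟨x, by rw [← extensionEmbeddingOfIsReal_apply hv, hx]⟩
  · exact surjective_extensionEmbedding_of_isComplex (InfinitePlace.not_isReal_iff_isComplex.1 hv) _

/-- The embedding of `ℝ` in an Archimedean completion. -/
noncomputable def ofRealCompletion : ℝ →+* v.Completion where
  toFun r := (exists_extensionEmbedding_eq_ofReal v r).choose
  map_one' := (extensionEmbedding v).injective (by
    rw [(exists_extensionEmbedding_eq_ofReal v 1).choose_spec, map_one, Complex.ofReal_one])
  map_zero' := (extensionEmbedding v).injective (by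
    rw [(exists_extensionEmbedding_eq_ofReal v 0).choose_spec, map_zero, Complex.ofReal_zero])
  map_mul' r s := (extensionEmbedding v).injective (by
    rw [map_mul, (exists_extensionEmbedding_eq_ofReal v r).choose_spec,
      (exists_extensionEmbedding_eq_ofReal v s).choose_spec,
      (exists_extensionEmbedding_eq_ofReal v (r * s)).choose_spec, Complex.ofReal_mul])
  map_add' r s := (extensionEmbedding v).injective (by
    rw [map_add, (exists_extensionEmbedding_eq_ofReal v r).choose_spec,
      (exists_extensionEmbedding_eq_ofReal v s).choose_spec,
      (exists_extensionEmbedding_eq_ofReal v (r + s)).choose_spec, Complex.ofReal_add])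

theorem extensionEmbedding_ofRealCompletion (r : ℝ) :
    extensionEmbedding v (ofRealCompletion v r) = r :=
  (exists_extensionEmbedding_eq_ofReal v r).choose_spec

theorem norm_extensionEmbedding (x : v.Completion) : ‖extensionEmbedding v x‖ = ‖x‖ :=
  (isometry_extensionEmbedding v).norm_map_of_map_zero (map_zero _) x

/-- The real structure is pulled back from `ℂ`, uniformly for real and complex places; its dimension
is the multiplicity of `v`, which makes the exponents in `ideleNorm` those of the Haar modulus. -/
noncomputable instance : NormedAlgebra ℝ v.Completion where
  __ := (ofRealCompletion v).toAlgebra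
  norm_smul_le r x := by
    change ‖ofRealCompletion v r * x‖ ≤ _
    rw [norm_mul, ← norm_extensionEmbedding v (ofRealCompletion v r),
      extensionEmbedding_ofRealCompletion, Complex.norm_real]

/-- An Archimedean completion, as a real subspace of `ℂ`. -/
noncomputable def extensionEmbeddingₗᵢ : v.Completion →ₗᵢ[ℝ] ℂ where
  toFun := extensionEmbedding v
  map_add' := map_add _
  map_smul' r x := by
    change extensionEmbedding v (ofRealCompletion v r * x) = _
    rw [map_mul, extensionEmbedding_ofRealCompletion]
    simp
  norm_map' := norm_extensionEmbedding v

instance : FiniteDimensional ℝ v.Completion :=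
  FiniteDimensional.of_injective (extensionEmbeddingₗᵢ v).toLinearMap
    (extensionEmbeddingₗᵢ v).injective

instance : ProperSpace v.Completion := FiniteDimensional.proper_real _

noncomputable instance : MeasurableSpace v.Completion := borel _

instance : BorelSpace v.Completion := ⟨rfl⟩

variable {v}

/-- The completion at a real place. -/
noncomputable def realEquiv (hv : v.IsReal) : v.Completion ≃L[ℝ] ℝ :=
  LinearEquiv.toContinuousLinearEquiv
    { ringEquivRealOfIsReal hv with
      map_smul' := fun r x => by
        change extensionEmbeddingOfIsReal hv (ofRealCompletion v r * x) = r * _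
        rw [map_mul]
        congr 1
        refine Complex.ofReal_injective ?_
        rw [extensionEmbeddingOfIsReal_apply, extensionEmbedding_ofRealCompletion] }

/-- The completion at a complex place. -/
noncomputable def complexEquiv (hv : v.IsComplex) : v.Completion ≃L[ℝ] ℂ :=
  LinearEquiv.toContinuousLinearEquiv
    (LinearEquiv.ofBijective (extensionEmbeddingₗᵢ v).toLinearMap
      (bijective_extensionEmbedding_of_isComplex hv))

variable (v) in
theorem finrank_completion : Module.finrank ℝ v.Completion = v.mult := by
  by_cases hv : v.IsReal
  · rw [(realEquiv hv).toLinearEquiv.finrank_eq, Module.finrank_self, InfinitePlace.mult, if_pos hv]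
  · rw [(complexEquiv (InfinitePlace.not_isReal_iff_isComplex.1 hv)).toLinearEquiv.finrank_eq,
      Complex.finrank_real_complex, InfinitePlace.mult, if_neg hv]

theorem IsSchwartz.exists_eq {f : v.Completion → ℂ} (hf : IsSchwartz v f) :
    ∃ g : 𝓢(v.Completion, ℂ), f = g := by
  rcases hf with ⟨hv, g, hg⟩ | ⟨hv, g, hg⟩
  · exact ⟨SchwartzMap.compCLMOfContinuousLinearEquiv ℝ (realEquiv hv) g, funext hg⟩
  · exact ⟨SchwartzMap.compCLMOfContinuousLinearEquiv ℝ (complexEquiv hv) g, funext hg⟩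

theorem _root_.ContDiffBump.exists_schwartzMap {V : Type*} [NormedAddCommGroup V] [NormedSpace ℝ V]
    [FiniteDimensional ℝ V] [HasContDiffBump V] (b : ContDiffBump (0 : V)) :
    ∃ g : 𝓢(V, ℂ), ∀ x, g x = (b x : ℂ) := by
  refine ⟨HasCompactSupport.toSchwartzMap (f := fun x => ((b x : ℝ) : ℂ)) ?_ ?_, fun x => rfl⟩
  · exact b.hasCompactSupport.comp_left (g := fun r : ℝ => (r : ℂ)) Complex.ofReal_zero
  · exact Complex.ofRealCLM.contDiff.comp b.contDiff

variable (v) in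
/-- Bump functions on an Archimedean completion. -/
theorem exists_isSchwartz_bump {r : ℝ} (hr : 0 < r) : ∃ b : v.Completion → ℝ,
    IsSchwartz v (fun x => (b x : ℂ)) ∧ (∀ x, 0 ≤ b x) ∧ b 0 = 1 ∧ (∀ x, b (-x) = b x) ∧
      ∀ x, r ≤ ‖x‖ → b x = 0 := by
  by_cases hv : v.IsReal
  · let b : ContDiffBump (0 : ℝ) := ⟨r / 2, r, half_pos hr, half_lt_self hr⟩
    obtain ⟨g, hg⟩ := b.exists_schwartzMap
    refine ⟨fun x => b (extensionEmbeddingOfIsReal hv x), Or.inl ⟨hv, g, fun x => (hg _).symm⟩,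
      fun x => b.nonneg, ?_, fun x => ?_, fun x hx => ?_⟩
    · simp only [map_zero]
      exact b.one_of_mem_closedBall (Metric.mem_closedBall_self b.rIn_pos.le)
    · simp only [map_neg, b.neg]
    · refine b.zero_of_le_dist ?_
      rwa [dist_zero_right, (isometry_extensionEmbeddingOfIsReal hv).norm_map_of_map_zero
        (map_zero _) x]
  · let b : ContDiffBump (0 : ℂ) := ⟨r / 2, r, half_pos hr, half_lt_self hr⟩
    obtain ⟨g, hg⟩ := b.exists_schwartzMap
    refine ⟨fun x => b (extensionEmbedding v x),
      Or.inr ⟨InfinitePlace.not_isReal_iff_isComplex.1 hv, g, fun x => (hg _).symm⟩,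
      fun x => b.nonneg, ?_, fun x => ?_, fun x hx => ?_⟩
    · simp only [map_zero]
      exact b.one_of_mem_closedBall (Metric.mem_closedBall_self b.rIn_pos.le)
    · simp only [map_neg, b.neg]
    · refine b.zero_of_le_dist ?_
      rwa [dist_zero_right, norm_extensionEmbedding]

end InfinitePlaces

end GlobalField

/-! ### Decomposition of Schwartz–Bruhat functions into boxes -/

section LocallyConstant

variable {R : Type*} [CommRing R] [TopologicalSpace R] [IsTopologicalRing R] {O : AddSubgroup R}

/-- A compactly supported function that is invariant under an open subgroup is a finite linear
combination of indicator functions of cosets. -/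
theorem exists_eq_sum_indicator (hO : IsOpen (O : Set R)) (u : Rˣ) {H : R → ℂ} {B : Set R}
    (hB : IsCompact B) (hHB : ∀ a, H a ≠ 0 → a ∈ B) (hH : ∀ a y : R, u * y ∈ O → H (a + y) = H a) :
    ∃ s : Finset R, ∀ a, H a = ∑ c ∈ s, H c * (O : Set R).indicator 1 (u * a - u * c) := by
  classical
  -- `H` factors through the discrete quotient by `D = u⁻¹ O`, where the compact support has finite
  -- image; the sum runs over representatives of that image.
  let D : AddSubgroup R := O.comap (AddMonoidHom.mulLeft (u : R))
  have hD (y : R) : y ∈ D ↔ u * y ∈ O := Iff.rfl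
  have hDo : IsOpen (D : Set R) := hO.preimage (continuous_const_mul (u : R))
  have := QuotientAddGroup.discreteTopology hDo
  have hfin : ((QuotientAddGroup.mk : R → R ⧸ D) '' B).Finite :=
    (hB.image QuotientAddGroup.continuous_mk).finite_of_discrete
  have hout (q : R ⧸ D) : ((Quotient.out q : R) : R ⧸ D) = q := Quotient.out_eq q
  refine ⟨hfin.toFinset.image Quotient.out, fun a => ?_⟩
  rw [Finset.sum_image fun p _ q _ h => by rw [← hout p, ← hout q, h]]
  have h1 (q : R ⧸ D) : (O : Set R).indicator (1 : R → ℂ) (u * a - u * Quotient.out q) =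
      if (a : R ⧸ D) = q then 1 else 0 := by
    have : (a : R ⧸ D) = q ↔ u * a - u * Quotient.out q ∈ (O : Set R) := by
      conv_lhs => rw [← hout q, eq_comm, QuotientAddGroup.eq, hD]
      rw [neg_add_eq_sub, mul_sub]
      rfl
    simp only [this, indicator, Pi.one_apply]
  have h2 : H a = H (Quotient.out (a : R ⧸ D)) := by
    have h3 : -a + Quotient.out (a : R ⧸ D) ∈ D := QuotientAddGroup.eq.1 (hout _).symm
    have := hH a _ h3
    rw [add_neg_cancel_left] at this
    exact this.symm
  simp only [h1, mul_ite, mul_one, mul_zero]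
  rw [Finset.sum_ite_eq]
  split_ifs with h
  · exact h2
  · by_contra h0
    exact h (by simpa using ⟨a, hHB a h0, rfl⟩)

end LocallyConstant

namespace GlobalField
open scoped SchwartzMap

variable {K : Type*} [Field K]

namespace FinitePlace

theorem exists_completion_uniformizer (v : FinitePlace K) : ∃ π : v.Completion,
    π ≠ 0 ∧ Valued.v π = WithZero.exp (-1 : ℤ) := by
  obtain ⟨y, hy0, -, hy⟩ := v.exists_uniformizer
  exact ⟨algebraMap K _ y, by simpa using hy0, by rw [valued_algebraMap, hy]⟩

variable [IsGlobalField K]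

theorem isCompact_integers (v : FinitePlace K) : IsCompact (v.integers : Set v.Completion) :=
  isCompact_iff_compactSpace.2 (inferInstanceAs (CompactSpace v.integers))

/-- The balls `π ^ (-k) O_v` are open, increasing and exhaust `K_v`, so one of them contains the
compact support. -/
theorem IsSchwartzBruhat.exists_bound {v : FinitePlace K} {h : v.Completion → ℂ}
    (hh : IsSchwartzBruhat v h) :
    ∃ b : v.Completion, b ≠ 0 ∧ ∀ x, h x ≠ 0 → Valued.v x ≤ Valued.v b := by
  obtain ⟨π, hπ0, hπ⟩ := v.exists_completion_uniformizer
  have hlim := Valued.tendsto_zero_pow_of_le_exp_neg_one hπ.le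
  obtain ⟨k, hk⟩ := hh.2.isCompact.elim_directed_cover
    (fun k : ℕ => {x : v.Completion | π ^ k * x ∈ v.integers})
    (fun k => v.isOpen_integers.preimage (continuous_const_mul _))
    (fun x _ => by
      have h1 : Tendsto (fun k : ℕ => π ^ k * x) atTop (𝓝 0) := by
        simpa using hlim.mul_const x
      obtain ⟨k, hk⟩ := (h1.eventually (v.isOpen_integers.mem_nhds v.integers.zero_mem)).exists
      exact mem_iUnion.2 ⟨k, hk⟩)
    (directed_of_isDirected_le fun i j hij x hx => by
      obtain ⟨m, rfl⟩ := Nat.exists_eq_add_of_le hij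
      have : π ^ (i + m) * x = π ^ m * (π ^ i * x) := by ring
      simp only [mem_ofPred_eq, this]
      exact v.integers.mul_mem _ _ (pow_mem (v.mem_integers.2 (hπ.le.trans
        exp_neg_one_lt_one.le)) m) hx)
  refine ⟨(π ^ k)⁻¹, inv_ne_zero (pow_ne_zero k hπ0), fun x hx => ?_⟩
  have h1 : Valued.v (π ^ k * x) ≤ 1 := hk (subset_tsupport h hx)
  rw [map_mul, ← le_inv_mul_iff₀ (by simpa [zero_lt_iff] using fun h : π = 0 => (hπ0 h).elim), mul_one] at h1
  rwa [map_inv₀]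

/-- Local constancy is uniform on the compact support, which makes all sufficiently small elements
periods. -/
theorem IsSchwartzBruhat.exists_period {v : FinitePlace K} {h : v.Completion → ℂ}
    (hh : IsSchwartzBruhat v h) :
    ∃ d : v.Completion, d ≠ 0 ∧ ∀ x y, Valued.v y ≤ Valued.v d → h (x + y) = h x := by
  obtain ⟨π, hπ0, hπ⟩ := v.exists_completion_uniformizer
  have hlim := Valued.tendsto_zero_pow_of_le_exp_neg_one hπ.le
  have h1 : ∀ᶠ y in 𝓝 (0 : v.Completion), ∀ x ∈ tsupport h, h (x + y) = h x := by
    refine hh.2.isCompact.eventually_forall_of_forall_eventually fun x _ => ?_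
    have h2 : ∀ᶠ z in 𝓝 x, h z = h x := (IsLocallyConstant.iff_eventually_eq h).1 hh.1 x
    have h3 : Tendsto (fun p : v.Completion × v.Completion => p.2 + p.1) (𝓝 (0, x)) (𝓝 x) := by
      have : Continuous fun p : v.Completion × v.Completion => p.2 + p.1 := by fun_prop
      simpa using this.tendsto (0, x)
    have h4 : Tendsto (fun p : v.Completion × v.Completion => p.2) (𝓝 (0, x)) (𝓝 x) :=
      continuous_snd.tendsto _
    filter_upwards [h3.eventually h2, h4.eventually h2] with p hp hp'
    rw [hp, hp']
  -- Shifts by `-y` serve for points outside the support: if `h (x + y)` were nonzero, moving back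
  -- from the support would force it to equal `h x = 0`.
  have h5 : ∀ᶠ y in 𝓝 (0 : v.Completion), ∀ x ∈ tsupport h, h (x + -y) = h x := by
    have : Tendsto (fun y : v.Completion => -y) (𝓝 0) (𝓝 0) := by
      simpa using (continuous_neg (G := v.Completion)).tendsto 0
    exact this.eventually h1
  have h6 : ∀ᶠ y in 𝓝 (0 : v.Completion), ∀ x, h (x + y) = h x := by
    filter_upwards [h1, h5] with y hy hy' x
    by_cases hx : x ∈ tsupport h
    · exact hy x hx
    · rw [image_eq_zero_of_notMem_tsupport hx]
      by_contra h0
      have := hy' (x + y) (subset_tsupport h h0)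
      rw [add_neg_cancel_right, image_eq_zero_of_notMem_tsupport hx] at this
      exact h0 this.symm
  have h7 : ∀ᶠ z in 𝓝 (0 : v.Completion), ∀ o ∈ (v.integers : Set v.Completion),
      ∀ x, h (x + z * o) = h x := by
    refine v.isCompact_integers.eventually_forall_of_forall_eventually fun o _ => ?_
    have h3 : Tendsto (fun p : v.Completion × v.Completion => p.1 * p.2) (𝓝 (0, o)) (𝓝 0) := by
      have : Continuous fun p : v.Completion × v.Completion => p.1 * p.2 := by fun_prop
      simpa using this.tendsto (0, o)
    exact h3.eventually h6
  obtain ⟨k, hk⟩ := (hlim.eventually h7).exists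
  refine ⟨π ^ k, pow_ne_zero k hπ0, fun x y hy => ?_⟩
  have h8 : (π ^ k)⁻¹ * y ∈ v.integers := by
    rw [v.mem_integers, map_mul, map_inv₀,
      inv_mul_le_one₀ (by simpa [zero_lt_iff] using fun h : π = 0 => (hπ0 h).elim)]
    exact hy
  have := hk _ h8 x
  rwa [mul_inv_cancel_left₀ (pow_ne_zero k hπ0)] at this

end FinitePlace

variable [IsGlobalField K]

/-- The local bounds and periods at the finitely many places where `h v` is not the indicator of
`O_v` assemble into two finite ideles: the product is supported in a multiple of the integral adeles
and periodic under another, so it is a finite sum over cosets. -/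
theorem exists_eq_sum_indicator_integers {h : ∀ v : FinitePlace K, v.Completion → ℂ}
    (hSB : ∀ v, FinitePlace.IsSchwartzBruhat v (h v))
    (hO : ∀ᶠ v in cofinite, h v = Set.indicator (v.integers : Set v.Completion) 1) :
    ∃ (u : (FiniteAdeleRing K)ˣ) (s : Finset (FiniteAdeleRing K)) (α : FiniteAdeleRing K → ℂ),
      ∀ a : FiniteAdeleRing K, ∏ᶠ v, h v (a v) =
        ∑ c ∈ s, α c * (FiniteAdeleRing.integers K : Set (FiniteAdeleRing K)).indicator 1
          (u * a - u * c) := by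
  classical
  choose b hb0 hb using fun v => (hSB v).exists_bound
  choose d hd0 hd using fun v => (hSB v).exists_period
  set S := {v | h v ≠ Set.indicator (v.integers : Set v.Completion) 1}
  have hS : S.Finite := hO
  have hnS (v) (hv : v ∉ S) : h v = Set.indicator (v.integers : Set v.Completion) 1 := not_not.1 hv
  have hmul (a : FiniteAdeleRing K) : (Function.mulSupport fun v => h v (a v)).Finite := by
    refine (hS.union (FiniteAdeleRing.finite_not_mem_integers a)).subset fun v hv => ?_
    by_contra h1
    simp only [mem_union, mem_ofPred_eq, not_or, not_not] at h1
    refine hv ?_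
    simp only [hnS v h1.1]
    rw [indicator_of_mem (show a v ∈ (v.integers : Set v.Completion) from h1.2), Pi.one_apply]
  obtain ⟨w, hw⟩ := FiniteAdeleRing.exists_unit_forall_mul_mem hS (b := b) fun v _ => hb0 v
  obtain ⟨u, hu⟩ := FiniteAdeleRing.exists_unit_forall_mul_mem hS (b := d) fun v _ => hd0 v
  obtain ⟨s, hs⟩ := exists_eq_sum_indicator (O := FiniteAdeleRing.integers K)
    FiniteAdeleRing.isOpen_integers u (H := fun a => ∏ᶠ v, h v (a v))
    (isCompact_preimage_unit_mul_sub (R := FiniteAdeleRing K)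
      FiniteAdeleRing.isCompact_integers w 0) (fun a ha => by
      have h0 (v) : h v (a v) ≠ 0 := fun h0 => ha (finprod_eq_zero _ v h0 (hmul a))
      simp only [mem_ofPred_eq, sub_zero]
      refine (hw a).2 ⟨fun v hv => ?_, fun v _ => hb v _ (h0 v)⟩
      have := h0 v
      rw [hnS v hv] at this
      exact mem_of_indicator_ne_zero this) (fun a y hy => by
      obtain ⟨h1, h2⟩ := (hu y).1 hy
      refine finprod_congr fun v => ?_
      rw [FiniteAdeleRing.add_apply]
      by_cases hv : v ∈ S
      · exact hd v _ _ (h2 v hv)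
      · rw [hnS v hv]
        have h3 : a v + y v ∈ (v.integers : Set v.Completion) ↔
            a v ∈ (v.integers : Set v.Completion) := add_mem_cancel_right (h1 v hv)
        simp only [indicator, h3, Pi.one_apply])
  exact ⟨u, s, _, hs⟩

section Span
open NumberField

variable [Fintype (InfinitePlace K)]

theorem IsPureTensor.exists_eq_sum
    {f : (∀ v : InfinitePlace K, v.Completion) × FiniteAdeleRing K → ℂ}
    (hf : IsPureTensor f) :
    ∃ (g : 𝓢(∀ v : InfinitePlace K, v.Completion, ℂ)) (u : (FiniteAdeleRing K)ˣ)
      (s : Finset (FiniteAdeleRing K)) (α : FiniteAdeleRing K → ℂ),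
      f = ∑ c ∈ s, α c • schwartzBox (FiniteAdeleRing.integers K) g u (u * c) := by
  obtain ⟨g, h, hg, hh, hO, hf⟩ := hf
  choose g' hg' using fun v => (hg v).exists_eq
  obtain ⟨G, hG⟩ := SchwartzMap.exists_pi g'
  obtain ⟨u, s, α, hs⟩ := exists_eq_sum_indicator_integers hh hO
  refine ⟨G, u, s, α, funext fun x => ?_⟩
  refine (hf x).trans ?_
  rw [Finset.sum_apply]
  have h1 : ∏ᶠ v, g v (x.1 v) = G x.1 := by
    rw [hG, finprod_eq_prod_of_fintype]
    exact Finset.prod_congr rfl fun v _ => by rw [hg']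
  have h2 := hs x.2
  refine (congrArg₂ (· * ·) h1 h2).trans ?_
  simp only [Finset.mul_sum]
  refine Finset.sum_congr rfl fun c _ => ?_
  simp only [Pi.smul_apply, smul_eq_mul, schwartzBox]
  ring

/-- Adelic Schwartz-Bruhat functions are linear combinations of the functions
`g ⊗ 1_O(u a - c)`. -/
theorem mem_span_schwartzBox {f : (∀ v : InfinitePlace K, v.Completion) × FiniteAdeleRing K → ℂ}
    (hf : (show AdeleRing K → ℂ from f) ∈ schwartzBruhat K) :
    f ∈ Submodule.span ℂ {f | ∃ (g : 𝓢(∀ v : InfinitePlace K, v.Completion, ℂ))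
      (u : (FiniteAdeleRing K)ˣ) (c : FiniteAdeleRing K),
      f = schwartzBox (FiniteAdeleRing.integers K) g u c} := by
  refine Submodule.span_induction (p := fun (f : AdeleRing K → ℂ) _ =>
    (show (∀ v : InfinitePlace K, v.Completion) × FiniteAdeleRing K → ℂ from f) ∈
      Submodule.span ℂ {f | ∃ (g : 𝓢(∀ v : InfinitePlace K, v.Completion, ℂ))
      (u : (FiniteAdeleRing K)ˣ) (c : FiniteAdeleRing K),
      f = schwartzBox (FiniteAdeleRing.integers K) g u c}) (fun f hf => ?_)
    (Submodule.zero_mem _) (fun f g _ _ hf hg => Submodule.add_mem _ hf hg)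
    (fun a f _ hf => Submodule.smul_mem _ a hf) hf
  obtain ⟨g, u, s, α, h⟩ := IsPureTensor.exists_eq_sum hf
  change f = _ at h
  rw [h]
  exact Submodule.sum_mem _ fun c _ =>
    Submodule.smul_mem _ _ (Submodule.subset_span ⟨g, u, u * c, rfl⟩)

end Span

end GlobalField

/-! ### The scaling of Haar measure by units -/

section Modulus

variable {A : Type*} [CommRing A] [TopologicalSpace A] [IsTopologicalRing A] [MeasurableSpace A]
  [BorelSpace A] {μ : Measure A}

/-- Multiplication by the unit `t` scales the measure `μ` by `r`. -/
def HasModulus (μ : Measure A) (t : Aˣ) (r : ℝ) : Prop :=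
  -- The pushforward evaluates `μ` on `S * t⁻¹`, hence the inverse of `r`.
  0 < r ∧ μ.map (fun x : A => x * (t : A)) = ENNReal.ofReal r⁻¹ • μ

theorem measurable_mul_unit (t : Aˣ) : Measurable fun x : A => x * (t : A) :=
  (continuous_mul_const (t : A)).measurable

theorem HasModulus.mul {t s : Aˣ} {r q : ℝ} (ht : HasModulus μ t r) (hs : HasModulus μ s q) :
    HasModulus μ (t * s) (r * q) := by
  refine ⟨mul_pos ht.1 hs.1, ?_⟩
  have : (fun x : A => x * ((t * s : Aˣ) : A)) =
      (fun x : A => x * (s : A)) ∘ fun x : A => x * (t : A) := by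
    funext x; simp [mul_assoc]
  rw [this, ← Measure.map_map (measurable_mul_unit s) (measurable_mul_unit t), ht.2,
    Measure.map_smul, hs.2, smul_smul, ← ENNReal.ofReal_mul (inv_nonneg.2 ht.1.le), mul_inv]

theorem HasModulus.one : HasModulus μ 1 1 := ⟨one_pos, by simp⟩

theorem HasModulus.inv {t : Aˣ} {r : ℝ} (ht : HasModulus μ t r) : HasModulus μ t⁻¹ r⁻¹ := by
  refine ⟨inv_pos.2 ht.1, ?_⟩
  have h1 : μ = ENNReal.ofReal r⁻¹ • μ.map (fun x : A => x * ((t⁻¹ : Aˣ) : A)) := by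
    rw [← Measure.map_smul, ← ht.2,
      Measure.map_map (measurable_mul_unit t⁻¹) (measurable_mul_unit t)]
    have : (fun x : A => x * ((t⁻¹ : Aˣ) : A)) ∘ (fun x : A => x * (t : A)) = id := by
      funext x; simp
    rw [this, Measure.map_id]
  conv_rhs => rw [h1]
  rw [smul_smul, ← ENNReal.ofReal_mul (by rw [inv_inv]; exact ht.1.le), inv_inv,
    mul_inv_cancel₀ ht.1.ne', ENNReal.ofReal_one, one_smul]

theorem HasModulus.pow {t : Aˣ} {r : ℝ} (ht : HasModulus μ t r) (n : ℕ) :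
    HasModulus μ (t ^ n) (r ^ n) := by
  induction n with
  | zero => simpa using HasModulus.one
  | succ n ih => simpa only [pow_succ] using ih.mul ht

theorem HasModulus.zpow {t : Aˣ} {r : ℝ} (ht : HasModulus μ t r) (n : ℤ) :
    HasModulus μ (t ^ n) (r ^ n) := by
  cases n with
  | ofNat n => simpa using ht.pow n
  | negSucc n => simpa using (ht.pow (n + 1)).inv

theorem HasModulus.integral_mul {t : Aˣ} {r : ℝ} (ht : HasModulus μ t r) (h : A → ℂ) :
    ∫ x, h (x * t) ∂μ = 1 / (r : ℂ) * ∫ x, h x ∂μ := by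
  have h1 := integral_map_equiv (μ := μ) (⟨Units.mulRight t, measurable_mul_unit t,
    measurable_mul_unit t⁻¹⟩ : A ≃ᵐ A) h
  refine h1.symm.trans ?_
  change ∫ x, h x ∂(μ.map fun x : A => x * (t : A)) = _
  rw [ht.2, integral_smul_measure, ENNReal.toReal_ofReal (inv_nonneg.2 ht.1.le),
    Complex.real_smul, Complex.ofReal_inv, one_div]

variable [LocallyCompactSpace A] [SigmaCompactSpace A] [μ.IsAddHaarMeasure]

/-- Uniqueness of Haar measure gives proportionality on relatively compact sets; σ-compactness
extends it to all measurable sets, so no regularity of `μ` is needed. -/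
theorem exists_map_mul_unit_eq_smul (t : Aˣ) :
    ∃ c : NNReal, μ.map (fun x : A => x * (t : A)) = c • μ := by
  have : (μ.map (fun x : A => x * (t : A))).IsAddHaarMeasure :=
    (AddAut.mulRight t).isAddHaarMeasure_map μ (continuous_mul_const (t : A))
      (continuous_mul_const ((t⁻¹ : Aˣ) : A))
  refine ⟨Measure.addHaarScalarFactor (μ.map (fun x : A => x * (t : A))) μ, Measure.ext fun S _ => ?_⟩
  have hS : S = ⋃ n, S ∩ closure (compactCovering A n) := by
    rw [← inter_iUnion, iUnion_eq_univ_iff.2 fun x =>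
      (exists_mem_compactCovering x).imp fun n hn => subset_closure hn, inter_univ]
  have hmono : Monotone fun n => S ∩ closure (compactCovering A n) := fun m n hmn =>
    inter_subset_inter_right _ (closure_mono (compactCovering_subset A hmn))
  rw [hS, hmono.measure_iUnion, hmono.measure_iUnion]
  refine iSup_congr fun n => ?_
  rw [Measure.smul_apply]
  refine Measure.measure_isAddInvariant_eq_smul_of_isCompact_closure _ μ ?_
  exact (isCompact_compactCovering A n).closure.of_isClosed_subset isClosed_closure
    (closure_minimal inter_subset_right isClosed_closure)

/-- The pushforward is a constant multiple of `μ`, so one test set of finite nonzero measure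
determines the constant. -/
theorem HasModulus.of_measure_preimage {t : Aˣ} {r : ℝ} (hr : 0 < r) {S : Set A}
    (hSm : MeasurableSet S) (hS0 : μ S ≠ 0) (hS : μ S ≠ ⊤)
    (h : μ ((fun x : A => x * (t : A)) ⁻¹' S) = ENNReal.ofReal r⁻¹ * μ S) : HasModulus μ t r := by
  obtain ⟨c, hc⟩ := exists_map_mul_unit_eq_smul (μ := μ) t
  refine ⟨hr, ?_⟩
  have h1 := congrArg (fun ν => ν S) hc
  simp only [Measure.map_apply (measurable_mul_unit t) hSm, Measure.smul_apply, h] at h1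
  rw [ENNReal.smul_def, smul_eq_mul] at h1
  rw [hc, (ENNReal.mul_left_inj hS0 hS).1 h1]
  rfl

end Modulus

/-! ### Moduli of the Archimedean and finite components -/

section ModulusProd

variable {ι : Type*} [Fintype ι] {V : ι → Type*} [∀ i, NormedField (V i)]
  [∀ i, NormedAlgebra ℝ (V i)] [∀ i, FiniteDimensional ℝ (V i)] [∀ i, MeasurableSpace (V i)]
  [∀ i, BorelSpace (V i)] [∀ i, ProperSpace (V i)]

theorem addHaar_pi_preimage_mul_closedBall (ν : Measure (∀ i, V i)) [ν.IsAddHaarMeasure]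
    {t : ∀ i, V i} (ht : ∀ i, t i ≠ 0) :
    ν ((fun x : ∀ i, V i => x * t) ⁻¹' Metric.closedBall 0 1) =
      ENNReal.ofReal (∏ i, ‖t i‖ ^ Module.finrank ℝ (V i))⁻¹ * ν (Metric.closedBall 0 1) := by
  let π : Measure (∀ i, V i) := Measure.pi fun i => Measure.addHaar
  have hν : ν = Measure.addHaarScalarFactor ν π • π := Measure.isAddLeftInvariant_eq_smul ν π
  have h1 : (fun x : ∀ i, V i => x * t) ⁻¹' Metric.closedBall (0 : ∀ i, V i) 1 =
      Set.pi univ fun i => Metric.closedBall 0 ‖t i‖⁻¹ := by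
    ext x
    rw [mem_preimage, closedBall_pi _ zero_le_one]
    simp only [mem_univ_pi, Pi.mul_apply, Pi.zero_apply, mem_closedBall_zero_iff, norm_mul]
    refine forall_congr' fun i => ?_
    rw [← le_div_iff₀ (norm_pos_iff.2 (ht i)), one_div]
  suffices h : π ((fun x : ∀ i, V i => x * t) ⁻¹' Metric.closedBall 0 1) =
      ENNReal.ofReal (∏ i, ‖t i‖ ^ Module.finrank ℝ (V i))⁻¹ * π (Metric.closedBall 0 1) by
    rw [hν, Measure.smul_apply, Measure.smul_apply, h, ENNReal.smul_def, smul_eq_mul,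
      ENNReal.smul_def, smul_eq_mul, mul_left_comm]
  rw [h1, closedBall_pi _ zero_le_one, Measure.pi_pi, Measure.pi_pi, ← Finset.prod_inv_distrib,
    ENNReal.ofReal_prod_of_nonneg fun i _ => by positivity, ← Finset.prod_mul_distrib]
  refine Finset.prod_congr rfl fun i _ => ?_
  rw [Measure.addHaar_closedBall' _ _ (inv_nonneg.2 (norm_nonneg _)), inv_pow, Pi.zero_apply]

variable {R : Type*} [CommRing R] [TopologicalSpace R] [IsTopologicalRing R] [T2Space R]
  [LocallyCompactSpace R] {O : AddSubgroup R} [MeasurableSpace ((∀ i, V i) × R)]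
  [BorelSpace ((∀ i, V i) × R)] {μ : Measure ((∀ i, V i) × R)} [μ.IsAddHaarMeasure]

theorem measurableSet_closedBall_prod (hOo : IsOpen (O : Set R)) :
    MeasurableSet (Metric.closedBall (0 : ∀ i, V i) 1 ×ˢ (O : Set R)) :=
  (Metric.isClosed_closedBall.prod (O.isClosed_of_isOpen hOo)).measurableSet

theorem measure_closedBall_prod_ne_zero (hOo : IsOpen (O : Set R)) :
    μ (Metric.closedBall (0 : ∀ i, V i) 1 ×ˢ (O : Set R)) ≠ 0 := by
  have h := ((Metric.isOpen_ball (x := (0 : ∀ i, V i)) (ε := 1)).prod hOo).measure_pos μ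
    ⟨0, Metric.mem_ball_self one_pos, O.zero_mem⟩
  exact (h.trans_le (measure_mono (prod_mono Metric.ball_subset_closedBall subset_rfl))).ne'

theorem measure_closedBall_prod_ne_top (hOc : IsCompact (O : Set R)) :
    μ (Metric.closedBall (0 : ∀ i, V i) 1 ×ˢ (O : Set R)) ≠ ⊤ :=
  ((isCompact_closedBall _ _).prod hOc).measure_ne_top

/-- The test set is the unit polydisc times `O`. Its preimage has polyradii `‖t i‖⁻¹`, and slicing
along `O` reduces the comparison to Haar measure on the Archimedean factor. -/
theorem hasModulus_of_snd_eq_one [SigmaCompactSpace ((∀ i, V i) × R)] (hOo : IsOpen (O : Set R))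
    (hOc : IsCompact (O : Set R)) {t : ((∀ i, V i) × R)ˣ} (ht : t.1.2 = 1)
    (ht0 : ∀ i, t.1.1 i ≠ 0) :
    HasModulus μ t (∏ i, ‖t.1.1 i‖ ^ Module.finrank ℝ (V i)) := by
  obtain ⟨c, hc⟩ := exists_map_fst_restrict_eq_smul μ hOc
  have h1 (W : Set (∀ i, V i)) (hW : MeasurableSet W) :
      μ (W ×ˢ (O : Set R)) = c * Measure.addHaar W := by
    have h2 := congrArg (fun ν => ν W) hc
    have hm : Measurable (Prod.fst : (∀ i, V i) × R → (∀ i, V i)) := continuous_fst.measurable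
    simp only [Measure.map_apply hm hW, Measure.restrict_apply (hm hW), Measure.smul_apply] at h2
    have h3 : W ×ˢ (O : Set R) = Prod.fst ⁻¹' W ∩ univ ×ˢ (O : Set R) := by ext x; simp
    rw [h3]
    exact h2
  refine HasModulus.of_measure_preimage
    (Finset.prod_pos fun i _ => pow_pos (norm_pos_iff.2 (ht0 i)) _)
    (measurableSet_closedBall_prod hOo) (measure_closedBall_prod_ne_zero hOo)
    (measure_closedBall_prod_ne_top hOc) ?_
  have h2 : (fun x : (∀ i, V i) × R => x * (t : (∀ i, V i) × R)) ⁻¹'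
      (Metric.closedBall (0 : ∀ i, V i) 1 ×ˢ (O : Set R)) =
      ((fun x => x * t.1.1) ⁻¹' Metric.closedBall 0 1) ×ˢ (O : Set R) := by
    ext x
    simp only [mem_preimage, mem_prod, Prod.fst_mul, Prod.snd_mul, ht, mul_one]
  rw [h2, h1 _ Metric.isClosed_closedBall.measurableSet,
    h1 _ (Metric.isClosed_closedBall.preimage (continuous_mul_const _)).measurableSet,
    addHaar_pi_preimage_mul_closedBall _ ht0, mul_left_comm]

end ModulusProd

section ModulusProd

variable {ι : Type*} [Fintype ι] {V : ι → Type*} [∀ i, NormedField (V i)]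
  [∀ i, NormedAlgebra ℝ (V i)] [∀ i, FiniteDimensional ℝ (V i)] [∀ i, MeasurableSpace (V i)]
  [∀ i, BorelSpace (V i)] [∀ i, ProperSpace (V i)]

variable {R : Type*} [CommRing R] [TopologicalSpace R] [IsTopologicalRing R] [T2Space R]
  [LocallyCompactSpace R] {O : AddSubgroup R} [MeasurableSpace ((∀ i, V i) × R)]
  [BorelSpace ((∀ i, V i) × R)] {μ : Measure ((∀ i, V i) × R)} [μ.IsAddHaarMeasure]

/-- If `O` is the disjoint union of `n` translates of `O t⁻¹`, then `t` has modulus `n`. -/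
theorem hasModulus_of_fst_eq_one [SigmaCompactSpace ((∀ i, V i) × R)] (hOo : IsOpen (O : Set R))
    (hOc : IsCompact (O : Set R)) {t : ((∀ i, V i) × R)ˣ} (ht : t.1.1 = 1) {κ : Type*} [Finite κ]
    (c : κ → R) (hc : ∀ a, a ∈ O ↔ ∃ k, (a - c k) * t.1.2 ∈ O)
    (huniq : ∀ a k l, (a - c k) * t.1.2 ∈ O → (a - c l) * t.1.2 ∈ O → k = l) :
    HasModulus μ t (Nat.card κ) := by
  have := Fintype.ofFinite κ
  rw [Nat.card_eq_fintype_card]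
  obtain ⟨k₀, -⟩ := (hc 0).1 O.zero_mem
  have hcard : (0 : ℝ) < Fintype.card κ := by
    exact_mod_cast Fintype.card_pos_iff.2 ⟨k₀⟩
  have hS := measurableSet_closedBall_prod (V := V) hOo
  set S := Metric.closedBall (0 : ∀ i, V i) 1 ×ˢ (O : Set R) with hSdef
  set P := (fun x : (∀ i, V i) × R => x * (t : (∀ i, V i) × R)) ⁻¹' S with hP
  have hPm : MeasurableSet P := measurable_mul_unit t hS
  have hmem (k : κ) (x : (∀ i, V i) × R) : x ∈ (fun x => x + (0, -c k)) ⁻¹' P ↔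
      x.1 ∈ Metric.closedBall (0 : ∀ i, V i) 1 ∧ (x.2 - c k) * t.1.2 ∈ O := by
    simp only [hP, hSdef, mem_preimage, mem_prod, Prod.fst_mul, Prod.snd_mul, Prod.fst_add,
      Prod.snd_add, ht, mul_one, add_zero, sub_eq_add_neg, SetLike.mem_coe]
  -- `P` is `S * t⁻¹`. By hypothesis `S` is the union of its translates by the `c k`, disjoint by
  -- `huniq`, so `μ S` is the cardinality times `μ P`.
  have h1 : S = ⋃ k, (fun x => x + (0, -c k)) ⁻¹' P := by
    ext x
    simp only [mem_iUnion, hmem, exists_and_left, ← hc]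
    rfl
  have h2 : μ S = Fintype.card κ * μ P := by
    conv_lhs => rw [h1]
    rw [measure_iUnion _ fun k => (continuous_add_const _).measurable hPm, tsum_fintype]
    · simp [measure_preimage_add_right]
    · refine fun k l hkl => Set.disjoint_left.2 fun x hk hl => hkl ?_
      exact huniq _ _ _ ((hmem k x).1 hk).2 ((hmem l x).1 hl).2
  refine HasModulus.of_measure_preimage hcard hS (measure_closedBall_prod_ne_zero hOo)
    (measure_closedBall_prod_ne_top hOc) ?_
  change μ P = _
  rw [h2, ← mul_assoc, ENNReal.ofReal_inv_of_pos hcard, ENNReal.ofReal_natCast,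
    ENNReal.inv_mul_cancel, one_mul]
  · exact_mod_cast hcard.ne'
  · exact ENNReal.natCast_ne_top _

end ModulusProd

/-! ### The modulus of an idele -/

namespace GlobalField

variable {K : Type*} [Field K]

namespace FiniteAdeleRing

/-- The component at `v`, as a homomorphism. -/
def component (v : FinitePlace K) : FiniteAdeleRing K →* v.Completion where
  toFun a := a v
  map_one' := rfl
  map_mul' _ _ := rfl

theorem unit_zpow_apply (u : (FiniteAdeleRing K)ˣ) (n : ℤ) (v : FinitePlace K) :
    (u ^ n).1 v = u.1 v ^ n := by
  have h := congrArg Units.val (map_zpow (Units.map (component v)) u n)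
  rw [Units.val_zpow_eq_zpow_val] at h
  exact h

/-- The finite idele that is a uniformizer at `v` and `1` elsewhere. -/
theorem exists_uniformizer_unit (v : FinitePlace K) : ∃ u : (FiniteAdeleRing K)ˣ,
    Valued.v (u.1 v) = WithZero.exp (-1 : ℤ) ∧ ∀ w ≠ v, u.1 w = 1 := by
  classical
  obtain ⟨π, hπ0, hπ⟩ := v.exists_completion_uniformizer
  have h1 (w) (hw : w ≠ v) : (Pi.mulSingle v π : ∀ w : FinitePlace K, w.Completion) w = 1 :=
    Pi.mulSingle_eq_of_ne hw _
  have h2 : (Pi.mulSingle v π : ∀ w : FinitePlace K, w.Completion) v = π := Pi.mulSingle_eq_same _ _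
  obtain ⟨u, hu⟩ := exists_unit K (Pi.mulSingle v π) (fun w => by
      by_cases hw : w = v
      · subst hw; rwa [h2]
      · rw [h1 w hw]; exact one_ne_zero)
    ((finite_singleton v).subset fun w hw => by
      by_contra h
      exact hw (by rw [h1 w h, map_one]))
  exact ⟨u, by rw [hu, h2, hπ], fun w hw => by rw [hu, h1 w hw]⟩

end FiniteAdeleRing

section Modulus

variable [IsGlobalField K] {ι : Type*} [Fintype ι] {V : ι → Type*} [∀ i, NormedField (V i)]
  [∀ i, NormedAlgebra ℝ (V i)] [∀ i, FiniteDimensional ℝ (V i)] [∀ i, MeasurableSpace (V i)]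
  [∀ i, BorelSpace (V i)] [∀ i, ProperSpace (V i)]
  [MeasurableSpace ((∀ i, V i) × FiniteAdeleRing K)]
  [BorelSpace ((∀ i, V i) × FiniteAdeleRing K)]
  [SigmaCompactSpace ((∀ i, V i) × FiniteAdeleRing K)]
  {μ : Measure ((∀ i, V i) × FiniteAdeleRing K)} [μ.IsAddHaarMeasure]

/-- A finite idele as an element of the product. -/
noncomputable def finiteUnit (V : ι → Type*) [∀ i, NormedField (V i)] :
    (FiniteAdeleRing K)ˣ →* ((∀ i, V i) × FiniteAdeleRing K)ˣ where
  toFun u := MulEquiv.prodUnits.symm (1, u)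
  map_one' := rfl
  map_mul' u w := by rw [← map_mul, Prod.mk_mul_mk, one_mul]

theorem hasModulus_finiteUnit_of_valued_eq_one {u : (FiniteAdeleRing K)ˣ}
    (hu : ∀ v, Valued.v (u.1 v) = 1) : HasModulus μ (finiteUnit V u) 1 := by
  have h (a : FiniteAdeleRing K) : a * u.1 ∈ FiniteAdeleRing.integers K ↔
      a ∈ FiniteAdeleRing.integers K := by
    refine forall_congr' fun v => ?_
    rw [FiniteAdeleRing.mul_apply, v.mem_integers, v.mem_integers, map_mul, hu, mul_one]
  have := hasModulus_of_fst_eq_one (V := V) (μ := μ) (t := finiteUnit V u)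
    FiniteAdeleRing.isOpen_integers FiniteAdeleRing.isCompact_integers rfl (κ := Unit) (fun _ => 0)
    (fun a => by
      rw [sub_zero]
      exact (h a).symm.trans ⟨fun h => ⟨(), h⟩, fun ⟨_, h⟩ => h⟩) (fun _ _ _ _ _ => rfl)
  simpa using this

theorem hasModulus_finiteUnit_uniformizer {v : FinitePlace K} {u : (FiniteAdeleRing K)ˣ}
    (huv : Valued.v (u.1 v) = WithZero.exp (-1 : ℤ)) (hu : ∀ w ≠ v, u.1 w = 1) :
    HasModulus μ (finiteUnit V u) (Nat.card (IsLocalRing.ResidueField v.1) : ℝ)⁻¹ := by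
  classical
  choose r hr using IsLocalRing.residue_surjective (R := v.1)
  have hint (k) (w : FinitePlace K) : (Pi.single v (algebraMap K v.Completion (r k)) :
      ∀ w : FinitePlace K, w.Completion) w ∈ w.integers := by
    by_cases hw : w = v
    · subst hw
      rw [Pi.single_eq_same, w.mem_integers, FinitePlace.valued_algebraMap]
      exact (FinitePlace.valuation_le_one_iff w _).2 (r k).2
    · rw [Pi.single_eq_of_ne hw]
      exact w.integers.zero_mem
  let c (k : IsLocalRing.ResidueField v.1) : FiniteAdeleRing K :=
    ⟨Pi.single v (algebraMap K v.Completion (r k)), Eventually.of_forall (hint k)⟩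
  have hcv (k) : c k v = algebraMap K v.Completion (r k) :=
    Pi.single_eq_same (M := fun w : FinitePlace K => w.Completion) v _
  have hcw (k) (w : FinitePlace K) (hw : w ≠ v) : c k w = 0 :=
    Pi.single_eq_of_ne (M := fun w : FinitePlace K => w.Completion) hw _
  have hmem (k) (a : FiniteAdeleRing K) :
      (a - c k) * u⁻¹.1 ∈ FiniteAdeleRing.integers K ↔ a ∈ FiniteAdeleRing.integers K ∧
        Valued.v (a v - algebraMap K v.Completion (r k)) < 1 := by
    have hv : ((a - c k) * u⁻¹.1) v ∈ v.integers ↔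
        Valued.v (a v - algebraMap K v.Completion (r k)) < 1 := by
      rw [FiniteAdeleRing.mul_apply, FiniteAdeleRing.unit_inv_apply, FiniteAdeleRing.sub_apply, hcv,
        v.mem_integers, map_mul, map_inv₀, huv]
      rw [mul_inv_le_iff₀ (zero_lt_iff.2 WithZero.exp_ne_zero), one_mul]
      constructor
      · exact fun h => h.trans_lt FinitePlace.exp_neg_one_lt_one
      · intro h
        by_cases h0 : Valued.v (a v - algebraMap K v.Completion (r k)) = 0
        · rw [h0]; exact zero_le
        · rw [← WithZero.exp_log h0, ← WithZero.exp_zero, WithZero.exp_lt_exp] at h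
          rw [← WithZero.exp_log h0, WithZero.exp_le_exp]
          omega
    have hw (w) (hw : w ≠ v) : ((a - c k) * u⁻¹.1) w ∈ w.integers ↔ a w ∈ w.integers := by
      rw [FiniteAdeleRing.mul_apply, FiniteAdeleRing.unit_inv_apply, hu w hw, inv_one, mul_one,
        FiniteAdeleRing.sub_apply, hcw k w hw, sub_zero]
    constructor
    · intro h
      have h1 := hv.1 (h v)
      refine ⟨fun w => ?_, h1⟩
      by_cases hwv : w = v
      · subst hwv
        have h2 := w.integers.add_mem _ _ (w.mem_integers.2 h1.le) (hint k w)
        rw [Pi.single_eq_same, sub_add_cancel] at h2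
        exact h2
      · exact (hw w hwv).1 (h w)
    · intro h w
      by_cases hwv : w = v
      · subst hwv
        exact hv.2 h.2
      · exact (hw w hwv).2 (h.1 w)
  -- `O_v` is the disjoint union of `q_v` cosets of its maximal ideal, so `u⁻¹` has modulus `q_v`;
  -- the claim follows by inversion.
  have key : HasModulus μ (finiteUnit V u⁻¹) (Nat.card (IsLocalRing.ResidueField v.1)) := by
    refine hasModulus_of_fst_eq_one FiniteAdeleRing.isOpen_integers
      FiniteAdeleRing.isCompact_integers rfl c (fun a => ?_) fun a k l hk hl => ?_
    · change _ ↔ ∃ k, (a - c k) * u⁻¹.1 ∈ FiniteAdeleRing.integers K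
      simp only [hmem, exists_and_left, iff_self_and]
      exact fun h => (v.existsUnique_residue hr (h v)).exists
    · have hk := (hmem k a).1 hk
      exact (v.existsUnique_residue hr (hk.1 v)).unique hk.2 ((hmem l a).1 hl).2
  simpa using key.inv

theorem FinitePlace.absValue_of_ne_zero (v : FinitePlace K) {x : v.Completion} (hx : x ≠ 0) :
    v.absValue x = (Nat.card (IsLocalRing.ResidueField v.1) : ℝ) ^ WithZero.log (Valued.v x) :=
  if_neg hx

theorem FinitePlace.absValue_of_valued_eq_one (v : FinitePlace K) {x : v.Completion}
    (hx : Valued.v x = 1) : v.absValue x = 1 := by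
  rw [v.absValue_of_ne_zero fun h => by simp [h] at hx, hx, WithZero.log_one, zpow_zero]

/-- Induction on `S`: a power of the uniformizer idele at `v` makes the `v`-component a unit without
changing the others, and moduli multiply. -/
theorem hasModulus_finiteUnit_prod (S : Finset (FinitePlace K)) (u : (FiniteAdeleRing K)ˣ)
    (hu : ∀ v ∉ S, Valued.v (u.1 v) = 1) :
    HasModulus μ (finiteUnit V u) (∏ v ∈ S, v.absValue (u.1 v)) := by
  classical
  induction S using Finset.induction_on generalizing u with
  | empty => simpa using hasModulus_finiteUnit_of_valued_eq_one fun v => hu v (Finset.notMem_empty v)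
  | insert v S hv ih =>
    obtain ⟨ϖ, hϖv, hϖ⟩ := FiniteAdeleRing.exists_uniformizer_unit v
    set n := WithZero.log (Valued.v (u.1 v)) with hn
    have hun : Valued.v (u.1 v) = WithZero.exp n :=
      (WithZero.exp_log (by simpa using FiniteAdeleRing.unit_apply_ne_zero u v)).symm
    have h1 (w) (hw : w ≠ v) : (u * ϖ ^ n).1 w = u.1 w := by
      rw [Units.val_mul, FiniteAdeleRing.mul_apply, FiniteAdeleRing.unit_zpow_apply, hϖ w hw,
        one_zpow, mul_one]
    have h2 : Valued.v ((u * ϖ ^ n).1 v) = 1 := by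
      rw [Units.val_mul, FiniteAdeleRing.mul_apply, FiniteAdeleRing.unit_zpow_apply, map_mul,
        map_zpow₀, hϖv, hun, ← WithZero.exp_zsmul, ← WithZero.exp_add]
      simp
    have h3 := (ih (u * ϖ ^ n) fun w hw => by
      by_cases hwv : w = v
      · subst hwv; exact h2
      · rw [h1 w hwv]
        exact hu w (by simp [hwv, hw])).mul
      ((hasModulus_finiteUnit_uniformizer (V := V) (μ := μ) hϖv hϖ).zpow (-n))
    rw [← map_zpow, ← map_mul, mul_assoc, ← zpow_add, add_neg_cancel, zpow_zero, mul_one,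
      inv_zpow, zpow_neg, inv_inv] at h3
    rw [Finset.prod_insert hv, mul_comm,
      v.absValue_of_ne_zero (FiniteAdeleRing.unit_apply_ne_zero u v), ← hn,
      Finset.prod_congr rfl fun w hw =>
        congrArg w.absValue (h1 w fun h => hv (h ▸ hw)).symm]
    exact h3

theorem hasModulus_finiteUnit (u : (FiniteAdeleRing K)ˣ) :
    HasModulus μ (finiteUnit V u) (∏ᶠ v : FinitePlace K, v.absValue (u.1 v)) := by
  have hS := FiniteAdeleRing.finite_valued_unit_ne_one u
  rw [finprod_eq_prod_of_mulSupport_subset (s := hS.toFinset) _ fun v hv => by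
    rw [Finite.coe_toFinset]
    exact fun h => hv (v.absValue_of_valued_eq_one h)]
  exact hasModulus_finiteUnit_prod _ u fun v hv => by simpa using hv

theorem hasModulus_prod (t : ((∀ i, V i) × FiniteAdeleRing K)ˣ) :
    HasModulus μ t ((∏ i, ‖t.1.1 i‖ ^ Module.finrank ℝ (V i)) *
      ∏ᶠ v : FinitePlace K, v.absValue (t.1.2 v)) := by
  set p := MulEquiv.prodUnits t with hp
  have h1 := hasModulus_of_snd_eq_one (μ := μ) FiniteAdeleRing.isOpen_integers
    FiniteAdeleRing.isCompact_integers (t := MulEquiv.prodUnits.symm (p.1, 1)) rfl fun i hi => by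
      have := congrFun p.1.mul_inv i
      rw [Pi.mul_apply, show p.1.1 i = 0 from hi, zero_mul] at this
      exact zero_ne_one this
  have h2 := h1.mul (hasModulus_finiteUnit (V := V) (μ := μ) p.2)
  have h3 : MulEquiv.prodUnits.symm (p.1, 1) * finiteUnit V p.2 = t := by
    change MulEquiv.prodUnits.symm (p.1, 1) * MulEquiv.prodUnits.symm (1, p.2) = t
    rw [← map_mul, Prod.mk_mul_mk, mul_one, one_mul]
    exact MulEquiv.symm_apply_apply _ _
  rw [h3] at h2
  exact h2

end Modulus

end GlobalField

/-! ### Test functions and the assembly of the adelic statement -/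

namespace GlobalField
open NumberField
open scoped SchwartzMap

variable {K : Type*} [Field K] [IsGlobalField K]

theorem FinitePlace.isSchwartzBruhat_indicator (v : FinitePlace K) {z : v.Completion}
    (hz : z ≠ 0) : IsSchwartzBruhat v ({y | z * y ∈ v.integers}.indicator 1) := by
  have hcont : Continuous fun y : v.Completion => z * y := continuous_const_mul z
  have hclosed : IsClosed (v.integers : Set v.Completion) := v.isCompact_integers.isClosed
  have hclopen : IsClopen {y : v.Completion | z * y ∈ v.integers} :=
    ⟨hclosed.preimage hcont, v.isOpen_integers.preimage hcont⟩
  refine ⟨(LocallyConstant.charFn ℂ hclopen).isLocallyConstant, ?_⟩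
  have hcomp : IsCompact {y : v.Completion | z * y ∈ v.integers} := by
    have h := v.isCompact_integers.image (continuous_const_mul z⁻¹)
    refine h.of_isClosed_subset hclopen.1 fun y hy => ⟨z * y, hy, ?_⟩
    exact inv_mul_cancel_left₀ hz y
  exact HasCompactSupport.intro hcomp fun y hy => indicator_of_notMem hy _

theorem finprod_indicator_mul_mem (u : (FiniteAdeleRing K)ˣ) (a : FiniteAdeleRing K) :
    ∏ᶠ v : FinitePlace K, {y | u.1 v * y ∈ v.integers}.indicator (1 : v.Completion → ℂ) (a v) =
      (FiniteAdeleRing.integers K : Set (FiniteAdeleRing K)).indicator 1 (u.1 * a) := by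
  have hmem (v : FinitePlace K) : a v ∈ {y | u.1 v * y ∈ v.integers} ↔
      (u.1 * a) v ∈ v.integers := Iff.rfl
  by_cases hx : u.1 * a ∈ FiniteAdeleRing.integers K
  · rw [indicator_of_mem (by exact hx), Pi.one_apply]
    exact finprod_eq_one_of_forall_eq_one fun v => indicator_of_mem ((hmem v).2 (hx v)) _
  · rw [indicator_of_notMem (by exact hx)]
    obtain ⟨v, hv⟩ := not_forall.1 hx
    refine finprod_eq_zero _ v (indicator_of_notMem (fun h => hv ((hmem v).1 h)) _) ?_
    refine (FiniteAdeleRing.finite_not_mem_integers (u.1 * a)).subset fun w hw h => hw ?_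
    exact indicator_of_mem ((hmem w).2 h) _

theorem mem_schwartzBruhat_of_isSchwartz {b : ∀ v : InfinitePlace K, v.Completion → ℂ}
    (hb : ∀ v, IsSchwartz v (b v)) (u : (FiniteAdeleRing K)ˣ) :
    (fun x : AdeleRing K => (∏ᶠ v, b v (x.1 v)) *
      (FiniteAdeleRing.integers K : Set (FiniteAdeleRing K)).indicator 1 (u.1 * x.2)) ∈
      schwartzBruhat K := by
  have hS (v : FinitePlace K) (hv : Valued.v (u.1 v) = 1) :
      {y | u.1 v * y ∈ v.integers} = (v.integers : Set v.Completion) := by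
    ext y
    simp only [mem_ofPred_eq, v.mem_integers, map_mul, hv, one_mul, SetLike.mem_coe]
  refine Submodule.subset_span ⟨b, fun v => {y | u.1 v * y ∈ v.integers}.indicator 1, hb,
    fun v => v.isSchwartzBruhat_indicator (FiniteAdeleRing.unit_apply_ne_zero u v),
    (FiniteAdeleRing.finite_valued_unit_ne_one u).subset fun v hv h => hv (by
      simp only [mem_ofPred_eq, hS v h]), fun x => ?_⟩
  exact congrArg (_ * ·) (finprod_indicator_mul_mem u x.2).symm

/-- This feeds the nondegeneracy of `ψ`. The function is `1` at `0` and `0` at `x`: a narrow bump at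
an Archimedean place with `x.1 v ≠ 0`, or else a small box at a finite place. -/
theorem exists_mem_schwartzBruhat_ne {x : AdeleRing K} (hx : x ≠ 0) :
    ∃ f ∈ schwartzBruhat K, f x ≠ f 0 := by
  classical
  have := finite_infinitePlace K
  have := Fintype.ofFinite (InfinitePlace K)
  have hone (b : ∀ v : InfinitePlace K, v.Completion → ℝ) (hb : ∀ v, b v 0 = 1)
      (u : (FiniteAdeleRing K)ˣ) : (∏ᶠ v, (b v ((0 : AdeleRing K).1 v) : ℂ)) *
      (FiniteAdeleRing.integers K : Set (FiniteAdeleRing K)).indicator (1 : FiniteAdeleRing K → ℂ)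
        (u.1 * (0 : AdeleRing K).2) = 1 := by
    have h1 (v : InfinitePlace K) : ((b v ((0 : AdeleRing K).1 v) : ℝ) : ℂ) = 1 := by
      have := hb v
      exact_mod_cast this
    rw [finprod_eq_one_of_forall_eq_one h1, one_mul]
    have h2 : u.1 * (0 : AdeleRing K).2 = 0 := mul_zero _
    rw [h2, indicator_of_mem (FiniteAdeleRing.integers K).zero_mem, Pi.one_apply]
  by_cases h : ∃ v, x.1 v ≠ 0
  · obtain ⟨v, hv⟩ := h
    choose b hb hb0 hb1 hbn hbr using fun w : InfinitePlace K =>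
      exists_isSchwartz_bump w (show 0 < if x.1 w = 0 then 1 else ‖x.1 w‖ by
        split_ifs with h
        · exact one_pos
        · exact norm_pos_iff.2 h)
    refine ⟨_, mem_schwartzBruhat_of_isSchwartz hb 1, ?_⟩
    rw [hone b hb1, finprod_eq_zero _ v, zero_mul]
    · exact zero_ne_one
    · rw [hbr v _ (by rw [if_neg hv]), Complex.ofReal_zero]
    · exact Set.toFinite _
  · choose b hb hb0 hb1 hbn hbr using fun w : InfinitePlace K =>
      exists_isSchwartz_bump w one_pos
    obtain ⟨v, hv⟩ : ∃ v, x.2 v ≠ 0 := by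
      by_contra! h2
      exact hx (Prod.ext (funext fun v => not_not.1 fun h1 => h ⟨v, h1⟩)
        (FiniteAdeleRing.ext h2))
    obtain ⟨ϖ, hϖ, -⟩ := FiniteAdeleRing.exists_uniformizer_unit v
    -- With this `n` the element `ϖ ^ n * x` has value `exp 1` at `v`, just outside `O_v`.
    set n := WithZero.log (Valued.v (x.2 v)) - 1 with hn
    refine ⟨_, mem_schwartzBruhat_of_isSchwartz hb (ϖ ^ n), ?_⟩
    rw [hone b hb1, indicator_of_notMem, mul_zero]
    · exact zero_ne_one
    · intro hmem
      have h3 : Valued.v (((ϖ ^ n).1 * x.2) v) ≤ 1 := hmem v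
      rw [FiniteAdeleRing.mul_apply, FiniteAdeleRing.unit_zpow_apply, map_mul, map_zpow₀, hϖ,
        ← WithZero.exp_zsmul, ← WithZero.exp_log (show Valued.v (x.2 v) ≠ 0 by simpa using hv),
        ← WithZero.exp_add, ← WithZero.exp_zero, WithZero.exp_le_exp, hn] at h3
      simp at h3

variable (K) in
-- The adele ring is the union of the countably many translates by `K` of a compact set.
theorem sigmaCompactSpace_adeleRing : SigmaCompactSpace (AdeleRing K) := by
  have := countable K
  obtain ⟨C, hC, hKC⟩ := exists_isCompact_forall_exists_add_mem K
  refine isSigmaCompact_univ_iff.1 ?_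
  have h : (univ : Set (AdeleRing K)) =
      ⋃ k : K, (fun a => -algebraMap K (AdeleRing K) k + a) '' C := by
    refine (eq_univ_of_forall fun a => ?_).symm
    obtain ⟨k, hk⟩ := hKC a
    exact mem_iUnion.2 ⟨k, _, hk, neg_add_cancel_left _ _⟩
  rw [h]
  exact isSigmaCompact_iUnion_of_isCompact _ fun k => hC.image (continuous_const_add _)

theorem hasModulus_ideleNorm (μ : Measure (AdeleRing K)) [μ.IsAddHaarMeasure] (x : IdeleGroup K) :
    HasModulus μ x (ideleNorm x) := by
  have := finite_infinitePlace K
  have := Fintype.ofFinite (InfinitePlace K)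
  -- The same ring presented as an explicit product, whose Archimedean factor carries the sup norm.
  let A := (∀ v : InfinitePlace K, v.Completion) × FiniteAdeleRing K
  have hσ : SigmaCompactSpace A := sigmaCompactSpace_adeleRing K
  let _ : MeasurableSpace A := borel A
  have : BorelSpace A := ⟨rfl⟩
  let μ' : Measure A := μ
  have : μ'.IsAddHaarMeasure := ‹μ.IsAddHaarMeasure›
  have h : HasModulus μ' x _ := hasModulus_prod (V := fun v : InfinitePlace K => v.Completion) x
  simp only [finrank_completion] at h
  rw [ideleNorm, finprod_eq_prod_of_fintype]
  exact h

end GlobalField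

theorem mainTheorem2 (K : Type*) [Field K] [GlobalField.IsGlobalField K]
    (ψ : AddChar (GlobalField.AdeleRing K) Circle) (hψ_cont : Continuous ψ) (hψ_ne : ψ ≠ 1)
    (hψ_K : ∀ γ : K, ψ (algebraMap K (GlobalField.AdeleRing K) γ) = 1)
    (μ : MeasureTheory.Measure (GlobalField.AdeleRing K)) [μ.IsAddHaarMeasure]
    (hμ : GlobalField.IsSelfDual ψ μ)
    (f : GlobalField.AdeleRing K → ℂ) (hf : f ∈ GlobalField.schwartzBruhat K)
    (x : GlobalField.IdeleGroup K) :
    Summable (fun γ : K => f (algebraMap K (GlobalField.AdeleRing K) γ * x)) ∧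
    Summable (fun γ : K => GlobalField.fourier ψ μ f
      (algebraMap K (GlobalField.AdeleRing K) γ * ((x⁻¹ : GlobalField.IdeleGroup K) :
        GlobalField.AdeleRing K))) ∧
    ∑' γ : K, f (algebraMap K (GlobalField.AdeleRing K) γ * x) =
      1 / (GlobalField.ideleNorm x : ℂ) *
        ∑' γ : K, GlobalField.fourier ψ μ f
          (algebraMap K (GlobalField.AdeleRing K) γ * ((x⁻¹ : GlobalField.IdeleGroup K) :
            GlobalField.AdeleRing K)) := by
  have := GlobalField.finite_infinitePlace K
  have := Fintype.ofFinite (NumberField.InfinitePlace K)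
  have := GlobalField.countable K
  have := GlobalField.infinite K
  obtain ⟨C, hC, hKC⟩ := GlobalField.exists_isCompact_forall_exists_add_mem K
  -- The product of these even bumps, tensored with the indicator of the integral finite adeles, is
  -- the test function that yields compactness of the annihilator and covolume `1`.
  choose b hb hb0 hb1 hbn hbr using fun v : NumberField.InfinitePlace K =>
    GlobalField.exists_isSchwartz_bump v one_pos
  choose g hg using fun v => (hb v).exists_eq
  obtain ⟨g₀, hg₀⟩ := SchwartzMap.exists_pi g
  have hp₀ (y) : g₀ y = ((∏ v, b v (y v) : ℝ) : ℂ) := by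
    rw [hg₀, Complex.ofReal_prod]
    exact Finset.prod_congr rfl fun v _ => (congrFun (hg v) (y v)).symm
  have hbox : schwartzBox (GlobalField.FiniteAdeleRing.integers K) g₀ 1 0 =
      fun y : GlobalField.AdeleRing K => (∏ᶠ v, (b v (y.1 v) : ℂ)) *
      (GlobalField.FiniteAdeleRing.integers K : Set (GlobalField.FiniteAdeleRing K)).indicator 1
        ((1 : (GlobalField.FiniteAdeleRing K)ˣ).1 * y.2) := by
    funext y
    rw [schwartzBox, hp₀, sub_zero, finprod_eq_prod_of_fintype, Complex.ofReal_prod]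
  have hnd := eq_zero_of_forall_mul_eq_one (ψ := ψ) (μ := μ) fun z hz =>
    (GlobalField.exists_mem_schwartzBruhat_ne hz).imp fun f hf => ⟨hμ f hf.1, hf.2⟩
  have hmod := GlobalField.hasModulus_ideleNorm μ x
  have hmem : (show GlobalField.AdeleRing K → ℂ from
      schwartzBox (E := ∀ v : NumberField.InfinitePlace K, v.Completion)
        (GlobalField.FiniteAdeleRing.integers K) g₀ 1 0) ∈ GlobalField.schwartzBruhat K :=
    hbox ▸ GlobalField.mem_schwartzBruhat_of_isSchwartz hb 1
  let A := (∀ v : NumberField.InfinitePlace K, v.Completion) × GlobalField.FiniteAdeleRing K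
  let _ : MeasurableSpace A := borel A
  have : BorelSpace A := ⟨rfl⟩
  let _ : Algebra K A := GlobalField.AdeleRing.instAlgebraOfIsGlobalField K
  let μ' : Measure A := μ
  have : μ'.IsAddHaarMeasure := ‹μ.IsAddHaarMeasure›
  have h := tsum_eq_tsum_ringFourier_of_mem_span (K := K) (μ := μ') (ψ := ψ)
    (O := GlobalField.FiniteAdeleRing.integers K) hψ_cont hψ_ne hψ_K hnd hC hKC
    GlobalField.FiniteAdeleRing.isCompact_integers GlobalField.FiniteAdeleRing.isOpen_integers
    hp₀ (fun y => Finset.prod_nonneg fun v _ => hb0 v _)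
    (by simp only [Pi.zero_apply, hb1, Finset.prod_const_one]; exact one_pos)
    (fun y => Finset.prod_congr rfl fun v _ => hbn v _)
    (hμ _ hmem) (GlobalField.mem_span_schwartzBox hf) x
    (Complex.ofReal_ne_zero.2 hmod.1.ne') hmod.integral_mul
  exact h.2
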